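/- **Setting.** An instance $I$ of the Bayesian principal-multi-agent problem consists of finite sets $N$ of $n\ge 1$ agents, $\Theta$ of types, $\Omega$ of outcomes and $A$ of actions; rational probability distributions $F_{i,\theta,a}$ on $\Omega$ and rational costs $c_{i,\theta,a}\in[0,1]$ for $i\in N,\theta\in\Theta,a\in A$, such that some action $a_\varnothing$ has $c_{i,\theta,a_\varnothing}=0$ for all $i,\theta$; a rational probability distribution $\lambda$ on $\Theta^n$; and rewards $r_{\boldsymbol\omega}\in[0,1]$ for $\boldsymbol\omega\in\Omega^n$. Put $R_{\boldsymbol\theta,\boldsymbol a}=\sum_{\boldsymbol\omega}r_{\boldsymbol\omega}\prod_{i}F_{i,\theta_i,a_i,\omega_i}$, $\tilde\Theta^n=\mathrm{supp}(\lambda)$ and $\tilde\Theta^n_{-i}=\{\boldsymbol\theta_{-i}:\boldsymbol\theta\in\tilde\Theta^n\}$. The size $|I|$ is the number of bits of a list of $n,|\Theta|,|\Omega|,|A|$, all $F_{i,\theta,a,\omega}$ and $c_{i,\theta,a}$, and the elements of $\tilde\Theta^n$ with their probabilities (rewards are not written down). An action $a$ is incentive compatible (IC) for agent $i$ of type $\theta$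 under payments $p\in\mathbb R_+^{N\times\Omega}$ if it maximizes $\sum_\omega F_{i,\theta,a,\omega}p_{i,\omega}-c_{i,\theta,a}$ over $A$; $A_{i,\theta}$ is the set of *inducible* actions, those that are IC under some $p\in\mathbb R_+^{N\times\Omega}$; and $A^{n,\boldsymbol\theta}=\prod_iA_{i,\theta_i}$. **Supremum problem.** A *feasible menu* (a DSIC menu of randomized contracts) consists of nonnegative numbers $t_{\boldsymbol\theta,\boldsymbol a}$ ($\boldsymbol\theta\in\tilde\Theta^n,\boldsymbol a\in A^n$), and $\xi_{i,\boldsymbol\theta,a}$, $p_{i,\boldsymbol\theta,a,\omega}$ ($\boldsymbol\theta_{-i}\in\tilde\Theta^n_{-i}$, $\theta_i\in\Theta$, $a\in A$, $\omega\in\Omega$) with $\sum_a\xi_{i,\boldsymbol\theta,a}=1$ whenever $\boldsymbol\theta_{-i}\in\tilde\Theta_{-i}^n$; $\sum_{\boldsymbol a:a_i=a}t_{\boldsymbol\theta,\boldsymbol a}=\xi_{i,\boldsymbol\theta,a}$ for $\boldsymbol\theta\in\tilde\Theta^n$; and, for all $i$, $\boldsymbol\theta\in\tilde\Theta^n$,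 $\theta\in\Theta$, $$\sum_{a}\xi_{i,\boldsymbol\theta,a}\Big(\sum_\omega F_{i,\theta_i,a,\omega}p_{i,\boldsymbol\theta,a,\omega}-c_{i,\theta_i,a}\Big)\ \ge\ \sum_a\xi_{i,(\theta,\boldsymbol\theta_{-i}),a}\max_{a'\in A}\Big\{\sum_\omega F_{i,\theta_i,a',\omega}p_{i,(\theta,\boldsymbol\theta_{-i}),a,\omega}-c_{i,\theta_i,a'}\Big\}.$$ Its value is $\sum_{\boldsymbol\theta}\lambda_{\boldsymbol\theta}\sum_{\boldsymbol a}t_{\boldsymbol\theta,\boldsymbol a}R_{\boldsymbol\theta,\boldsymbol a}-\sum_i\sum_{\boldsymbol\theta}\lambda_{\boldsymbol\theta}\sum_a\xi_{i,\boldsymbol\theta,a}\sum_\omega F_{i,\theta_i,a,\omega}p_{i,\boldsymbol\theta,a,\omega}$, and $\mathrm{SUP}$ is the supremum of the values of the feasible menus. **Linear program.** Maximize $\sum_{\boldsymbol\theta}\lambda_{\boldsymbol\theta}\sum_{\boldsymbol a\in A^{n,\boldsymbol\theta}}t_{\boldsymbol\theta,\boldsymbol a}R_{\boldsymbol\theta,\boldsymbol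 a}-\sum_i\sum_{\boldsymbol\theta}\lambda_{\boldsymbol\theta}\sum_{a\in A_{i,\theta_i}}\sum_\omega F_{i,\theta_i,a,\omega}y_{i,\boldsymbol\theta,a,\omega}$ over $t_{\boldsymbol\theta,\boldsymbol a}\ge0$ ($\boldsymbol\theta\in\tilde\Theta^n$, $\boldsymbol a\in A^{n,\boldsymbol\theta}$), $\xi_{i,\boldsymbol\theta,a},y_{i,\boldsymbol\theta,a,\omega}\ge0$ ($\boldsymbol\theta_{-i}\in\tilde\Theta^n_{-i}$, $a\in A_{i,\theta_i}$) and $\gamma_{i,\boldsymbol\theta,\theta,a}\in\mathbb R$ ($\boldsymbol\theta\in\tilde\Theta^n$, $\theta\in\Theta$, $a\in A_{i,\theta}$), subject to $\sum_{a\in A_{i,\theta_i}}\big(\sum_\omega F_{i,\theta_i,a,\omega}y_{i,\boldsymbol\theta,a,\omega}-\xi_{i,\boldsymbol\theta,a}c_{i,\theta_i,a}\big)\ge\sum_{a\in A_{i,\theta}}\gamma_{i,\boldsymbol\theta,\theta,a}$ and $\gamma_{i,\boldsymbol\theta,\theta,a}\ge\sum_\omega F_{i,\theta_i,a',\omega}y_{i,(\theta,\boldsymbol\theta_{-i}),a,\omega}-\xi_{i,(\theta,\boldsymbol\theta_{-i}),a}c_{i,\theta_i,a'}$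 for $\boldsymbol\theta\in\tilde\Theta^n$, $\theta\in\Theta$, $a\in A_{i,\theta}$, $a'\in A_{i,\theta_i}$; $\sum_{a\in A_{i,\theta_i}}\xi_{i,\boldsymbol\theta,a}=1$ for $\boldsymbol\theta_{-i}\in\tilde\Theta^n_{-i}$; and $\sum_{\boldsymbol a\in A^{n,\boldsymbol\theta}:a_i=a}t_{\boldsymbol\theta,\boldsymbol a}=\xi_{i,\boldsymbol\theta,a}$ for $\boldsymbol\theta\in\tilde\Theta^n$, $a\in A_{i,\theta_i}$. Let $\mathrm{LP}$ be its optimal value. A feasible solution is *irregular* if $y_{i,\boldsymbol\theta,a,\omega}>0$ and $\xi_{i,\boldsymbol\theta,a}=0$ for some $i,\boldsymbol\theta,a,\omega$, and *regular* otherwise. A *payment bound* is a function $\tau:\mathbb N\to\mathbb R$ with $\tau(x)=O(2^{\mathrm{poly}(x)})$ such that for all $I$, $i$, $\theta$ and every $a\in A_{i,\theta}$ there is $p\in\mathbb R_+^{N\times\Omega}$ under which $a$ is IC for agent $i$ of type $\theta$, with $p_{i,\omega}\le\tau(|I|)$ for all $\omega$. **Theorem.** 1. A payment bound exists. 2. For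 every instance, $\mathrm{SUP}$ and $\mathrm{LP}$ are finite and $\mathrm{LP}\ge\mathrm{SUP}$. 3. For every payment bound $\tau$, every feasible solution of the linear program with value $v$ and every real $\varepsilon>0$, there is a regular feasible solution of value at least $v-\varepsilon(n\,\tau(|I|)+1)$. 4. There is an algorithm that, given an instance $I$ (without its rewards), an optimal solution $s$ of the linear program with rational entries (written as lists of its nonzero entries, possibly together with some zero entries) and a rational $\varepsilon>0$, returns a feasible menu, written in the same way, whose value is at least $\mathrm{SUP}-\varepsilon(n\,\tau(|I|)+1)$ for every payment bound $\tau$. Its running time is bounded by a polynomial in $1/\varepsilon$ and in the number of bits of its input $(I,s,\varepsilon)$; in particular by a polynomial in $|I|$ and $1/\varepsilon$ if $s$ and $\varepsilon$ are given with polynomially many bits in $|I|$ and $1/\varepsilon$. -/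

import Mathlib

namespace BayesianPMA

/-! ### A machine model with an explicit running time -/

/-- The data on which programs operate: binary trees whose leaves carry integers. -/
inductive Data where
  | int (z : ℤ)
  | pair (x y : Data)

namespace Data

/-- The number of bits of a piece of data (up to a constant factor): an integer is charged the
length of its binary expansion. -/
def size : Data → ℕ
  | int z => 1 + Nat.size z.natAbs
  | pair x y => 1 + x.size + y.size

/-- The outcome of a test: only positive integers count as "true". -/
def IsTrue : Data → Prop
  | int z => 0 < z
  | pair _ _ => False

/-- Lists are represented as nested pairs, terminated by the integer `0`. -/
def ofList : List Data → Data
  | [] => int 0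
  | x :: xs => pair x (ofList xs)

end Data

/-- The elementary instructions. -/
inductive Instr where
  | copy
  | const (z : ℤ)
  | fst
  | snd
  | isInt
  | add
  | sub
  | mul

/-- The effect of an elementary instruction (`0` on arguments of the wrong shape). -/
def Instr.eval : Instr → Data → Data
  | .copy, d => d
  | .const z, _ => .int z
  | .fst, .pair x _ => x
  | .snd, .pair _ y => y
  | .isInt, .int _ => .int 1
  | .add, .pair (.int x) (.int y) => .int (x + y)
  | .sub, .pair (.int x) (.int y) => .int (x - y)
  | .mul, .pair (.int x) (.int y) => .int (x * y)
  | _, _ => .int 0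

/-- The cost of an elementary instruction (logarithmic cost criterion): the bit size of the data
it is applied to, and its square for a multiplication. -/
def Instr.cost : Instr → Data → ℕ
  | .const z, _ => (Data.int z).size
  | .mul, d => d.size ^ 2 + 1
  | _, d => d.size + 1

/-- Programs. -/
inductive Prog where
  | instr (o : Instr)
  | pair (f g : Prog)
  | comp (g f : Prog)
  | ite (c f g : Prog)
  | loop (c f : Prog)

/-- `Runs f d x s`: the program `f`, started on the data `d`, halts with output `x` after time
`s`. `pair f g` runs `f` and `g` on copies of the same data, `comp g f` runs `g` on the output
of `f`, `ite c f g` branches on the test `c`, and `loop c f` is "while `c` do `f`". Copying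
data costs its bit size, so all the data that is ever produced has bit size at most the time. -/
inductive Runs : Prog → Data → Data → ℕ → Prop where
  | instr (o : Instr) (d : Data) : Runs (.instr o) d (o.eval d) (o.cost d)
  | pair {f g : Prog} {d x y : Data} {s t : ℕ} :
      Runs f d x s → Runs g d y t → Runs (.pair f g) d (.pair x y) (s + t + d.size)
  | comp {g f : Prog} {d x y : Data} {s t : ℕ} :
      Runs f d x s → Runs g x y t → Runs (.comp g f) d y (s + t + 1)
  | ite_true {c f g : Prog} {d b x : Data} {s t : ℕ} :
      Runs c d b s → b.IsTrue → Runs f d x t → Runs (.ite c f g) d x (s + t + d.size)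
  | ite_false {c f g : Prog} {d b x : Data} {s t : ℕ} :
      Runs c d b s → ¬ b.IsTrue → Runs g d x t → Runs (.ite c f g) d x (s + t + d.size)
  | loop_stop {c f : Prog} {d b : Data} {s : ℕ} :
      Runs c d b s → ¬ b.IsTrue → Runs (.loop c f) d d (s + d.size)
  | loop_step {c f : Prog} {d b x y : Data} {s t u : ℕ} :
      Runs c d b s → b.IsTrue → Runs f d x t → Runs (.loop c f) x y u →
        Runs (.loop c f) d y (s + t + u + d.size)

/-! ### Bayesian principal-multi-agent problems -/

/-- An instance of the Bayesian principal-multi-agent problem. Agents, types, outcomes and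
actions are numbered. The numbers `F i θ a ω`, `cost i θ a` and the prior are rational, being
part of the finite input; the prior is given by the list of the type profiles in its support,
together with their probabilities. The rewards of the principal may be arbitrary reals in
`[0, 1]`. -/
structure Instance where
  numAgents : ℕ
  numTypes : ℕ
  numOutcomes : ℕ
  numActions : ℕ
  numAgents_pos : 0 < numAgents
  /-- `F i θ a ω`: the probability of outcome `ω` if agent `i` of type `θ` plays `a`. -/
  F : Fin numAgents → Fin numTypes → Fin numActions → Fin numOutcomes → ℚ
  F_nonneg : ∀ i θ a ω, 0 ≤ F i θ a ω
  F_sum : ∀ i θ a, ∑ ω, F i θ a ω = 1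
  cost : Fin numAgents → Fin numTypes → Fin numActions → ℚ
  cost_mem : ∀ i θ a, cost i θ a ∈ Set.Icc (0 : ℚ) 1
  exists_null : ∃ a₀, ∀ i θ, cost i θ a₀ = 0
  prior : (Fin numAgents → Fin numTypes) → ℚ
  prior_nonneg : ∀ θ, 0 ≤ prior θ
  prior_sum : ∑ θ, prior θ = 1
  support : List (Fin numAgents → Fin numTypes)
  support_nodup : support.Nodup
  mem_support : ∀ θ, θ ∈ support ↔ prior θ ≠ 0
  reward : (Fin numAgents → Fin numOutcomes) → ℝ
  reward_mem : ∀ ω, reward ω ∈ Set.Icc (0 : ℝ) 1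

namespace Instance

variable (I : Instance)

abbrev Agent : Type := Fin I.numAgents
abbrev AgentType : Type := Fin I.numTypes
abbrev Outcome : Type := Fin I.numOutcomes
abbrev Action : Type := Fin I.numActions
/-- Tuples of agents' types. -/
abbrev TypeProfile : Type := I.Agent → I.AgentType
/-- Tuples of agents' actions. -/
abbrev ActionProfile : Type := I.Agent → I.Action

/-- The expected payment to agent `i` of type `θ` playing `a` under the payment scheme `q`. -/
noncomputable def pay (i : I.Agent) (θ : I.AgentType) (a : I.Action) (q : I.Outcome → ℝ) : ℝ :=
  ∑ ω, (I.F i θ a ω : ℝ) * q ω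

/-- The expected reward `R_{θ, a}` of the principal. -/
noncomputable def expReward (θ : I.TypeProfile) (a : I.ActionProfile) : ℝ :=
  ∑ ω : I.Agent → I.Outcome, I.reward ω * ∏ i, (I.F i (θ i) (a i) (ω i) : ℝ)

/-- The set `A*_{i, θ}(p)` of incentive compatible actions of agent `i` of type `θ`. -/
def icActions (i : I.Agent) (θ : I.AgentType) (p : I.Agent → I.Outcome → ℝ) : Set I.Action :=
  {a | ∀ a', I.pay i θ a' (p i) - (I.cost i θ a' : ℝ) ≤ I.pay i θ a (p i) - (I.cost i θ a : ℝ)}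

open Classical in
/-- The set `A_{i, θ}` of inducible actions of agent `i` of type `θ`. -/
noncomputable def inducible (i : I.Agent) (θ : I.AgentType) : Finset I.Action :=
  {a | ∃ p : I.Agent → I.Outcome → ℝ, (∀ j ω, 0 ≤ p j ω) ∧ a ∈ I.icActions i θ p}

/-- `θ = (θ_i, θ_{-i})` where `θ_{-i}` extends to a type profile in the support of the prior:
the profiles that can be reported if all the agents other than `i` are truthful. -/
def IsReport (i : I.Agent) (θ : I.TypeProfile) : Prop :=
  ∃ θ' ∈ I.support, ∀ j, j ≠ i → θ' j = θ j

/-- The type profile `(θ', θ_{-i})`. -/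
def deviate (θ : I.TypeProfile) (i : I.Agent) (θ' : I.AgentType) : I.TypeProfile :=
  Function.update θ i θ'

/-! ### The supremum problem -/

/-- The variables of the principal's problem: `t θ a` is the probability that the action
recommendations `a` are drawn when `θ` is reported, `ξ i θ a` the probability that agent `i` is
recommended `a`, and `p i θ a ω` the payment to agent `i` when they are recommended `a` and the
outcome is `ω`. -/
structure Menu where
  t : I.TypeProfile → I.ActionProfile → ℝ
  ξ : I.Agent → I.TypeProfile → I.Action → ℝ
  p : I.Agent → I.TypeProfile → I.Action → I.Outcome → ℝ

variable {I} in
/-- The principal's expected utility. -/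
noncomputable def Menu.value (μ : I.Menu) : ℝ :=
  ∑ θ, (I.prior θ : ℝ) * ∑ a, μ.t θ a * I.expReward θ a
    - ∑ i, ∑ θ, (I.prior θ : ℝ) * ∑ a, μ.ξ i θ a * I.pay i (θ i) a (μ.p i θ a)

variable {I} in
/-- Feasibility for the principal's problem, i.e. the menu is well defined and DSIC. -/
structure Menu.Feasible (μ : I.Menu) : Prop where
  dsic : ∀ i, ∀ θ ∈ I.support, ∀ θ' : I.AgentType,
    ∑ a, μ.ξ i (I.deviate θ i θ') a *
        (⨆ a', (I.pay i (θ i) a' (μ.p i (I.deviate θ i θ') a) - (I.cost i (θ i) a' : ℝ)))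
      ≤ ∑ a, μ.ξ i θ a * (I.pay i (θ i) a (μ.p i θ a) - (I.cost i (θ i) a : ℝ))
  sum_ξ : ∀ i θ, I.IsReport i θ → ∑ a, μ.ξ i θ a = 1
  marginal : ∀ i, ∀ θ ∈ I.support, ∀ a,
    ∑ b : I.ActionProfile with b i = a, μ.t θ b = μ.ξ i θ a
  t_nonneg : ∀ θ ∈ I.support, ∀ a, 0 ≤ μ.t θ a
  ξ_nonneg : ∀ i θ, I.IsReport i θ → ∀ a, 0 ≤ μ.ξ i θ a
  p_nonneg : ∀ i θ, I.IsReport i θ → ∀ a ω, 0 ≤ μ.p i θ a ω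

/-- The values of the feasible menus. -/
def menuValues : Set ℝ := {v | ∃ μ : I.Menu, μ.Feasible ∧ μ.value = v}

/-- `SUP`, the value of the supremum problem. -/
noncomputable def supValue : ℝ := sSup I.menuValues

/-! ### The linear program -/

/-- The set `A^{n, θ}` of tuples of inducible actions. -/
noncomputable def inducibleProfiles (θ : I.TypeProfile) : Finset I.ActionProfile :=
  Fintype.piFinset fun i => I.inducible i (θ i)

/-- An assignment of values to the variables of the linear program. -/
structure LPPoint where
  t : I.TypeProfile → I.ActionProfile → ℝ
  ξ : I.Agent → I.TypeProfile → I.Action → ℝ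
  y : I.Agent → I.TypeProfile → I.Action → I.Outcome → ℝ
  γ : I.Agent → I.TypeProfile → I.AgentType → I.Action → ℝ

variable {I} in
/-- The objective of the linear program. -/
noncomputable def LPPoint.value (s : I.LPPoint) : ℝ :=
  ∑ θ, (I.prior θ : ℝ) * ∑ a ∈ I.inducibleProfiles θ, s.t θ a * I.expReward θ a
    - ∑ i, ∑ θ, (I.prior θ : ℝ) * ∑ a ∈ I.inducible i (θ i), I.pay i (θ i) a (s.y i θ a)

variable {I} in
/-- Feasibility for the linear program. The `_index` conditions say that there are no variables
other than those of the program: the entries outside its index sets are `0`. -/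
structure LPPoint.Feasible (s : I.LPPoint) : Prop where
  dsic : ∀ i, ∀ θ ∈ I.support, ∀ θ' : I.AgentType,
    ∑ a ∈ I.inducible i θ', s.γ i θ θ' a
      ≤ ∑ a ∈ I.inducible i (θ i),
          (I.pay i (θ i) a (s.y i θ a) - s.ξ i θ a * (I.cost i (θ i) a : ℝ))
  γ_ge : ∀ i, ∀ θ ∈ I.support, ∀ θ' : I.AgentType,
    ∀ a ∈ I.inducible i θ', ∀ a' ∈ I.inducible i (θ i),
      I.pay i (θ i) a' (s.y i (I.deviate θ i θ') a)
          - s.ξ i (I.deviate θ i θ') a * (I.cost i (θ i) a' : ℝ)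
        ≤ s.γ i θ θ' a
  sum_ξ : ∀ i θ, I.IsReport i θ → ∑ a ∈ I.inducible i (θ i), s.ξ i θ a = 1
  marginal : ∀ i, ∀ θ ∈ I.support, ∀ a ∈ I.inducible i (θ i),
    ∑ b ∈ I.inducibleProfiles θ with b i = a, s.t θ b = s.ξ i θ a
  t_nonneg : ∀ θ ∈ I.support, ∀ a ∈ I.inducibleProfiles θ, 0 ≤ s.t θ a
  ξ_nonneg : ∀ i θ, I.IsReport i θ → ∀ a ∈ I.inducible i (θ i), 0 ≤ s.ξ i θ a
  y_nonneg : ∀ i θ, I.IsReport i θ → ∀ a ∈ I.inducible i (θ i), ∀ ω, 0 ≤ s.y i θ a ω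
  t_index : ∀ θ a, s.t θ a ≠ 0 → θ ∈ I.support ∧ a ∈ I.inducibleProfiles θ
  ξ_index : ∀ i θ a, s.ξ i θ a ≠ 0 → I.IsReport i θ ∧ a ∈ I.inducible i (θ i)
  y_index : ∀ i θ a ω, s.y i θ a ω ≠ 0 → I.IsReport i θ ∧ a ∈ I.inducible i (θ i)
  γ_index : ∀ i θ θ' a, s.γ i θ θ' a ≠ 0 → θ ∈ I.support ∧ a ∈ I.inducible i θ'

variable {I} in
/-- Optimal solutions of the linear program. -/
def LPPoint.Optimal (s : I.LPPoint) : Prop :=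
  s.Feasible ∧ ∀ s' : I.LPPoint, s'.Feasible → s'.value ≤ s.value

variable {I} in
/-- Irregular points: `y > 0` while `ξ = 0`. -/
def LPPoint.Irregular (s : I.LPPoint) : Prop :=
  ∃ i θ, ∃ a ∈ I.inducible i (θ i), ∃ ω, 0 < s.y i θ a ω ∧ s.ξ i θ a = 0

/-- The values of the feasible solutions of the linear program. -/
def lpValues : Set ℝ := {v | ∃ s : I.LPPoint, s.Feasible ∧ s.value = v}

/-- `LP`, the value of the linear program. -/
noncomputable def lpValue : ℝ := sSup I.lpValues

end Instance

/-! ### Representing the inputs and outputs of programs -/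

/-- A natural number as data. -/
def encNat (n : ℕ) : Data := .int n

/-- A rational number as data: its reduced numerator and denominator. -/
def encRat (q : ℚ) : Data := .pair (.int q.num) (.int q.den)

/-- A finite sequence as a list. -/
def encSeq {n : ℕ} (f : Fin n → Data) : Data := Data.ofList (List.ofFn f)

/-- A tuple of types or actions as the list of its components. -/
def encTuple {n k : ℕ} (f : Fin n → Fin k) : Data := encSeq fun i => encNat (f i)

/-- The representation of a real-valued function with finitely many nonzero values, all of them
rational, as a list of pairs of a key and a value (numerator and denominator, not necessarily in
lowest terms). No key is listed twice, and the function is zero at all the keys that are not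
listed. -/
def IsTable {K : Type} (encKey : K → Data) (f : K → ℝ) (d : Data) : Prop :=
  ∃ L : List (K × ℤ × ℕ),
    (L.map fun e => e.1).Nodup ∧
    (∀ e ∈ L, 0 < e.2.2 ∧ f e.1 = (e.2.1 : ℝ) / (e.2.2 : ℝ)) ∧
    (∀ x, f x ≠ 0 → x ∈ L.map fun e => e.1) ∧
    d = Data.ofList (L.map fun e => .pair (encKey e.1) (.pair (.int e.2.1) (encNat e.2.2)))

namespace Instance

variable (I : Instance)

/-- An instance as data: the four cardinalities, the tables of the probabilities `F` and of the
costs, and the type profiles in the support of the prior with their probabilities. The rewards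
are not written down. -/
def enc : Data :=
  Data.ofList
    [encNat I.numAgents, encNat I.numTypes, encNat I.numOutcomes, encNat I.numActions,
      encSeq fun i => encSeq fun θ => encSeq fun a => encSeq fun ω => encRat (I.F i θ a ω),
      encSeq fun i => encSeq fun θ => encSeq fun a => encRat (I.cost i θ a),
      Data.ofList (I.support.map fun θ => .pair (encTuple θ) (encRat (I.prior θ)))]

/-- The size `|I|` of an instance, in bits. -/
def size : ℕ := I.enc.size

/-- Tables of the probabilities `t θ a`. -/
def IsTTable (t : I.TypeProfile → I.ActionProfile → ℝ) (d : Data) : Prop :=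
  IsTable (K := I.TypeProfile × I.ActionProfile)
    (fun x => Data.ofList [encTuple x.1, encTuple x.2]) (fun x => t x.1 x.2) d

/-- Tables of the probabilities `ξ i θ a`. -/
def IsXiTable (ξ : I.Agent → I.TypeProfile → I.Action → ℝ) (d : Data) : Prop :=
  IsTable (K := I.Agent × I.TypeProfile × I.Action)
    (fun x => Data.ofList [encNat x.1, encTuple x.2.1, encNat x.2.2])
    (fun x => ξ x.1 x.2.1 x.2.2) d

/-- Tables of the quantities `y i θ a ω` or `p i θ a ω`. -/
def IsPayTable (y : I.Agent → I.TypeProfile → I.Action → I.Outcome → ℝ) (d : Data) : Prop :=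
  IsTable (K := I.Agent × I.TypeProfile × I.Action × I.Outcome)
    (fun x => Data.ofList [encNat x.1, encTuple x.2.1, encNat x.2.2.1, encNat x.2.2.2])
    (fun x => y x.1 x.2.1 x.2.2.1 x.2.2.2) d

/-- Tables of the quantities `γ i θ θ' a`. -/
def IsGammaTable (γ : I.Agent → I.TypeProfile → I.AgentType → I.Action → ℝ) (d : Data) : Prop :=
  IsTable (K := I.Agent × I.TypeProfile × I.AgentType × I.Action)
    (fun x => Data.ofList [encNat x.1, encTuple x.2.1, encNat x.2.2.1, encNat x.2.2.2])
    (fun x => γ x.1 x.2.1 x.2.2.1 x.2.2.2) d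

variable {I} in
/-- `d` represents the point `s` of the linear program. -/
def LPPoint.IsEncoding (s : I.LPPoint) (d : Data) : Prop :=
  ∃ dt dξ dy dγ, I.IsTTable s.t dt ∧ I.IsXiTable s.ξ dξ ∧ I.IsPayTable s.y dy ∧
    I.IsGammaTable s.γ dγ ∧ d = Data.ofList [dt, dξ, dy, dγ]

variable {I} in
/-- `d` represents the menu `μ`. -/
def Menu.IsEncoding (μ : I.Menu) (d : Data) : Prop :=
  ∃ dt dξ dp, I.IsTTable μ.t dt ∧ I.IsXiTable μ.ξ dξ ∧ I.IsPayTable μ.p dp ∧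
    d = Data.ofList [dt, dξ, dp]

end Instance

/-- `τ` is `O(2^poly)` and bounds the payments that are needed to induce inducible actions, in
terms of the size of the instance. -/
structure IsPaymentBound (τ : ℕ → ℝ) : Prop where
  isBigO : ∃ Q : Polynomial ℕ, τ =O[Filter.atTop] fun x : ℕ => (2 : ℝ) ^ (Q.eval x)
  bound : ∀ (I : Instance) (i : I.Agent) (θ : I.AgentType), ∀ a ∈ I.inducible i θ,
    ∃ p : I.Agent → I.Outcome → ℝ, (∀ j ω, 0 ≤ p j ω) ∧ a ∈ I.icActions i θ p ∧
      ∀ ω, p i ω ≤ τ I.size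

end BayesianPMA

open BayesianPMA

/-!
The idea is to work with *schemes* (`Instance.IsScheme`): points `(t, ξ, y)` of the linear program
in which the variables `γ` are replaced with the utilities `util` that they stand for, and in which
deviating agents may choose among all actions instead of the inducible ones. `util i θ Y w`, the
utility from payments of expected value `Y` that come with probability `w`, is sublinear in `(Y, w)`
and makes sense for `w = 0`. Best responses are always inducible, so a bound for the inducible
actions holds for all actions if `w > 0`, and by continuity also if `w = 0`
(`Instance.pay_sub_le_of_inducible`). Hence the feasible points of the linear program are exactly
the schemes, up to the choice of `γ` (`Instance.LPPoint.Feasible.isScheme`,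
`Instance.IsScheme.exists_feasible`). A feasible menu becomes a scheme of the same value if every
recommendation is replaced with the action that the agent would choose, and the payments are
multiplied with their probabilities (`Instance.Menu.Feasible.exists_isScheme`); conversely, a scheme
without payments of probability `0` becomes a menu by division (`Instance.IsScheme.menu`). As values
are at most `1`, this proves that `SUP` and `LP` are finite and that `SUP ≤ LP`.

A payment bound exists because the payments that induce an action form a polyhedron given by
inequalities with coefficients of polynomially many bits; by Carathéodory's theorem and Cramer's
rule it has a point with coordinates of polynomially many bits (`exists_isPaymentBound`).

To make a scheme regular, it is mixed with a lottery that ignores the reports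
(`Instance.Relocates`). The lottery draws one of the payment schemes `K • y i θ a` of the given
scheme itself, and every agent chooses a best response to it. Since the lottery does not depend on
the reports, the mixture is again DSIC; merging the payments that lead to the same action is
harmless because `util` is sublinear. If `K` is so large that all nonzero differences of expected
payments become larger than the costs, then the best responses to `K • y i θ a` maximize the
expected payment from `y i θ a`. Therefore a payment `y i θ a` of probability `0` can be moved to the
best response to `K • y i θ a`, without a change of the utility of truthful agents, and this action is
played with positive probability in the mixture. The loss tends to `0` with the weight of the
lottery (`Instance.Relocates.value_ge`). So a loss of at most `ε` can be achieved, whatever `τ` is;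
the bound of the theorem is weaker since `τ` is nonnegative at the sizes of instances
(`IsPaymentBound.nonneg`).

The same construction is an algorithm if the solution is rational: twice a common denominator of all
expected payments can be taken for `K`, and the weight of the lottery is computed from `K`, the
entries of `y` and the denominator of `ε`. These numbers have polynomially many bits, the lottery
has one payment scheme for each entry of the table of `y`, and the best responses of single agents
are found by enumerating actions; neither a linear program has to be solved nor the reports or
action profiles be listed. The running time is bounded by means of a class of functions
`PolyTime` that is closed under composition, pairing, arithmetic, tests and iterations over lists in
which intermediate results do not become too large (`PolyTime.foldl_of_bound`), and that contains
the algorithm (`PolyTime.algorithm`). Its correctness is `Instance.IsScheme.exists_menu`.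
-/

namespace BayesianPMA

namespace Instance

variable {I : Instance}

/-! ### Best responses and the utility of a deviation -/

theorem pay_add (i : I.Agent) (θ : I.AgentType) (a : I.Action) (q r : I.Outcome → ℝ) :
    I.pay i θ a (q + r) = I.pay i θ a q + I.pay i θ a r := by
  simp [pay, mul_add, Finset.sum_add_distrib]

theorem pay_smul (i : I.Agent) (θ : I.AgentType) (a : I.Action) (x : ℝ) (q : I.Outcome → ℝ) :
    I.pay i θ a (x • q) = x * I.pay i θ a q := by
  simp only [pay, Finset.mul_sum, Pi.smul_apply, smul_eq_mul]
  exact Finset.sum_congr rfl fun _ _ => by ring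

theorem pay_zero (i : I.Agent) (θ : I.AgentType) (a : I.Action) : I.pay i θ a 0 = 0 := by
  simp [pay]

theorem pay_sum {κ : Type*} (S : Finset κ) (i : I.Agent) (θ : I.AgentType) (a : I.Action)
    (q : κ → I.Outcome → ℝ) : I.pay i θ a (∑ k ∈ S, q k) = ∑ k ∈ S, I.pay i θ a (q k) := by
  classical
  induction S using Finset.induction_on with
  | empty => simp [pay_zero]
  | insert k S hk ih => rw [Finset.sum_insert hk, Finset.sum_insert hk, pay_add, ih]

theorem pay_nonneg (i : I.Agent) (θ : I.AgentType) (a : I.Action) {q : I.Outcome → ℝ}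
    (hq : ∀ ω, 0 ≤ q ω) : 0 ≤ I.pay i θ a q :=
  Finset.sum_nonneg fun ω _ => mul_nonneg (by exact_mod_cast I.F_nonneg i θ a ω) (hq ω)

theorem pay_le (i : I.Agent) (θ : I.AgentType) (a : I.Action) {q : I.Outcome → ℝ} {C : ℝ}
    (hq : ∀ ω, q ω ≤ C) : I.pay i θ a q ≤ C := by
  have hF : ∑ ω, (I.F i θ a ω : ℝ) = 1 := by exact_mod_cast I.F_sum i θ a
  calc I.pay i θ a q ≤ ∑ ω, (I.F i θ a ω : ℝ) * C :=
        Finset.sum_le_sum fun ω _ =>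
          mul_le_mul_of_nonneg_left (hq ω) (by exact_mod_cast I.F_nonneg i θ a ω)
    _ = C := by rw [← Finset.sum_mul, hF, one_mul]

theorem cost_nonneg (i : I.Agent) (θ : I.AgentType) (a : I.Action) : 0 ≤ (I.cost i θ a : ℝ) := by
  exact_mod_cast (I.cost_mem i θ a).1

theorem cost_le_one (i : I.Agent) (θ : I.AgentType) (a : I.Action) :
    (I.cost i θ a : ℝ) ≤ 1 := by
  exact_mod_cast (I.cost_mem i θ a).2

theorem nonempty_action (I : Instance) : Nonempty I.Action :=
  let ⟨a, _⟩ := I.exists_null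
  ⟨a⟩

/-- `a` is a best response of agent `i` of type `θ` to the payments `q`. -/
def IsBest (i : I.Agent) (θ : I.AgentType) (q : I.Outcome → ℝ) (a : I.Action) : Prop :=
  ∀ a', I.pay i θ a' q - (I.cost i θ a' : ℝ) ≤ I.pay i θ a q - (I.cost i θ a : ℝ)

theorem exists_isBest (i : I.Agent) (θ : I.AgentType) (q : I.Outcome → ℝ) :
    ∃ a, I.IsBest i θ q a := by
  have := I.nonempty_action
  exact Finite.exists_max fun a => I.pay i θ a q - (I.cost i θ a : ℝ)

theorem IsBest.mem_inducible {i : I.Agent} {θ : I.AgentType} {q : I.Outcome → ℝ} {a : I.Action}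
    (h : I.IsBest i θ q a) (hq : ∀ ω, 0 ≤ q ω) : a ∈ I.inducible i θ := by
  simp only [inducible, Finset.mem_filter, Finset.mem_univ, true_and]
  exact ⟨fun _ => q, fun _ => hq, h⟩

/-- The contribution to the utility of agent `i` of type `θ` of a payment scheme `Y / w` that is
drawn with probability `w`, if the agent responds optimally. For `w = 0` this is the limit of the
contributions of payment schemes of expected value `Y` that become arbitrarily unlikely. -/
noncomputable def util (i : I.Agent) (θ : I.AgentType) (Y : I.Outcome → ℝ) (w : ℝ) : ℝ :=
  ⨆ a', (I.pay i θ a' Y - w * (I.cost i θ a' : ℝ))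

theorem le_util (i : I.Agent) (θ : I.AgentType) (Y : I.Outcome → ℝ) (w : ℝ) (a : I.Action) :
    I.pay i θ a Y - w * (I.cost i θ a : ℝ) ≤ I.util i θ Y w :=
  le_ciSup (f := fun a' => I.pay i θ a' Y - w * (I.cost i θ a' : ℝ))
    (Set.finite_range _).bddAbove a

theorem util_le {i : I.Agent} {θ : I.AgentType} {Y : I.Outcome → ℝ} {w x : ℝ}
    (h : ∀ a, I.pay i θ a Y - w * (I.cost i θ a : ℝ) ≤ x) : I.util i θ Y w ≤ x :=
  have := I.nonempty_action
  ciSup_le h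

theorem util_zero (i : I.Agent) (θ : I.AgentType) : I.util i θ 0 0 = 0 := by
  have := I.nonempty_action
  simp [util, pay_zero]

theorem util_add_le (i : I.Agent) (θ : I.AgentType) (Y Z : I.Outcome → ℝ) (w x : ℝ) :
    I.util i θ (Y + Z) (w + x) ≤ I.util i θ Y w + I.util i θ Z x :=
  util_le fun a => by
    rw [pay_add]
    linarith [le_util i θ Y w a, le_util i θ Z x a]

theorem util_smul (i : I.Agent) (θ : I.AgentType) {x : ℝ} (hx : 0 ≤ x) (Y : I.Outcome → ℝ)
    (w : ℝ) : I.util i θ (x • Y) (x * w) = x * I.util i θ Y w := by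
  rw [util, util, Real.mul_iSup_of_nonneg hx]
  congr 1
  ext a
  rw [pay_smul]
  ring

theorem util_sum_le {κ : Type*} (S : Finset κ) (i : I.Agent) (θ : I.AgentType)
    (Y : κ → I.Outcome → ℝ) (w : κ → ℝ) :
    I.util i θ (∑ k ∈ S, Y k) (∑ k ∈ S, w k) ≤ ∑ k ∈ S, I.util i θ (Y k) (w k) := by
  refine util_le fun a => ?_
  rw [pay_sum, Finset.sum_mul, ← Finset.sum_sub_distrib]
  exact Finset.sum_le_sum fun k _ => le_util i θ (Y k) (w k) a

theorem IsBest.util_eq {i : I.Agent} {θ : I.AgentType} {q : I.Outcome → ℝ} {a : I.Action}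
    (h : I.IsBest i θ q a) : I.util i θ q 1 = I.pay i θ a q - (I.cost i θ a : ℝ) := by
  refine le_antisymm (util_le fun a' => ?_) ?_
  · rw [one_mul]; exact h a'
  · simpa using le_util i θ q 1 a

/-- A bound for all the inducible actions is a bound for all actions, also if the payments come
with probability `0`: best responses are inducible, so the claim holds for all slightly larger
probabilities. -/
theorem pay_sub_le_of_inducible {i : I.Agent} {θ : I.AgentType} {Y : I.Outcome → ℝ} {w x : ℝ}
    (hY : ∀ ω, 0 ≤ Y ω) (hw : 0 ≤ w)
    (h : ∀ a ∈ I.inducible i θ, I.pay i θ a Y - w * (I.cost i θ a : ℝ) ≤ x) (a : I.Action) :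
    I.pay i θ a Y - w * (I.cost i θ a : ℝ) ≤ x := by
  refine le_of_forall_pos_le_add fun η hη => ?_
  have hpos : 0 < w + η := by linarith
  obtain ⟨b, hb⟩ := exists_isBest i θ ((w + η)⁻¹ • Y)
  have hb' := h b (hb.mem_inducible fun ω => mul_nonneg (inv_nonneg.2 hpos.le) (hY ω))
  have hba := hb a
  simp only [pay_smul] at hba
  have hba' := mul_le_mul_of_nonneg_left hba hpos.le
  rw [mul_sub, mul_sub, mul_inv_cancel_left₀ hpos.ne', mul_inv_cancel_left₀ hpos.ne'] at hba'
  nlinarith [cost_nonneg i θ b, cost_le_one i θ a]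

/-! ### Reports -/

theorem isReport_of_mem {θ : I.TypeProfile} (hθ : θ ∈ I.support) (i : I.Agent) :
    I.IsReport i θ := ⟨θ, hθ, fun _ _ => rfl⟩

theorem isReport_deviate {θ : I.TypeProfile} (hθ : θ ∈ I.support) (i : I.Agent)
    (θ' : I.AgentType) : I.IsReport i (I.deviate θ i θ') :=
  ⟨θ, hθ, fun j hj => by simp [deviate, hj]⟩

@[simp] theorem deviate_same (θ : I.TypeProfile) (i : I.Agent) (θ' : I.AgentType) :
    I.deviate θ i θ' i = θ' := by simp [deviate]

@[simp] theorem deviate_self (θ : I.TypeProfile) (i : I.Agent) : I.deviate θ i (θ i) = θ := by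
  simp [deviate]

theorem prior_eq_zero {θ : I.TypeProfile} (hθ : θ ∉ I.support) : I.prior θ = 0 := by
  by_contra h
  exact hθ ((I.mem_support θ).2 h)

theorem sum_inducible {i : I.Agent} {θ : I.AgentType} {f : I.Action → ℝ}
    (h : ∀ a, f a ≠ 0 → a ∈ I.inducible i θ) :
    ∑ a ∈ I.inducible i θ, f a = ∑ a, f a :=
  Finset.sum_subset (Finset.subset_univ _) fun a _ ha => by
    by_contra hne
    exact ha (h a hne)

theorem mem_inducibleProfiles {θ : I.TypeProfile} {a : I.ActionProfile} :
    a ∈ I.inducibleProfiles θ ↔ ∀ i, a i ∈ I.inducible i (θ i) := by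
  simp [inducibleProfiles]

/-! ### Lottery schemes -/

/-- The points `(t, ξ, y)` of the linear program without the auxiliary variables `γ`, which are
replaced with the utilities they stand for. All sums extend over all actions, the index
conditions making the additional terms vanish. -/
structure IsScheme (t : I.TypeProfile → I.ActionProfile → ℝ)
    (ξ : I.Agent → I.TypeProfile → I.Action → ℝ)
    (y : I.Agent → I.TypeProfile → I.Action → I.Outcome → ℝ) : Prop where
  dsic : ∀ i, ∀ θ ∈ I.support, ∀ θ' : I.AgentType,
    ∑ a, I.util i (θ i) (y i (I.deviate θ i θ') a) (ξ i (I.deviate θ i θ') a)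
      ≤ ∑ a, (I.pay i (θ i) a (y i θ a) - ξ i θ a * (I.cost i (θ i) a : ℝ))
  sum_ξ : ∀ i θ, I.IsReport i θ → ∑ a, ξ i θ a = 1
  marginal : ∀ i, ∀ θ ∈ I.support, ∀ a, ∑ b : I.ActionProfile with b i = a, t θ b = ξ i θ a
  t_nonneg : ∀ θ a, 0 ≤ t θ a
  ξ_nonneg : ∀ i θ a, 0 ≤ ξ i θ a
  y_nonneg : ∀ i θ a ω, 0 ≤ y i θ a ω
  t_index : ∀ θ a, t θ a ≠ 0 → θ ∈ I.support ∧ a ∈ I.inducibleProfiles θ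
  ξ_index : ∀ i θ a, ξ i θ a ≠ 0 → I.IsReport i θ ∧ a ∈ I.inducible i (θ i)
  y_index : ∀ i θ a ω, y i θ a ω ≠ 0 → I.IsReport i θ ∧ a ∈ I.inducible i (θ i)

/-- The principal's expected utility from `(t, ξ, y)`. -/
noncomputable def schemeValue (t : I.TypeProfile → I.ActionProfile → ℝ)
    (y : I.Agent → I.TypeProfile → I.Action → I.Outcome → ℝ) : ℝ :=
  ∑ θ, (I.prior θ : ℝ) * ∑ a, t θ a * I.expReward θ a
    - ∑ i, ∑ θ, (I.prior θ : ℝ) * ∑ a, I.pay i (θ i) a (y i θ a)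

section Basic

variable {t : I.TypeProfile → I.ActionProfile → ℝ}
  {ξ : I.Agent → I.TypeProfile → I.Action → ℝ}
  {y : I.Agent → I.TypeProfile → I.Action → I.Outcome → ℝ}

theorem IsScheme.y_eq_zero (h : I.IsScheme t ξ y) {i : I.Agent} {θ : I.TypeProfile}
    {a : I.Action} (ha : a ∉ I.inducible i (θ i)) : y i θ a = 0 := by
  ext ω
  by_contra hne
  exact ha (h.y_index i θ a ω hne).2

theorem IsScheme.ξ_eq_zero (h : I.IsScheme t ξ y) {i : I.Agent} {θ : I.TypeProfile}
    {a : I.Action} (ha : a ∉ I.inducible i (θ i)) : ξ i θ a = 0 := by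
  by_contra hne
  exact ha (h.ξ_index i θ a hne).2

theorem IsScheme.t_eq_zero (h : I.IsScheme t ξ y) {θ : I.TypeProfile}
    {a : I.ActionProfile} (ha : a ∉ I.inducibleProfiles θ) : t θ a = 0 := by
  by_contra hne
  exact ha (h.t_index θ a hne).2

theorem IsScheme.sum_t (h : I.IsScheme t ξ y) {θ : I.TypeProfile} (hθ : θ ∈ I.support) :
    ∑ a, t θ a = 1 := by
  rw [← h.sum_ξ ⟨0, I.numAgents_pos⟩ θ (isReport_of_mem hθ _)]
  simp_rw [← h.marginal _ θ hθ]
  exact (Finset.sum_fiberwise _ _ _).symm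

/-- A recommended payment scheme is optimal for the agent it is meant for. If the payments come
with probability `0`, only their expected value counts. -/
theorem IsScheme.best (h : I.IsScheme t ξ y) (i : I.Agent) {θ : I.TypeProfile}
    (hθ : θ ∈ I.support) (a : I.Action) :
    I.util i (θ i) (y i θ a) (ξ i θ a)
      = I.pay i (θ i) a (y i θ a) - ξ i θ a * (I.cost i (θ i) a : ℝ) := by
  have hle : ∀ a ∈ Finset.univ, I.pay i (θ i) a (y i θ a) - ξ i θ a * (I.cost i (θ i) a : ℝ)
      ≤ I.util i (θ i) (y i θ a) (ξ i θ a) := fun a _ => le_util _ _ _ _ a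
  have hsum := h.dsic i θ hθ (θ i)
  rw [deviate_self] at hsum
  have heq := le_antisymm (Finset.sum_le_sum hle) hsum
  exact ((Finset.sum_eq_sum_iff_of_le hle).1 heq a (Finset.mem_univ a)).symm

theorem expReward_nonneg (θ : I.TypeProfile) (a : I.ActionProfile) : 0 ≤ I.expReward θ a :=
  Finset.sum_nonneg fun ω _ => mul_nonneg (I.reward_mem ω).1
    (Finset.prod_nonneg fun i _ => by exact_mod_cast I.F_nonneg i _ _ _)

theorem expReward_le_one (θ : I.TypeProfile) (a : I.ActionProfile) : I.expReward θ a ≤ 1 := by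
  have hF : ∀ i, ∑ ω, (I.F i (θ i) (a i) ω : ℝ) = 1 := fun i => by
    exact_mod_cast I.F_sum i (θ i) (a i)
  calc I.expReward θ a
      ≤ ∑ ω : I.Agent → I.Outcome, ∏ i, (I.F i (θ i) (a i) (ω i) : ℝ) :=
        Finset.sum_le_sum fun ω _ => mul_le_of_le_one_left
          (Finset.prod_nonneg fun i _ => by exact_mod_cast I.F_nonneg i _ _ _) (I.reward_mem ω).2
    _ = ∏ i, ∑ ω, (I.F i (θ i) (a i) ω : ℝ) := by
        rw [Finset.prod_univ_sum, Fintype.piFinset_univ]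
    _ = 1 := by simp [hF]

theorem sum_prior (I : Instance) : ∑ θ, (I.prior θ : ℝ) = 1 := by exact_mod_cast I.prior_sum

theorem prior_nonneg' (θ : I.TypeProfile) : 0 ≤ (I.prior θ : ℝ) := by
  exact_mod_cast I.prior_nonneg θ

theorem sum_prior_mul_le {f : I.TypeProfile → ℝ} {C : ℝ} (h : ∀ θ ∈ I.support, f θ ≤ C) :
    ∑ θ, (I.prior θ : ℝ) * f θ ≤ C := by
  calc ∑ θ, (I.prior θ : ℝ) * f θ ≤ ∑ θ, (I.prior θ : ℝ) * C := by
        refine Finset.sum_le_sum fun θ _ => ?_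
        by_cases hθ : θ ∈ I.support
        · exact mul_le_mul_of_nonneg_left (h θ hθ) (prior_nonneg' θ)
        · simp [prior_eq_zero hθ]
    _ = C := by rw [← Finset.sum_mul, sum_prior, one_mul]

theorem IsScheme.value_le_one (h : I.IsScheme t ξ y) : I.schemeValue t y ≤ 1 := by
  have h1 : ∑ θ, (I.prior θ : ℝ) * ∑ a, t θ a * I.expReward θ a ≤ 1 := by
    refine sum_prior_mul_le fun θ hθ => ?_
    rw [← h.sum_t hθ]
    exact Finset.sum_le_sum fun a _ =>
      mul_le_of_le_one_right (h.t_nonneg θ a) (expReward_le_one θ a)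
  have h2 : 0 ≤ ∑ i, ∑ θ, (I.prior θ : ℝ) * ∑ a, I.pay i (θ i) a (y i θ a) :=
    Finset.sum_nonneg fun i _ => Finset.sum_nonneg fun θ _ => mul_nonneg (prior_nonneg' θ)
      (Finset.sum_nonneg fun a _ => pay_nonneg _ _ _ (h.y_nonneg i θ a))
  rw [schemeValue]
  linarith

end Basic

/-! ### The linear program and lottery schemes -/

theorem LPPoint.Feasible.isScheme {s : I.LPPoint} (h : s.Feasible) :
    I.IsScheme s.t s.ξ s.y := by
  have ht : ∀ θ a, 0 ≤ s.t θ a := fun θ a => by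
    by_contra hlt
    obtain ⟨h1, h2⟩ := h.t_index θ a (by linarith)
    exact hlt (h.t_nonneg θ h1 a h2)
  have hξ : ∀ i θ a, 0 ≤ s.ξ i θ a := fun i θ a => by
    by_contra hlt
    obtain ⟨h1, h2⟩ := h.ξ_index i θ a (by linarith)
    exact hlt (h.ξ_nonneg i θ h1 a h2)
  have hy : ∀ i θ a ω, 0 ≤ s.y i θ a ω := fun i θ a ω => by
    by_contra hlt
    obtain ⟨h1, h2⟩ := h.y_index i θ a ω (by linarith)
    exact hlt (h.y_nonneg i θ h1 a h2 ω)
  have hy0 : ∀ i (θ : I.TypeProfile) a, a ∉ I.inducible i (θ i) → s.y i θ a = 0 := by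
    intro i θ a ha
    ext ω
    by_contra hne
    exact ha (h.y_index i θ a ω hne).2
  have hξ0 : ∀ i (θ : I.TypeProfile) a, a ∉ I.inducible i (θ i) → s.ξ i θ a = 0 := by
    intro i θ a ha
    by_contra hne
    exact ha (h.ξ_index i θ a hne).2
  refine ⟨?_, ?_, ?_, ht, hξ, hy, h.t_index, h.ξ_index, h.y_index⟩
  · intro i θ hθ θ'
    have h1 := h.dsic i θ hθ θ'
    rw [sum_inducible] at h1
    · rw [sum_inducible] at h1
      · refine le_trans (Finset.sum_le_sum fun a _ => ?_) h1
        by_cases ha : a ∈ I.inducible i θ'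
        · exact util_le (pay_sub_le_of_inducible (hy i _ a) (hξ i _ a)
            (h.γ_ge i θ hθ θ' a ha))
        · rw [hy0 i (I.deviate θ i θ') a (by simpa using ha),
            hξ0 i (I.deviate θ i θ') a (by simpa using ha), util_zero]
          by_contra hlt
          exact ha (h.γ_index i θ θ' a (by linarith)).2
      · intro a ha
        by_contra hn
        rw [hy0 i θ a hn, hξ0 i θ a hn] at ha
        simp [pay_zero] at ha
    · exact fun a ha => (h.γ_index i θ θ' a ha).2
  · intro i θ hr
    rw [← h.sum_ξ i θ hr, sum_inducible]
    exact fun a ha => (h.ξ_index i θ a ha).2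
  · intro i θ hθ a
    by_cases ha : a ∈ I.inducible i (θ i)
    · rw [← h.marginal i θ hθ a ha]
      symm
      refine Finset.sum_subset (fun b hb => by simpa using (Finset.mem_filter.1 hb).2) ?_
      intro b hb hb'
      by_contra hne
      exact hb' (Finset.mem_filter.2 ⟨(h.t_index θ b hne).2, by simpa using hb⟩)
    · rw [hξ0 i θ a ha]
      refine Finset.sum_eq_zero fun b hb => ?_
      by_contra hne
      have hb' := (Finset.mem_filter.1 hb).2
      exact ha (hb' ▸ mem_inducibleProfiles.1 (h.t_index θ b hne).2 i)

theorem LPPoint.value_eq {s : I.LPPoint} (h : I.IsScheme s.t s.ξ s.y) :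
    s.value = I.schemeValue s.t s.y := by
  rw [LPPoint.value, schemeValue]
  congr 1
  · refine Finset.sum_congr rfl fun θ _ => ?_
    congr 1
    refine Finset.sum_subset (Finset.subset_univ _) fun a _ ha => ?_
    rw [h.t_eq_zero ha, zero_mul]
  · refine Finset.sum_congr rfl fun i _ => Finset.sum_congr rfl fun θ _ => ?_
    congr 1
    refine sum_inducible fun a ha => ?_
    by_contra hn
    rw [h.y_eq_zero hn, pay_zero] at ha
    exact ha rfl

/-- A scheme is a feasible point of the linear program if the variables `γ` take the values of
the utilities. -/
theorem IsScheme.exists_feasible {t : I.TypeProfile → I.ActionProfile → ℝ}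
    {ξ : I.Agent → I.TypeProfile → I.Action → ℝ}
    {y : I.Agent → I.TypeProfile → I.Action → I.Outcome → ℝ} (h : I.IsScheme t ξ y) :
    ∃ s : I.LPPoint, s.Feasible ∧ s.t = t ∧ s.ξ = ξ ∧ s.y = y := by
  classical
  let γ : I.Agent → I.TypeProfile → I.AgentType → I.Action → ℝ := fun i θ θ' a =>
    if θ ∈ I.support ∧ a ∈ I.inducible i θ' then
      I.util i (θ i) (y i (I.deviate θ i θ') a) (ξ i (I.deviate θ i θ') a) else 0
  refine ⟨⟨t, ξ, y, γ⟩, ?_, rfl, rfl, rfl⟩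
  refine ⟨?_, ?_, ?_, ?_, fun θ _ a _ => h.t_nonneg θ a, fun i θ _ a _ => h.ξ_nonneg i θ a,
    fun i θ _ a _ => h.y_nonneg i θ a, h.t_index, h.ξ_index, h.y_index, ?_⟩
  · intro i θ hθ θ'
    refine le_of_eq_of_le ?_ (le_of_le_of_eq (h.dsic i θ hθ θ') ?_)
    · rw [← sum_inducible (i := i) (θ := θ')]
      · exact Finset.sum_congr rfl fun a ha => by simp only [γ, hθ, ha, and_self, if_true]
      · intro a ha
        by_contra hn
        rw [h.y_eq_zero (by simpa using hn), h.ξ_eq_zero (by simpa using hn), util_zero] at ha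
        exact ha rfl
    · refine (sum_inducible fun a ha => ?_).symm
      by_contra hn
      rw [h.y_eq_zero hn, h.ξ_eq_zero hn, pay_zero] at ha
      simp at ha
  · intro i θ hθ θ' a ha a' _
    simp only [γ, hθ, ha, and_self, if_true]
    exact le_util _ _ _ _ a'
  · intro i θ hr
    rw [sum_inducible fun a ha => (h.ξ_index i θ a ha).2]
    exact h.sum_ξ i θ hr
  · intro i θ hθ a _
    refine Eq.trans ?_ (h.marginal i θ hθ a)
    refine Finset.sum_subset (fun b hb => by simpa using (Finset.mem_filter.1 hb).2) ?_
    intro b hb hb'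
    by_contra hne
    exact hb' (Finset.mem_filter.2 ⟨(h.t_index θ b hne).2, by simpa using hb⟩)
  · intro i θ θ' a hne
    by_contra hn
    exact hne (if_neg hn)

/-! ### Menus and lottery schemes -/

/-- Dividing the expected payments of a regular scheme by the probabilities of the
recommendations yields a menu. -/
theorem IsScheme.menu {t : I.TypeProfile → I.ActionProfile → ℝ}
    {ξ : I.Agent → I.TypeProfile → I.Action → ℝ}
    {y : I.Agent → I.TypeProfile → I.Action → I.Outcome → ℝ} (h : I.IsScheme t ξ y)
    (hreg : ∀ i θ a ω, y i θ a ω ≠ 0 → ξ i θ a ≠ 0) :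
    Menu.Feasible (⟨t, ξ, fun i θ a ω => y i θ a ω / ξ i θ a⟩ : I.Menu) ∧
      Menu.value (⟨t, ξ, fun i θ a ω => y i θ a ω / ξ i θ a⟩ : I.Menu) = I.schemeValue t y := by
  have hy : ∀ i θ a, ξ i θ a • (fun ω => y i θ a ω / ξ i θ a) = y i θ a := by
    intro i θ a
    ext ω
    by_cases hξ : ξ i θ a = 0
    · have : y i θ a ω = 0 := by
        by_contra hne
        exact hreg i θ a ω hne hξ
      simp [hξ, this]
    · simp only [Pi.smul_apply, smul_eq_mul]
      field_simp
  have hpay : ∀ i θ a θ' b, ξ i θ a * I.pay i θ' b (fun ω => y i θ a ω / ξ i θ a)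
      = I.pay i θ' b (y i θ a) := fun i θ a θ' b => by rw [← pay_smul, hy]
  constructor
  · refine ⟨?_, h.sum_ξ, h.marginal, fun θ _ a => h.t_nonneg θ a, fun i θ _ a => h.ξ_nonneg i θ a,
      fun i θ _ a ω => div_nonneg (h.y_nonneg i θ a ω) (h.ξ_nonneg i θ a)⟩
    intro i θ hθ θ'
    refine le_of_eq_of_le ?_ (le_of_le_of_eq (h.dsic i θ hθ θ') ?_)
    · refine Finset.sum_congr rfl fun a _ => ?_
      have heq := util_smul i (θ i) (h.ξ_nonneg i (I.deviate θ i θ') a)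
        (fun ω => y i (I.deviate θ i θ') a ω / ξ i (I.deviate θ i θ') a) 1
      rw [mul_one, hy] at heq
      rw [heq, util]
      simp only [one_mul]
    · exact Finset.sum_congr rfl fun a _ => by rw [mul_sub, hpay]
  · simp only [Menu.value, schemeValue, hpay]

/-- Best responses turn a menu into a scheme: the recommendations that an agent would not follow,
which can only occur at reports that do not come from the prior, are replaced with the actions
that the agent would choose. -/
theorem Menu.Feasible.exists_isScheme {μ : I.Menu} (h : μ.Feasible) :
    ∃ t ξ y, I.IsScheme t ξ y ∧ I.schemeValue t y = μ.value := by
  classical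
  choose br hbr using fun i (θ : I.TypeProfile) a => I.exists_isBest i (θ i) (μ.p i θ a)
  let σ : I.Agent → I.TypeProfile → I.Action → I.Action := fun i θ a =>
    if I.IsBest i (θ i) (μ.p i θ a) a then a else br i θ a
  have hσ : ∀ i θ a, I.IsBest i (θ i) (μ.p i θ a) (σ i θ a) := by
    intro i θ a
    simp only [σ]
    split_ifs with hb
    · exact hb
    · exact hbr i θ a
  let t : I.TypeProfile → I.ActionProfile → ℝ := fun θ a => if θ ∈ I.support then μ.t θ a else 0
  let ξ : I.Agent → I.TypeProfile → I.Action → ℝ := fun i θ b =>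
    if I.IsReport i θ then ∑ a with σ i θ a = b, μ.ξ i θ a else 0
  let y : I.Agent → I.TypeProfile → I.Action → I.Outcome → ℝ := fun i θ b =>
    if I.IsReport i θ then ∑ a with σ i θ a = b, μ.ξ i θ a • μ.p i θ a else 0
  have hutil : ∀ i (θ : I.TypeProfile) a (θ' : I.AgentType),
      (⨆ a', (I.pay i θ' a' (μ.p i θ a) - (I.cost i θ' a' : ℝ))) = I.util i θ' (μ.p i θ a) 1 := by
    intro i θ a θ'
    simp [util]
  -- A recommendation given with positive probability to a truthful agent is followed.
  have hbest : ∀ i, ∀ θ ∈ I.support, ∀ a, μ.ξ i θ a ≠ 0 → σ i θ a = a := by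
    intro i θ hθ a ha
    have hle : ∀ a ∈ Finset.univ,
        μ.ξ i θ a * (I.pay i (θ i) a (μ.p i θ a) - (I.cost i (θ i) a : ℝ))
          ≤ μ.ξ i θ a * I.util i (θ i) (μ.p i θ a) 1 := fun a _ =>
      mul_le_mul_of_nonneg_left (by simpa using le_util i (θ i) (μ.p i θ a) 1 a)
        (h.ξ_nonneg i θ (isReport_of_mem hθ i) a)
    have hsum := h.dsic i θ hθ (θ i)
    simp only [deviate_self, hutil] at hsum
    have heq := (Finset.sum_eq_sum_iff_of_le hle).1 (le_antisymm (Finset.sum_le_sum hle) hsum) a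
      (Finset.mem_univ a)
    have heq' := mul_left_cancel₀ ha heq
    refine if_pos fun a' => ?_
    rw [heq']
    simpa using le_util i (θ i) (μ.p i θ a) 1 a'
  have hξs : ∀ i, ∀ θ ∈ I.support, ∀ b, ξ i θ b = μ.ξ i θ b := by
    intro i θ hθ b
    simp only [ξ, isReport_of_mem hθ i, if_true]
    rw [Finset.sum_filter, Finset.sum_eq_single b]
    · by_cases hb : μ.ξ i θ b = 0
      · simp [hb]
      · simp [hbest i θ hθ b hb]
    · intro a _ hab
      by_cases ha : μ.ξ i θ a = 0
      · simp [ha]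
      · simp [hbest i θ hθ a ha, hab]
    · simp
  have hys : ∀ i, ∀ θ ∈ I.support, ∀ b, y i θ b = μ.ξ i θ b • μ.p i θ b := by
    intro i θ hθ b
    simp only [y, isReport_of_mem hθ i, if_true]
    rw [Finset.sum_filter, Finset.sum_eq_single b]
    · by_cases hb : μ.ξ i θ b = 0
      · simp [hb]
      · simp [hbest i θ hθ b hb]
    · intro a _ hab
      by_cases ha : μ.ξ i θ a = 0
      · simp [ha]
      · simp [hbest i θ hθ a ha, hab]
    · simp
  have hmem : ∀ i θ, I.IsReport i θ → ∀ a, σ i θ a ∈ I.inducible i (θ i) := fun i θ hr a =>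
    (hσ i θ a).mem_inducible (h.p_nonneg i θ hr a)
  have hmarg : ∀ i, ∀ θ ∈ I.support, ∀ a,
      ∑ b : I.ActionProfile with b i = a, t θ b = ξ i θ a := by
    intro i θ hθ a
    rw [hξs i θ hθ, ← h.marginal i θ hθ a]
    simp only [t, hθ, if_true]
  refine ⟨t, ξ, y, ⟨?_, ?_, hmarg, ?_, ?_, ?_, ?_, ?_, ?_⟩, ?_⟩
  · intro i θ hθ θ'
    have h1 := h.dsic i θ hθ θ'
    simp only [hutil] at h1
    refine le_trans ?_ (le_of_le_of_eq h1 ?_)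
    · have hr := isReport_deviate hθ i θ'
      set θd := I.deviate θ i θ'
      rw [← Finset.sum_fiberwise _ (σ i θd) (fun a => μ.ξ i θd a * _)]
      refine Finset.sum_le_sum fun b _ => ?_
      simp only [ξ, y, hr, if_true]
      refine (util_sum_le _ _ _ _ _).trans (Finset.sum_le_sum fun a _ => ?_)
      rw [← util_smul _ _ (h.ξ_nonneg i θd hr a), mul_one]
    · refine Finset.sum_congr rfl fun a _ => ?_
      rw [hys i θ hθ, hξs i θ hθ, pay_smul]
      ring
  · intro i θ hr
    simp only [ξ, hr, if_true]
    rw [Finset.sum_fiberwise]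
    exact h.sum_ξ i θ hr
  · intro θ a
    simp only [t]
    split_ifs with hθ
    · exact h.t_nonneg θ hθ a
    · exact le_rfl
  · intro i θ a
    simp only [ξ]
    split_ifs with hr
    · exact Finset.sum_nonneg fun b _ => h.ξ_nonneg i θ hr b
    · exact le_rfl
  · intro i θ a ω
    simp only [y]
    split_ifs with hr
    · rw [Finset.sum_apply]
      exact Finset.sum_nonneg fun b _ => mul_nonneg (h.ξ_nonneg i θ hr b) (h.p_nonneg i θ hr b ω)
    · exact le_rfl
  · intro θ a hne
    have hθ : θ ∈ I.support := by
      by_contra hn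
      exact hne (if_neg hn)
    refine ⟨hθ, mem_inducibleProfiles.2 fun i => ?_⟩
    have hne' : μ.t θ a ≠ 0 := by simpa [t, hθ] using hne
    have hpos : 0 < μ.t θ a := lt_of_le_of_ne (h.t_nonneg θ hθ a) hne'.symm
    have hle : μ.t θ a ≤ μ.ξ i θ (a i) := by
      rw [← h.marginal i θ hθ (a i)]
      exact Finset.single_le_sum (f := fun b => μ.t θ b) (fun b _ => h.t_nonneg θ hθ b)
        (by simp)
    rw [← hbest i θ hθ (a i) (by linarith)]
    exact hmem i θ (isReport_of_mem hθ i) (a i)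
  · intro i θ b hne
    have hr : I.IsReport i θ := by
      by_contra hn
      exact hne (if_neg hn)
    simp only [ξ, hr, if_true] at hne
    obtain ⟨a, ha, -⟩ := Finset.exists_ne_zero_of_sum_ne_zero hne
    exact ⟨hr, (Finset.mem_filter.1 ha).2 ▸ hmem i θ hr a⟩
  · intro i θ b ω hne
    have hr : I.IsReport i θ := by
      by_contra hn
      simp [y, hn] at hne
    simp only [y, hr, if_true, Finset.sum_apply] at hne
    obtain ⟨a, ha, -⟩ := Finset.exists_ne_zero_of_sum_ne_zero hne
    exact ⟨hr, (Finset.mem_filter.1 ha).2 ▸ hmem i θ hr a⟩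
  · rw [schemeValue, Menu.value]
    congr 1
    · refine Finset.sum_congr rfl fun θ _ => ?_
      by_cases hθ : θ ∈ I.support
      · simp [t, hθ]
      · simp [prior_eq_zero hθ]
    · refine Finset.sum_congr rfl fun i _ => Finset.sum_congr rfl fun θ _ => ?_
      by_cases hθ : θ ∈ I.support
      · simp only [hys i θ hθ, pay_smul]
      · simp [prior_eq_zero hθ]

/-! ### Mixing a scheme with a lottery that ignores the reports -/

section Mix

variable {J : Type*}

section Defs

variable [Fintype J]

/-- The recommendations `t` are followed with probability `α`; with probability `β` each, the
lottery `J` is run instead, and all agents choose their best responses `br`. -/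
noncomputable def mixT (α β : ℝ) (br : I.Agent → I.AgentType → J → I.Action)
    (t : I.TypeProfile → I.ActionProfile → ℝ) (θ : I.TypeProfile) (b : I.ActionProfile) : ℝ :=
  α * t θ b + β * ∑ a, t θ a * ∑ j, if (fun i => br i (θ i) j) = b then 1 else 0

/-- The marginals of `mixT`. -/
noncomputable def mixXi (α β : ℝ) (br : I.Agent → I.AgentType → J → I.Action)
    (ξ : I.Agent → I.TypeProfile → I.Action → ℝ) (i : I.Agent) (θ : I.TypeProfile)
    (b : I.Action) : ℝ :=
  α * ξ i θ b + β * ∑ a, ξ i θ a * ∑ j, if br i (θ i) j = b then 1 else 0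

/-- The expected payments that belong to `mixT` if the lottery `J` pays `Q`. The payments that
`y` attaches to the recommendation `a` are moved to `σ i θ a`. -/
noncomputable def mixY (α β : ℝ) (br : I.Agent → I.AgentType → J → I.Action)
    (σ : I.Agent → I.TypeProfile → I.Action → I.Action) (Q : J → I.Outcome → ℝ)
    (ξ : I.Agent → I.TypeProfile → I.Action → ℝ)
    (y : I.Agent → I.TypeProfile → I.Action → I.Outcome → ℝ) (i : I.Agent) (θ : I.TypeProfile)
    (b : I.Action) (ω : I.Outcome) : ℝ :=
  α * (∑ a, if σ i θ a = b then y i θ a ω else 0) +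
    β * ∑ a, ξ i θ a * ∑ j, if br i (θ i) j = b then Q j ω else 0

end Defs

variable {t : I.TypeProfile → I.ActionProfile → ℝ}
  {ξ : I.Agent → I.TypeProfile → I.Action → ℝ}
  {y : I.Agent → I.TypeProfile → I.Action → I.Outcome → ℝ}
  {Q : J → I.Outcome → ℝ} {br : I.Agent → I.AgentType → J → I.Action}
  {σ : I.Agent → I.TypeProfile → I.Action → I.Action} {α β : ℝ}

/-- What is required of the relocation `σ` of payments and the best responses `br`: only payments
that come with probability `0` are moved, and they are moved to an action that is also played in
the lottery and that maximizes the expected payment. -/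
structure Relocates (ξ : I.Agent → I.TypeProfile → I.Action → ℝ)
    (y : I.Agent → I.TypeProfile → I.Action → I.Outcome → ℝ) (Q : J → I.Outcome → ℝ)
    (br : I.Agent → I.AgentType → J → I.Action)
    (σ : I.Agent → I.TypeProfile → I.Action → I.Action) : Prop where
  nonneg : ∀ j ω, 0 ≤ Q j ω
  isBest : ∀ i θ j, I.IsBest i θ (Q j) (br i θ j)
  fixed : ∀ i θ a, ξ i θ a ≠ 0 → σ i θ a = a
  played : ∀ i θ a, ξ i θ a = 0 → y i θ a ≠ 0 → ∃ j, br i (θ i) j = σ i θ a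
  maximal : ∀ i θ a, ξ i θ a = 0 → y i θ a ≠ 0 →
    ∀ a', I.pay i (θ i) a' (y i θ a) ≤ I.pay i (θ i) (σ i θ a) (y i θ a)

namespace Relocates

/-- Relocating payments does not change the utilities of truthful agents. -/
theorem pay_sub_eq (hr : Relocates ξ y Q br σ) (h : I.IsScheme t ξ y) (i : I.Agent)
    {θ : I.TypeProfile} (hθ : θ ∈ I.support) (a : I.Action) :
    I.pay i (θ i) (σ i θ a) (y i θ a) = I.pay i (θ i) a (y i θ a) ∧
      ξ i θ a * (I.cost i (θ i) (σ i θ a) : ℝ) = ξ i θ a * (I.cost i (θ i) a : ℝ) := by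
  by_cases hξ : ξ i θ a = 0
  · refine ⟨?_, by rw [hξ, zero_mul, zero_mul]⟩
    by_cases hy : y i θ a = 0
    · simp [hy, pay_zero]
    · have h1 := h.best i hθ a
      have h2 := le_util i (θ i) (y i θ a) (ξ i θ a) (σ i θ a)
      rw [h1, hξ] at h2
      linarith [hr.maximal i θ a hξ hy a]
  · rw [hr.fixed i θ a hξ]
    exact ⟨rfl, rfl⟩

variable [Fintype J]

theorem mixXi_eq (hr : Relocates ξ y Q br σ) (i : I.Agent) (θ : I.TypeProfile)
    (hξ : ∑ a, ξ i θ a = 1) (b : I.Action) :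
    mixXi α β br ξ i θ b = α * (∑ a with σ i θ a = b, ξ i θ a) +
      β * ∑ j with br i (θ i) j = b, 1 := by
  have h1 : ∑ a with σ i θ a = b, ξ i θ a = ξ i θ b := by
    rw [Finset.sum_filter, Finset.sum_eq_single b]
    · by_cases hb : ξ i θ b = 0
      · simp [hb]
      · simp [hr.fixed i θ b hb]
    · intro a _ hab
      by_cases ha : ξ i θ a = 0
      · simp [ha]
      · simp [hr.fixed i θ a ha, hab]
    · simp
  rw [mixXi, h1, ← Finset.sum_mul, hξ, one_mul, Finset.sum_filter]

theorem mixY_eq (i : I.Agent) (θ : I.TypeProfile) (hξ : ∑ a, ξ i θ a = 1) (b : I.Action) :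
    mixY α β br σ Q ξ y i θ b = α • (∑ a with σ i θ a = b, y i θ a) +
      β • ∑ j with br i (θ i) j = b, Q j := by
  ext ω
  simp only [mixY, ← Finset.sum_mul, hξ, one_mul, Pi.add_apply, Pi.smul_apply, smul_eq_mul,
    Finset.sum_apply, Finset.sum_filter, ite_apply, Pi.zero_apply]

theorem mixXi_nonneg (hα : 0 ≤ α) (hβ : 0 ≤ β) (h : I.IsScheme t ξ y) (i : I.Agent)
    (θ : I.TypeProfile) (b : I.Action) : 0 ≤ mixXi α β br ξ i θ b :=
  add_nonneg (mul_nonneg hα (h.ξ_nonneg i θ b)) (mul_nonneg hβ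
    (Finset.sum_nonneg fun a _ => mul_nonneg (h.ξ_nonneg i θ a)
      (Finset.sum_nonneg fun j _ => by split_ifs <;> norm_num)))

/-- The mixture has no payments that come with probability `0`. -/
theorem mixXi_ne_zero (hr : Relocates ξ y Q br σ) (hα : 0 < α) (hβ : 0 < β)
    (h : I.IsScheme t ξ y) (i : I.Agent) (θ : I.TypeProfile) (b : I.Action) (ω : I.Outcome)
    (hne : mixY α β br σ Q ξ y i θ b ω ≠ 0) : mixXi α β br ξ i θ b ≠ 0 := by
  -- It suffices that the lottery leads to `b`, or that `b` is recommended in the given scheme.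
  have key1 : ∀ j, I.IsReport i θ → br i (θ i) j = b → mixXi α β br ξ i θ b ≠ 0 := by
    intro j hrep hj
    rw [hr.mixXi_eq i θ (h.sum_ξ i θ hrep)]
    have h1 : 0 ≤ α * ∑ a with σ i θ a = b, ξ i θ a :=
      mul_nonneg hα.le (Finset.sum_nonneg fun a _ => h.ξ_nonneg i θ a)
    have h2 : 0 < β * ∑ j with br i (θ i) j = b, (1 : ℝ) :=
      mul_pos hβ (Finset.sum_pos (fun _ _ => one_pos) ⟨j, by simpa using hj⟩)
    linarith
  have key2 : ξ i θ b ≠ 0 → mixXi α β br ξ i θ b ≠ 0 := by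
    intro hb
    have h1 : 0 < α * ξ i θ b := mul_pos hα (lt_of_le_of_ne (h.ξ_nonneg i θ b) hb.symm)
    have h2 : 0 ≤ β * ∑ a, ξ i θ a * ∑ j, if br i (θ i) j = b then (1 : ℝ) else 0 :=
      mul_nonneg hβ.le (Finset.sum_nonneg fun a _ => mul_nonneg (h.ξ_nonneg i θ a)
        (Finset.sum_nonneg fun j _ => by split_ifs <;> norm_num))
    rw [mixXi]
    linarith
  rw [mixY] at hne
  by_cases h1 : (∑ a, if σ i θ a = b then y i θ a ω else 0) = 0
  · rw [h1, mul_zero, zero_add] at hne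
    obtain ⟨a, -, ha⟩ := Finset.exists_ne_zero_of_sum_ne_zero (right_ne_zero_of_mul hne)
    obtain ⟨j, -, hj⟩ := Finset.exists_ne_zero_of_sum_ne_zero (right_ne_zero_of_mul ha)
    refine key1 j (h.ξ_index i θ a (left_ne_zero_of_mul ha)).1 ?_
    by_contra hn
    exact hj (if_neg hn)
  · obtain ⟨a, -, ha⟩ := Finset.exists_ne_zero_of_sum_ne_zero h1
    have hσ : σ i θ a = b := by
      by_contra hn
      exact ha (if_neg hn)
    rw [if_pos hσ] at ha
    by_cases hξ : ξ i θ a = 0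
    · obtain ⟨j, hj⟩ := hr.played i θ a hξ fun h0 => ha (by rw [h0]; rfl)
      exact key1 j (h.y_index i θ a ω ha).1 (hj.trans hσ)
    · rw [hr.fixed i θ a hξ] at hσ
      exact key2 (hσ ▸ hξ)

theorem sum_pay_mixY (hr : Relocates ξ y Q br σ) (h : I.IsScheme t ξ y) (i : I.Agent)
    {θ : I.TypeProfile} (hθ : θ ∈ I.support) :
    ∑ b, I.pay i (θ i) b (mixY α β br σ Q ξ y i θ b) =
      α * (∑ a, I.pay i (θ i) a (y i θ a)) + β * ∑ j, I.pay i (θ i) (br i (θ i) j) (Q j) := by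
  have hξ := h.sum_ξ i θ (isReport_of_mem hθ i)
  simp only [mixY_eq i θ hξ, pay_add, pay_smul, pay_sum, Finset.sum_add_distrib,
    ← Finset.mul_sum]
  congr 2
  · rw [← Finset.sum_fiberwise Finset.univ (σ i θ) fun a => I.pay i (θ i) a (y i θ a)]
    refine Finset.sum_congr rfl fun b _ => Finset.sum_congr rfl fun a ha => ?_
    rw [← (hr.pay_sub_eq h i hθ a).1, (Finset.mem_filter.1 ha).2]
  · rw [← Finset.sum_fiberwise Finset.univ (br i (θ i)) fun j =>
      I.pay i (θ i) (br i (θ i) j) (Q j)]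
    refine Finset.sum_congr rfl fun b _ => Finset.sum_congr rfl fun j hj => ?_
    rw [(Finset.mem_filter.1 hj).2]

theorem sum_cost_mixXi (hr : Relocates ξ y Q br σ) (h : I.IsScheme t ξ y) (i : I.Agent)
    {θ : I.TypeProfile} (hθ : θ ∈ I.support) :
    ∑ b, mixXi α β br ξ i θ b * (I.cost i (θ i) b : ℝ) =
      α * (∑ a, ξ i θ a * (I.cost i (θ i) a : ℝ)) +
        β * ∑ j, (I.cost i (θ i) (br i (θ i) j) : ℝ) := by
  have hξ := h.sum_ξ i θ (isReport_of_mem hθ i)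
  simp only [hr.mixXi_eq i θ hξ, add_mul, mul_assoc, Finset.sum_add_distrib,
    ← Finset.mul_sum]
  congr 2
  · rw [← Finset.sum_fiberwise Finset.univ (σ i θ) fun a => ξ i θ a * (I.cost i (θ i) a : ℝ)]
    refine Finset.sum_congr rfl fun b _ => ?_
    rw [Finset.sum_mul]
    refine Finset.sum_congr rfl fun a ha => ?_
    rw [← (hr.pay_sub_eq h i hθ a).2, (Finset.mem_filter.1 ha).2]
  · rw [← Finset.sum_fiberwise Finset.univ (br i (θ i)) fun j =>
      (I.cost i (θ i) (br i (θ i) j) : ℝ)]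
    refine Finset.sum_congr rfl fun b _ => ?_
    rw [Finset.sum_mul]
    refine Finset.sum_congr rfl fun j hj => ?_
    rw [(Finset.mem_filter.1 hj).2, one_mul]

theorem util_mix_le (hr : Relocates ξ y Q br σ) (hα : 0 ≤ α) (hβ : 0 ≤ β) (i : I.Agent)
    {θ : I.TypeProfile} (hξ : ∑ a, ξ i θ a = 1) (θ' : I.AgentType) :
    ∑ b, I.util i θ' (mixY α β br σ Q ξ y i θ b) (mixXi α β br ξ i θ b) ≤
      α * (∑ a, I.util i θ' (y i θ a) (ξ i θ a)) + β * ∑ j, I.util i θ' (Q j) 1 := by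
  rw [← Finset.sum_fiberwise Finset.univ (σ i θ) (fun a => I.util i θ' (y i θ a) (ξ i θ a)),
    ← Finset.sum_fiberwise Finset.univ (br i (θ i)) (fun j => I.util i θ' (Q j) 1),
    Finset.mul_sum, Finset.mul_sum, ← Finset.sum_add_distrib]
  refine Finset.sum_le_sum fun b _ => ?_
  rw [mixY_eq i θ hξ, hr.mixXi_eq i θ hξ]
  refine (util_add_le _ _ _ _ _ _).trans (add_le_add ?_ ?_)
  · rw [util_smul _ _ hα]
    exact mul_le_mul_of_nonneg_left (util_sum_le _ _ _ _ _) hα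
  · rw [util_smul _ _ hβ]
    exact mul_le_mul_of_nonneg_left (util_sum_le _ _ _ _ _) hβ

/-- The mixture is again a scheme. It is DSIC since utilities from the lottery do not depend on
the report, and since merging payments that different recommendations come with can only make
deviations less profitable. -/
theorem isScheme (hr : Relocates ξ y Q br σ) (hα : 0 ≤ α) (hβ : 0 ≤ β)
    (hαβ : α + β * Fintype.card J = 1) (h : I.IsScheme t ξ y) :
    I.IsScheme (mixT α β br t) (mixXi α β br ξ) (mixY α β br σ Q ξ y) := by
  have hbr : ∀ i θ j, br i θ j ∈ I.inducible i θ := fun i θ j =>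
    (hr.isBest i θ j).mem_inducible (hr.nonneg j)
  refine ⟨?_, ?_, ?_, ?_, mixXi_nonneg hα hβ h, ?_, ?_, ?_, ?_⟩
  · intro i θ hθ θ'
    have h1 := h.sum_ξ i _ (isReport_deviate hθ i θ')
    refine (hr.util_mix_le hα hβ i h1 (θ i)).trans ?_
    have h2 := mul_le_mul_of_nonneg_left (h.dsic i θ hθ θ') hα
    rw [Finset.sum_sub_distrib] at h2 ⊢
    rw [hr.sum_pay_mixY h i hθ, hr.sum_cost_mixXi h i hθ]
    have h3 : ∑ j, I.util i (θ i) (Q j) 1 = ∑ j, I.pay i (θ i) (br i (θ i) j) (Q j) -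
        ∑ j, (I.cost i (θ i) (br i (θ i) j) : ℝ) := by
      rw [← Finset.sum_sub_distrib]
      exact Finset.sum_congr rfl fun j _ => (hr.isBest i (θ i) j).util_eq
    rw [h3]
    linarith
  · intro i θ hrep
    have hξ := h.sum_ξ i θ hrep
    simp only [hr.mixXi_eq i θ hξ, Finset.sum_add_distrib, ← Finset.mul_sum]
    rw [Finset.sum_fiberwise, Finset.sum_fiberwise, hξ]
    simpa using hαβ
  · intro i θ hθ a
    simp only [mixT, mixXi, Finset.sum_add_distrib, ← Finset.mul_sum, h.marginal i θ hθ a]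
    congr 2
    simp only [← Finset.sum_mul]
    rw [h.sum_t hθ, h.sum_ξ i θ (isReport_of_mem hθ i)]
    simp only [one_mul]
    rw [Finset.sum_comm]
    refine Finset.sum_congr rfl fun j _ => ?_
    simp [Finset.sum_ite_eq]
  · intro θ a
    exact add_nonneg (mul_nonneg hα (h.t_nonneg θ a)) (mul_nonneg hβ
      (Finset.sum_nonneg fun b _ => mul_nonneg (h.t_nonneg θ b)
        (Finset.sum_nonneg fun j _ => by split_ifs <;> norm_num)))
  · intro i θ b ω
    refine add_nonneg (mul_nonneg hα (Finset.sum_nonneg fun a _ => ?_)) (mul_nonneg hβ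
      (Finset.sum_nonneg fun a _ => mul_nonneg (h.ξ_nonneg i θ a)
        (Finset.sum_nonneg fun j _ => ?_)))
    · split_ifs
      exacts [h.y_nonneg i θ a ω, le_rfl]
    · split_ifs
      exacts [hr.nonneg j ω, le_rfl]
  · intro θ b hne
    rw [mixT] at hne
    by_cases hb : t θ b = 0
    · rw [hb, mul_zero, zero_add] at hne
      obtain ⟨a, -, ha⟩ := Finset.exists_ne_zero_of_sum_ne_zero (right_ne_zero_of_mul hne)
      obtain ⟨j, -, hj⟩ := Finset.exists_ne_zero_of_sum_ne_zero (right_ne_zero_of_mul ha)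
      refine ⟨(h.t_index θ a (left_ne_zero_of_mul ha)).1, mem_inducibleProfiles.2 fun i => ?_⟩
      have hjb : (fun i => br i (θ i) j) = b := by
        by_contra hn
        exact hj (if_neg hn)
      rw [← hjb]
      exact hbr i (θ i) j
    · exact h.t_index θ b hb
  · intro i θ b hne
    rw [mixXi] at hne
    by_cases hb : ξ i θ b = 0
    · rw [hb, mul_zero, zero_add] at hne
      obtain ⟨a, -, ha⟩ := Finset.exists_ne_zero_of_sum_ne_zero (right_ne_zero_of_mul hne)
      obtain ⟨j, -, hj⟩ := Finset.exists_ne_zero_of_sum_ne_zero (right_ne_zero_of_mul ha)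
      refine ⟨(h.ξ_index i θ a (left_ne_zero_of_mul ha)).1, ?_⟩
      have hjb : br i (θ i) j = b := by
        by_contra hn
        exact hj (if_neg hn)
      exact hjb ▸ hbr i (θ i) j
    · exact h.ξ_index i θ b hb
  · intro i θ b ω hne
    rw [mixY] at hne
    by_cases hb : (∑ a, if σ i θ a = b then y i θ a ω else 0) = 0
    · rw [hb, mul_zero, zero_add] at hne
      obtain ⟨a, -, ha⟩ := Finset.exists_ne_zero_of_sum_ne_zero (right_ne_zero_of_mul hne)
      obtain ⟨j, -, hj⟩ := Finset.exists_ne_zero_of_sum_ne_zero (right_ne_zero_of_mul ha)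
      refine ⟨(h.ξ_index i θ a (left_ne_zero_of_mul ha)).1, ?_⟩
      have hjb : br i (θ i) j = b := by
        by_contra hn
        exact hj (if_neg hn)
      exact hjb ▸ hbr i (θ i) j
    · obtain ⟨a, -, ha⟩ := Finset.exists_ne_zero_of_sum_ne_zero hb
      have hσ : σ i θ a = b := by
        by_contra hn
        exact ha (if_neg hn)
      rw [if_pos hσ] at ha
      refine ⟨(h.y_index i θ a ω ha).1, ?_⟩
      by_cases hξ : ξ i θ a = 0
      · obtain ⟨j, hj⟩ := hr.played i θ a hξ fun h0 => ha (by rw [h0]; rfl)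
        rw [← hσ, ← hj]
        exact hbr i (θ i) j
      · rw [← hσ, hr.fixed i θ a hξ]
        exact (h.y_index i θ a ω ha).2

theorem value_ge (hr : Relocates ξ y Q br σ) (hβ : 0 ≤ β)
    (hαβ : α + β * Fintype.card J = 1) (h : I.IsScheme t ξ y) {C : ℝ}
    (hC : ∀ j ω, Q j ω ≤ C) :
    I.schemeValue t y - β * (Fintype.card J * (1 + I.numAgents * C)) ≤
      I.schemeValue (mixT α β br t) (mixY α β br σ Q ξ y) := by
  have h1 : α * (∑ θ, (I.prior θ : ℝ) * ∑ a, t θ a * I.expReward θ a) ≤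
      ∑ θ, (I.prior θ : ℝ) * ∑ a, mixT α β br t θ a * I.expReward θ a := by
    rw [Finset.mul_sum]
    refine Finset.sum_le_sum fun θ _ => ?_
    rw [mul_left_comm, Finset.mul_sum]
    refine mul_le_mul_of_nonneg_left (Finset.sum_le_sum fun a _ => ?_) (prior_nonneg' θ)
    rw [← mul_assoc]
    refine mul_le_mul_of_nonneg_right ?_ (expReward_nonneg θ a)
    rw [mixT]
    have := mul_nonneg hβ (Finset.sum_nonneg fun b (_ : b ∈ Finset.univ) =>
      mul_nonneg (h.t_nonneg θ b)
        (Finset.sum_nonneg fun j (_ : j ∈ Finset.univ) =>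
          show (0 : ℝ) ≤ if (fun i => br i (θ i) j) = a then 1 else 0 by split_ifs <;> norm_num))
    linarith
  have h2 : ∑ i, ∑ θ, (I.prior θ : ℝ) * ∑ a, I.pay i (θ i) a (mixY α β br σ Q ξ y i θ a) ≤
      α * (∑ i, ∑ θ, (I.prior θ : ℝ) * ∑ a, I.pay i (θ i) a (y i θ a)) +
        β * (Fintype.card J * (I.numAgents * C)) := by
    have hi : ∀ i, ∑ θ, (I.prior θ : ℝ) * ∑ a, I.pay i (θ i) a (mixY α β br σ Q ξ y i θ a) ≤
        α * (∑ θ, (I.prior θ : ℝ) * ∑ a, I.pay i (θ i) a (y i θ a)) +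
          β * (Fintype.card J * C) := by
      intro i
      rw [← sub_le_iff_le_add', Finset.mul_sum, ← Finset.sum_sub_distrib]
      have hrw : ∀ θ, (I.prior θ : ℝ) * ∑ a, I.pay i (θ i) a (mixY α β br σ Q ξ y i θ a) -
          α * ((I.prior θ : ℝ) * ∑ a, I.pay i (θ i) a (y i θ a)) =
          (I.prior θ : ℝ) * ((∑ a, I.pay i (θ i) a (mixY α β br σ Q ξ y i θ a)) -
            α * ∑ a, I.pay i (θ i) a (y i θ a)) := fun θ => by ring
      simp only [hrw]
      refine sum_prior_mul_le fun θ hθ => ?_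
      rw [hr.sum_pay_mixY h i hθ, add_sub_cancel_left]
      refine mul_le_mul_of_nonneg_left ?_ hβ
      refine (Finset.sum_le_sum fun j _ => pay_le i (θ i) _ (hC j)).trans ?_
      simp
    refine (Finset.sum_le_sum fun i _ => hi i).trans ?_
    rw [Finset.sum_add_distrib, ← Finset.mul_sum]
    simp only [Finset.sum_const, Finset.card_univ, Fintype.card_fin, nsmul_eq_mul]
    linarith
  have h3 := h.value_le_one
  have h4 : 0 ≤ β * Fintype.card J := mul_nonneg hβ (Nat.cast_nonneg _)
  rw [schemeValue] at h3 ⊢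
  rw [schemeValue]
  have h5 : α = 1 - β * Fintype.card J := by linarith
  subst h5
  have h6 := mul_le_mul_of_nonneg_left h3 h4
  linarith

end Relocates

end Mix

/-! ### Regular schemes, and the values of the two problems -/

/-- If differences of expected payments are multiplied with a factor that makes them exceed the
costs, then best responses maximize the expected payment. -/
theorem IsBest.pay_le_of_gap {i : I.Agent} {θ : I.AgentType} {q : I.Outcome → ℝ} {K : ℝ}
    {a : I.Action} (h : I.IsBest i θ (K • q) a)
    (hK : ∀ a a', I.pay i θ a q < I.pay i θ a' q → 1 < K * (I.pay i θ a' q - I.pay i θ a q))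
    (a' : I.Action) : I.pay i θ a' q ≤ I.pay i θ a q := by
  by_contra! hlt
  have h1 := hK a a' hlt
  have h2 := h a'
  rw [pay_smul, pay_smul] at h2
  nlinarith [cost_nonneg i θ a, cost_le_one i θ a']

/-- Every scheme can be made regular at an arbitrarily small loss, using the lottery over
multiples `K • y i θ a` of its own payment schemes. -/
theorem IsScheme.exists_regular {t : I.TypeProfile → I.ActionProfile → ℝ}
    {ξ : I.Agent → I.TypeProfile → I.Action → ℝ}
    {y : I.Agent → I.TypeProfile → I.Action → I.Outcome → ℝ} (h : I.IsScheme t ξ y)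
    {ε : ℝ} (hε : 0 < ε) :
    ∃ t' ξ' y', I.IsScheme t' ξ' y' ∧ (∀ i θ a ω, y' i θ a ω ≠ 0 → ξ' i θ a ≠ 0) ∧
      I.schemeValue t y - ε ≤ I.schemeValue t' y' := by
  classical
  let J := I.Agent × I.TypeProfile × I.Action
  let q : J → I.Outcome → ℝ := fun j => y j.1 j.2.1 j.2.2
  have hgap : ∀ᶠ K : ℝ in Filter.atTop, ∀ (i : I.Agent) (θ : I.AgentType) (j : J)
      (a a' : I.Action), I.pay i θ a (q j) < I.pay i θ a' (q j) →
        1 < K * (I.pay i θ a' (q j) - I.pay i θ a (q j)) := by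
    simp only [Filter.eventually_all]
    intro i θ j a a' hlt
    have hpos := sub_pos.2 hlt
    filter_upwards [Filter.eventually_gt_atTop (I.pay i θ a' (q j) - I.pay i θ a (q j))⁻¹]
      with K hK
    rwa [inv_lt_iff_one_lt_mul₀ hpos] at hK
  obtain ⟨K, hK, hK0⟩ := (hgap.and (Filter.eventually_ge_atTop 0)).exists
  let Q : J → I.Outcome → ℝ := fun j => K • q j
  choose br hbr using fun i θ j => I.exists_isBest i θ (Q j)
  let σ : I.Agent → I.TypeProfile → I.Action → I.Action := fun i θ a =>
    if ξ i θ a = 0 then br i (θ i) (i, θ, a) else a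
  have hr : Relocates ξ y Q br σ := by
    refine ⟨fun j ω => mul_nonneg hK0 (h.y_nonneg _ _ _ ω), hbr, fun i θ a ha => if_neg ha,
      fun i θ a ha _ => ⟨(i, θ, a), (if_pos ha).symm⟩, fun i θ a ha _ a' => ?_⟩
    simp only [σ, ha, if_true]
    exact (hbr i (θ i) (i, θ, a)).pay_le_of_gap (hK i (θ i) (i, θ, a)) a'
  obtain ⟨C, hC⟩ := (Set.finite_range fun x : J × I.Outcome => Q x.1 x.2).bddAbove
  have hC' : ∀ j ω, Q j ω ≤ max C 0 := fun j ω => (hC ⟨(j, ω), rfl⟩).trans (le_max_left _ _)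
  set m : ℝ := ((Fintype.card J : ℕ) : ℝ)
  have hm : 0 ≤ m := Nat.cast_nonneg _
  set M : ℝ := m * (1 + I.numAgents * max C 0) with hM
  have hM0 : 0 ≤ M :=
    mul_nonneg hm (add_nonneg zero_le_one (mul_nonneg (Nat.cast_nonneg _) (le_max_right _ _)))
  set B : ℝ := M / ε + 1
  have hB : 0 < B := add_pos_of_nonneg_of_pos (div_nonneg hM0 hε.le) one_pos
  have hN : 0 < B + m := by linarith
  have hαβ : B / (B + m) + (B + m)⁻¹ * m = 1 := by
    field_simp
  refine ⟨_, _, _, hr.isScheme (div_pos hB hN).le (inv_pos.2 hN).le hαβ h,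
    hr.mixXi_ne_zero (div_pos hB hN) (inv_pos.2 hN) h, ?_⟩
  refine le_trans ?_ (hr.value_ge (inv_pos.2 hN).le hαβ h hC')
  rw [← hM]
  have : (B + m)⁻¹ * M ≤ ε := by
    rw [inv_mul_le_iff₀ hN]
    have : M = M / ε * ε := by field_simp
    nlinarith
  linarith

end Instance

open Instance in
theorem IsPaymentBound.nonneg {τ : ℕ → ℝ} (h : IsPaymentBound τ) (I : Instance) :
    0 ≤ τ I.size := by
  let i : I.Agent := ⟨0, I.numAgents_pos⟩
  obtain ⟨θ⟩ : Nonempty I.TypeProfile := by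
    by_contra hn
    rw [not_nonempty_iff] at hn
    simpa using I.prior_sum
  obtain ⟨a, ha⟩ := I.exists_isBest i (θ i) 0
  obtain ⟨ω⟩ : Nonempty I.Outcome := by
    by_contra hn
    rw [not_nonempty_iff] at hn
    simpa using I.F_sum i (θ i) a
  obtain ⟨p, hp, -, hle⟩ := h.bound I i (θ i) a (ha.mem_inducible fun _ => le_rfl)
  exact (hp i ω).trans (hle ω)

namespace Instance

variable {I : Instance}

theorem exists_regular_lpPoint {s : I.LPPoint} (hs : s.Feasible) {ε : ℝ} (hε : 0 < ε) :
    ∃ s' : I.LPPoint, s'.Feasible ∧ ¬ s'.Irregular ∧ s.value - ε ≤ s'.value := by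
  obtain ⟨t, ξ, y, h, hreg, hv⟩ := hs.isScheme.exists_regular hε
  obtain ⟨s', hs', rfl, rfl, rfl⟩ := h.exists_feasible
  refine ⟨s', hs', ?_, ?_⟩
  · rintro ⟨i, θ, a, -, ω, hy, hξ⟩
    exact hreg i θ a ω hy.ne' hξ
  · rwa [LPPoint.value_eq h, LPPoint.value_eq hs.isScheme]

theorem menuValues_nonempty (I : Instance) : I.menuValues.Nonempty := by
  classical
  obtain ⟨a₀, h₀⟩ := I.exists_null
  let μ : I.Menu := ⟨fun _ b => if b = fun _ => a₀ then 1 else 0,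
    fun _ _ a => if a = a₀ then 1 else 0, fun _ _ _ _ => 0⟩
  have hpay : ∀ i θ a, I.pay i θ a (fun _ => 0) = 0 := fun i θ a => pay_zero i θ a
  refine ⟨μ.value, μ, ⟨?_, ?_, ?_, ?_, ?_, ?_⟩, rfl⟩
  · intro i θ _ θ'
    have := I.nonempty_action
    simp only [μ, hpay, ite_mul, one_mul, zero_mul, Finset.sum_ite_eq', Finset.mem_univ, if_true,
      h₀, zero_sub]
    refine ciSup_le fun a => ?_
    have := cost_nonneg i (θ i) a
    simpa using this
  · intro i θ _
    simp [μ]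
  · intro i θ _ a
    simp only [μ, Finset.sum_ite_eq', Finset.mem_filter, Finset.mem_univ, true_and, eq_comm]
  · intro θ _ a
    simp only [μ]
    split_ifs <;> norm_num
  · intro i θ _ a
    simp only [μ]
    split_ifs <;> norm_num
  · intro i θ _ a ω
    exact le_rfl

theorem exists_lp_of_menu {μ : I.Menu} (h : μ.Feasible) :
    ∃ s : I.LPPoint, s.Feasible ∧ s.value = μ.value := by
  obtain ⟨t, ξ, y, hs, hv⟩ := h.exists_isScheme
  obtain ⟨s, hs', rfl, rfl, rfl⟩ := hs.exists_feasible
  exact ⟨s, hs', (LPPoint.value_eq hs).trans hv⟩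

theorem LPPoint.Feasible.value_le_one {s : I.LPPoint} (h : s.Feasible) : s.value ≤ 1 := by
  rw [LPPoint.value_eq h.isScheme]
  exact h.isScheme.value_le_one

theorem menuValues_subset (I : Instance) : I.menuValues ⊆ I.lpValues := by
  rintro v ⟨μ, hμ, rfl⟩
  obtain ⟨s, hs, hv⟩ := exists_lp_of_menu hμ
  exact ⟨s, hs, hv⟩

theorem bddAbove_lpValues (I : Instance) : BddAbove I.lpValues := by
  refine ⟨1, ?_⟩
  rintro v ⟨s, hs, rfl⟩
  exact hs.value_le_one

theorem supValue_le_lpValue (I : Instance) : I.supValue ≤ I.lpValue :=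
  csSup_le_csSup I.bddAbove_lpValues I.menuValues_nonempty I.menuValues_subset

theorem isLUB_menuValues (I : Instance) : IsLUB I.menuValues I.supValue :=
  isLUB_csSup I.menuValues_nonempty (I.bddAbove_lpValues.mono I.menuValues_subset)

theorem isLUB_lpValues (I : Instance) : IsLUB I.lpValues I.lpValue :=
  isLUB_csSup (I.menuValues_nonempty.mono I.menuValues_subset) I.bddAbove_lpValues

theorem LPPoint.Optimal.supValue_le {s : I.LPPoint} (h : s.Optimal) : I.supValue ≤ s.value := by
  refine I.supValue_le_lpValue.trans (csSup_le ⟨_, s, h.1, rfl⟩ ?_)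
  rintro v ⟨s', hs', rfl⟩
  exact h.2 s' hs'

end Instance

/-! ### Small solutions of linear systems -/

/-- The conic version of Carathéodory's theorem. -/
theorem exists_nonneg_linearIndepOn {ι E : Type*} [Fintype ι] [AddCommGroup E] [Module ℝ E]
    (v : ι → E) (x : ι → ℝ) (hx : ∀ i, 0 ≤ x i) :
    ∃ x' : ι → ℝ, (∀ i, 0 ≤ x' i) ∧ ∑ i, x' i • v i = ∑ i, x i • v i ∧
      LinearIndepOn ℝ v {i | x' i ≠ 0} := by
  classical
  induction hn : (Finset.univ.filter fun i => x i ≠ 0).card using Nat.strong_induction_on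
    generalizing x with
  | _ n ih =>
    set S : Finset ι := Finset.univ.filter fun i => x i ≠ 0 with hS
    by_cases hli : LinearIndepOn ℝ v (S : Set ι)
    · exact ⟨x, hx, rfl, by simpa [hS] using hli⟩
    · rw [linearIndepOn_finset_iff] at hli
      push Not at hli
      obtain ⟨f, hf, i₁, hi₁, hne⟩ := hli
      obtain ⟨g, hg, hpos⟩ : ∃ g : ι → ℝ, ∑ i ∈ S, g i • v i = 0 ∧ ∃ i ∈ S, 0 < g i := by
        rcases lt_or_gt_of_ne hne with h | h
        · exact ⟨fun i => -f i, by simp [hf], i₁, hi₁, by linarith⟩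
        · exact ⟨f, hf, i₁, hi₁, h⟩
      -- Move along the relation `g` until the first coefficient vanishes.
      obtain ⟨i₀, hi₀, hmin⟩ := Finset.exists_min_image (S.filter fun i => 0 < g i)
        (fun i => x i / g i) (by
          obtain ⟨i, hi, h⟩ := hpos
          exact ⟨i, Finset.mem_filter.2 ⟨hi, h⟩⟩)
      obtain ⟨hi₀S, hg₀⟩ := Finset.mem_filter.1 hi₀
      set r := x i₀ / g i₀ with hr
      have hr0 : 0 ≤ r := div_nonneg (hx i₀) hg₀.le
      let x' : ι → ℝ := fun i => if i ∈ S then x i - r * g i else 0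
      have hx'0 : ∀ i, 0 ≤ x' i := by
        intro i
        simp only [x']
        split_ifs with hi
        · rcases le_or_gt (g i) 0 with h | h
          · nlinarith [hx i]
          · have := hmin i (Finset.mem_filter.2 ⟨hi, h⟩)
            rw [le_div_iff₀ h] at this
            linarith
        · exact le_rfl
      have hsum : ∑ i, x' i • v i = ∑ i, x i • v i := by
        have h1 : ∑ i, x i • v i = ∑ i ∈ S, x i • v i := by
          symm
          refine Finset.sum_subset (Finset.subset_univ _) fun i _ hi => ?_
          have : x i = 0 := by simpa [hS] using hi
          rw [this, zero_smul]
        have h2 : ∑ i, x' i • v i = ∑ i ∈ S, (x i - r * g i) • v i := by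
          simp only [x', ite_smul, zero_smul]
          rw [← Finset.sum_filter]
          simp
        rw [h1, h2]
        simp only [sub_smul, mul_smul, Finset.sum_sub_distrib, ← Finset.smul_sum, hg, smul_zero,
          sub_zero]
      have hlt : (Finset.univ.filter fun i => x' i ≠ 0).card < n := by
        rw [← hn]
        refine Finset.card_lt_card ⟨fun i hi => ?_, fun hsub => ?_⟩
        · by_contra hn'
          exact (Finset.mem_filter.1 hi).2 (if_neg hn')
        · have := (Finset.mem_filter.1 (hsub hi₀S)).2
          apply this
          simp only [x', hi₀S, if_true, hr]
          field_simp
          simp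
      obtain ⟨x'', h1, h2, h3⟩ := ih _ hlt x' hx'0 rfl
      exact ⟨x'', h1, h2.trans hsum, h3⟩

/-- Cramer's rule for the normal equations of an integral system with linearly independent
columns: as the determinant of the Gram matrix is a nonzero integer, the entries of a solution
are at most as large as the numerators. -/
theorem solution_le_of_linearIndependent {m κ : Type*} [Fintype m] [Fintype κ]
    (A : Matrix m κ ℤ) (b : m → ℤ) (H : ℕ) (hA : ∀ i j, |A i j| ≤ H) (hb : ∀ i, |b i| ≤ H)
    (x : κ → ℝ) (hAx : ∀ i, ∑ k, (A i k : ℝ) * x k = b i)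
    (hli : LinearIndependent ℝ fun k i => (A i k : ℝ)) (k : κ) :
    |x k| ≤ (Fintype.card κ).factorial * ((Fintype.card m * H ^ 2 : ℕ) : ℝ) ^ Fintype.card κ := by
  classical
  let V : Matrix m κ ℝ := A.map fun z => (z : ℝ)
  let G : Matrix κ κ ℤ := A.transpose * A
  let c : κ → ℤ := A.transpose.mulVec b
  have hGV : (G.map fun z => (z : ℝ)) = V.transpose * V := by
    ext i j
    simp [G, V, Matrix.mul_apply]
  have hV : V.mulVec x = fun i => (b i : ℝ) := by
    ext i
    simpa [V, Matrix.mulVec, dotProduct] using hAx i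
  have hGx : (G.map fun z => (z : ℝ)).mulVec x = fun k => (c k : ℝ) := by
    rw [hGV, ← Matrix.mulVec_mulVec, hV]
    ext j
    simp [V, c, Matrix.mulVec, dotProduct]
  have hdet : G.det ≠ 0 := by
    intro h0
    have h1 : (V.transpose * V).det = 0 := by
      rw [← hGV, ← Int.cast_det, h0, Int.cast_zero]
    obtain ⟨w, hw, hw0⟩ := Matrix.exists_mulVec_eq_zero_iff.2 h1
    rw [← Matrix.conjTranspose_eq_transpose_of_trivial,
      Matrix.conjTranspose_mul_self_mulVec_eq_zero] at hw0
    have hinj : Function.Injective V.mulVec := Matrix.mulVec_injective_iff.2 hli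
    exact hw (hinj (hw0.trans (Matrix.mulVec_zero V).symm))
  have hcramer : (G.det : ℝ) * x k = ((G.updateCol k c).det : ℝ) := by
    have h1 : (G.map fun z => (z : ℝ)).cramer (fun k => (c k : ℝ)) k = (G.det : ℝ) * x k := by
      rw [← hGx, Matrix.cramer_eq_adjugate_mulVec, Matrix.mulVec_mulVec, Matrix.adjugate_mul,
        Matrix.smul_mulVec, Matrix.one_mulVec, ← Int.cast_det]
      rfl
    rw [← h1, Matrix.cramer_apply, Int.cast_det]
    congr 1
    ext i j
    simp only [Matrix.updateCol_apply, Matrix.map_apply]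
    split_ifs <;> rfl
  have hdot : ∀ u w : m → ℤ, (∀ i, |u i| ≤ H) → (∀ i, |w i| ≤ H) →
      |∑ i, u i * w i| ≤ ((Fintype.card m * H ^ 2 : ℕ) : ℤ) := by
    intro u w hu hw
    refine (Finset.abs_sum_le_sum_abs _ _).trans ?_
    have : ∀ i ∈ Finset.univ, |u i * w i| ≤ (H : ℤ) ^ 2 := fun i _ => by
      rw [abs_mul, sq]
      exact mul_le_mul (hu i) (hw i) (abs_nonneg _) (Nat.cast_nonneg _)
    refine (Finset.sum_le_sum this).trans ?_
    simp
  have hle := Matrix.det_le (A := G.updateCol k c) (abv := AbsoluteValue.abs)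
    (x := ((Fintype.card m * H ^ 2 : ℕ) : ℤ)) (by
      intro i j
      rw [Matrix.updateCol_apply]
      split_ifs
      · exact hdot (fun l => A l i) b (fun l => hA l i) hb
      · exact hdot (fun l => A l i) (fun l => A l j) (fun l => hA l i) fun l => hA l j)
  have hle' : |((G.updateCol k c).det : ℝ)| ≤
      (Fintype.card κ).factorial * ((Fintype.card m * H ^ 2 : ℕ) : ℝ) ^ Fintype.card κ := by
    rw [nsmul_eq_mul] at hle
    exact_mod_cast hle
  refine le_trans ?_ hle'
  rw [← hcramer, abs_mul]
  have h1 : (1 : ℝ) ≤ |(G.det : ℝ)| := by exact_mod_cast Int.one_le_abs hdet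
  exact le_mul_of_one_le_left (abs_nonneg _) h1

/-- A solvable system with bounded integral coefficients has a bounded nonnegative solution. -/
theorem exists_nonneg_solution_le {m κ : Type*} [Fintype m] [Fintype κ]
    (A : Matrix m κ ℤ) (b : m → ℤ) (H : ℕ) (hA : ∀ i j, |A i j| ≤ H) (hb : ∀ i, |b i| ≤ H)
    (x : κ → ℝ) (hx : ∀ k, 0 ≤ x k) (hAx : ∀ i, ∑ k, (A i k : ℝ) * x k = b i) :
    ∃ x' : κ → ℝ, (∀ k, 0 ≤ x' k) ∧ (∀ i, ∑ k, (A i k : ℝ) * x' k = b i) ∧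
      ∀ k, x' k ≤ (Fintype.card κ).factorial *
        ((Fintype.card m * H ^ 2 + 1 : ℕ) : ℝ) ^ Fintype.card κ := by
  classical
  obtain ⟨x', hx', hsum, hli⟩ := exists_nonneg_linearIndepOn (fun k i => (A i k : ℝ)) x hx
  have hAx' : ∀ i, ∑ k, (A i k : ℝ) * x' k = b i := by
    intro i
    have := congrFun hsum i
    simp only [Finset.sum_apply, Pi.smul_apply, smul_eq_mul] at this
    rw [← hAx i]
    simpa only [mul_comm] using this
  refine ⟨x', hx', hAx', fun k => ?_⟩
  have hbig : (1 : ℝ) ≤ ((Fintype.card m * H ^ 2 + 1 : ℕ) : ℝ) := by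
    push_cast
    have : (0 : ℝ) ≤ (Fintype.card m : ℝ) * (H : ℝ) ^ 2 := by positivity
    linarith
  by_cases hk : x' k = 0
  · rw [hk]
    positivity
  · let S := {k // x' k ≠ 0}
    have hcard : Fintype.card S ≤ Fintype.card κ := Fintype.card_subtype_le _
    have h1 := solution_le_of_linearIndependent (m := m) (κ := S) (fun i k => A i k) b H
      (fun i j => hA i j) hb (fun k => x' k) (by
        intro i
        rw [← hAx' i]
        refine (Finset.sum_subtype (Finset.univ.filter fun k => x' k ≠ 0) (fun k => by simp)
          fun k => (A i k : ℝ) * x' k).symm.trans ?_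
        rw [Finset.sum_filter]
        refine Finset.sum_congr rfl fun k _ => ?_
        by_cases h : x' k = 0 <;> simp [h]) hli ⟨k, hk⟩
    refine (le_abs_self _).trans (h1.trans ?_)
    have h2 : ((Fintype.card S).factorial : ℝ) ≤ (Fintype.card κ).factorial := by
      exact_mod_cast Nat.factorial_le hcard
    have h3 : ((Fintype.card m * H ^ 2 : ℕ) : ℝ) ^ Fintype.card S ≤
        ((Fintype.card m * H ^ 2 + 1 : ℕ) : ℝ) ^ Fintype.card κ := by
      refine (pow_le_pow_left₀ (Nat.cast_nonneg _) ?_ _).trans (pow_le_pow_right₀ hbig hcard)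
      push_cast
      linarith
    exact mul_le_mul h2 h3 (by positivity) (by positivity)

/-! ### Sizes of encodings -/

namespace Data

theorem size_pos (d : Data) : 0 < d.size := by
  cases d <;> simp only [size] <;> omega

theorem size_ofList (l : List Data) :
    (ofList l).size = 1 + (l.map fun d => d.size + 1).sum := by
  induction l with
  | nil => simp [ofList, size]
  | cons d l ih =>
    simp only [ofList, size, ih, List.map_cons, List.sum_cons]
    omega

end Data

theorem size_encSeq {n : ℕ} (f : Fin n → Data) :
    (encSeq f).size = 1 + ∑ i, ((f i).size + 1) := by
  rw [encSeq, Data.size_ofList, List.map_ofFn, List.sum_ofFn]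
  rfl

theorem sum_size_le {n : ℕ} (f : Fin n → Data) : ∑ i, (f i).size ≤ (encSeq f).size := by
  rw [size_encSeq, Finset.sum_add_distrib]
  omega

theorem size_le_encSeq {n : ℕ} (f : Fin n → Data) (i : Fin n) :
    (f i).size ≤ (encSeq f).size :=
  (Finset.single_le_sum (f := fun i => (f i).size) (fun _ _ => Nat.zero_le _)
    (Finset.mem_univ i)).trans (sum_size_le f)

theorem length_le_encSeq {n : ℕ} (f : Fin n → Data) : n ≤ (encSeq f).size := by
  rw [size_encSeq, Finset.sum_add_distrib]
  simp
  omega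

theorem den_le_two_pow (q : ℚ) : q.den ≤ 2 ^ (encRat q).size := by
  refine (Nat.lt_size_self q.den).le.trans (Nat.pow_le_pow_right two_pos ?_)
  simp only [encRat, Data.size, Int.natAbs_natCast]
  omega

namespace Instance

variable (I : Instance)

theorem size_F_add_size_cost_le :
    (encSeq fun i => encSeq fun θ => encSeq fun a => encSeq fun ω => encRat (I.F i θ a ω)).size +
      (encSeq fun i => encSeq fun θ => encSeq fun a => encRat (I.cost i θ a)).size ≤ I.size := by
  simp only [size, enc, Data.size_ofList, List.map_cons, List.sum_cons]
  omega

/-- The product of the denominators of the probabilities and costs of agent `i` of type `θ`. -/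
def commonDen (i : I.Agent) (θ : I.AgentType) : ℕ :=
  (∏ a, ∏ ω, (I.F i θ a ω).den) * ∏ a, (I.cost i θ a).den

theorem den_F_dvd (i : I.Agent) (θ : I.AgentType) (a : I.Action) (ω : I.Outcome) :
    (I.F i θ a ω).den ∣ I.commonDen i θ :=
  ((Finset.dvd_prod_of_mem (fun ω => (I.F i θ a ω).den) (Finset.mem_univ ω)).trans
    (Finset.dvd_prod_of_mem (fun a => ∏ ω, (I.F i θ a ω).den) (Finset.mem_univ a))).mul_right _

theorem den_cost_dvd (i : I.Agent) (θ : I.AgentType) (a : I.Action) :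
    (I.cost i θ a).den ∣ I.commonDen i θ :=
  (Finset.dvd_prod_of_mem (fun a => (I.cost i θ a).den) (Finset.mem_univ a)).mul_left _

theorem commonDen_le (i : I.Agent) (θ : I.AgentType) : I.commonDen i θ ≤ 2 ^ I.size := by
  have h1 : ∏ a, ∏ ω, (I.F i θ a ω).den ≤ 2 ^ ∑ a, ∑ ω, (encRat (I.F i θ a ω)).size := by
    simp only [← Finset.prod_pow_eq_pow_sum]
    exact Finset.prod_le_prod' fun a _ => Finset.prod_le_prod' fun ω _ => den_le_two_pow _
  have h2 : ∏ a, (I.cost i θ a).den ≤ 2 ^ ∑ a, (encRat (I.cost i θ a)).size := by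
    rw [← Finset.prod_pow_eq_pow_sum]
    exact Finset.prod_le_prod' fun a _ => den_le_two_pow _
  refine (Nat.mul_le_mul h1 h2).trans ?_
  rw [← pow_add]
  refine Nat.pow_le_pow_right two_pos (le_trans (add_le_add ?_ ?_) I.size_F_add_size_cost_le)
  · exact (Finset.sum_le_sum fun a _ => sum_size_le _).trans ((sum_size_le _).trans
      ((size_le_encSeq (fun θ => encSeq fun a => encSeq fun ω => encRat (I.F i θ a ω)) θ).trans
        (size_le_encSeq (fun i => encSeq fun θ => encSeq fun a => encSeq fun ω =>
          encRat (I.F i θ a ω)) i)))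
  · exact (sum_size_le _).trans
      ((size_le_encSeq (fun θ => encSeq fun a => encRat (I.cost i θ a)) θ).trans
        (size_le_encSeq (fun i => encSeq fun θ => encSeq fun a => encRat (I.cost i θ a)) i))

theorem numActions_le (i : I.Agent) (θ : I.AgentType) : I.numActions ≤ I.size :=
  (length_le_encSeq fun a => encRat (I.cost i θ a)).trans
    ((size_le_encSeq (fun θ => encSeq fun a => encRat (I.cost i θ a)) θ).trans
      ((size_le_encSeq (fun i => encSeq fun θ => encSeq fun a => encRat (I.cost i θ a)) i).trans
        ((Nat.le_add_left _ _).trans I.size_F_add_size_cost_le)))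

theorem numOutcomes_le (i : I.Agent) (θ : I.AgentType) (a : I.Action) :
    I.numOutcomes ≤ I.size :=
  (length_le_encSeq fun ω => encRat (I.F i θ a ω)).trans
    ((size_le_encSeq (fun a => encSeq fun ω => encRat (I.F i θ a ω)) a).trans
      ((size_le_encSeq (fun θ => encSeq fun a => encSeq fun ω => encRat (I.F i θ a ω)) θ).trans
        ((size_le_encSeq (fun i => encSeq fun θ => encSeq fun a => encSeq fun ω =>
          encRat (I.F i θ a ω)) i).trans
            ((Nat.le_add_right _ _).trans I.size_F_add_size_cost_le))))

theorem F_le_one (i : I.Agent) (θ : I.AgentType) (a : I.Action) (ω : I.Outcome) :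
    I.F i θ a ω ≤ 1 := by
  rw [← I.F_sum i θ a]
  exact Finset.single_le_sum (f := fun ω => I.F i θ a ω) (fun ω _ => I.F_nonneg i θ a ω)
    (Finset.mem_univ ω)

end Instance

theorem exists_int_eq_mul {q : ℚ} {D : ℕ} (h : q.den ∣ D) : ∃ z : ℤ, (z : ℝ) = D * (q : ℝ) := by
  obtain ⟨k, rfl⟩ := h
  refine ⟨k * q.num, ?_⟩
  have : (q : ℝ) = q.num / q.den := by exact_mod_cast (Rat.num_div_den q).symm
  rw [this]
  have hd : (q.den : ℝ) ≠ 0 := by exact_mod_cast q.den_ne_zero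
  push_cast
  field_simp

theorem abs_le_of_cast_eq {z : ℤ} {D : ℕ} {x : ℝ} (h : (z : ℝ) = D * x) (hx : |x| ≤ 1) :
    |z| ≤ (D : ℤ) := by
  have : |(z : ℝ)| ≤ D := by
    rw [h, abs_mul, Nat.abs_cast]
    exact mul_le_of_le_one_right (Nat.cast_nonneg _) hx
  exact_mod_cast this

theorem factorial_mul_pow_le {z k c H : ℕ} (hk : k ≤ 2 * z) (hc : c ≤ z) (hH : H ≤ 2 ^ z) :
    k.factorial * (c * H ^ 2 + 1) ^ k ≤ 2 ^ (10 * z ^ 2) := by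
  have h1 : k.factorial ≤ 2 ^ (4 * z ^ 2) := by
    calc k.factorial ≤ k ^ k := Nat.factorial_le_pow k
      _ ≤ (2 ^ k) ^ k := Nat.pow_le_pow_left Nat.lt_two_pow_self.le _
      _ = 2 ^ (k * k) := (pow_mul _ _ _).symm
      _ ≤ 2 ^ (4 * z ^ 2) := Nat.pow_le_pow_right two_pos (by nlinarith)
  have h2 : c * H ^ 2 + 1 ≤ 2 ^ (3 * z) := by
    have h3 : z + 1 ≤ 2 ^ z := Nat.lt_two_pow_self
    have h4 : H ^ 2 ≤ (2 ^ z) ^ 2 := Nat.pow_le_pow_left hH 2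
    have h5 : 1 ≤ (2 ^ z) ^ 2 := Nat.one_le_pow _ _ (Nat.two_pow_pos z)
    calc c * H ^ 2 + 1 ≤ z * (2 ^ z) ^ 2 + (2 ^ z) ^ 2 :=
          add_le_add (Nat.mul_le_mul hc h4) h5
      _ = (z + 1) * (2 ^ z) ^ 2 := by ring
      _ ≤ 2 ^ z * (2 ^ z) ^ 2 := Nat.mul_le_mul_right _ h3
      _ = 2 ^ (3 * z) := by ring
  calc k.factorial * (c * H ^ 2 + 1) ^ k ≤ 2 ^ (4 * z ^ 2) * (2 ^ (3 * z)) ^ (2 * z) :=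
        Nat.mul_le_mul h1 ((Nat.pow_le_pow_left h2 k).trans
          (Nat.pow_le_pow_right (Nat.two_pow_pos _) hk))
    _ = 2 ^ (10 * z ^ 2) := by
        rw [← pow_mul, ← pow_add]
        congr 1
        ring

/-- The payments that induce an action are the solutions of a system of linear inequalities, so
they can be chosen to be at most exponential in the size of the instance. -/
theorem exists_isPaymentBound : ∃ τ : ℕ → ℝ, IsPaymentBound τ := by
  refine ⟨fun x => 2 ^ (10 * x ^ 2), ⟨10 * Polynomial.X ^ 2, ?_⟩, ?_⟩
  · simp only [Polynomial.eval_mul, Polynomial.eval_ofNat, Polynomial.eval_pow,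
      Polynomial.eval_X]
    exact Asymptotics.isBigO_refl _ _
  intro I i θ a ha
  classical
  obtain ⟨p, hp, hic⟩ : ∃ p : I.Agent → I.Outcome → ℝ, (∀ j ω, 0 ≤ p j ω) ∧
      a ∈ I.icActions i θ p := by
    simpa [Instance.inducible] using ha
  set D := I.commonDen i θ with hD
  choose zF hzF using fun a ω => exists_int_eq_mul (I.den_F_dvd i θ a ω)
  choose zc hzc using fun a => exists_int_eq_mul (I.den_cost_dvd i θ a)
  have hDpos : (0 : ℝ) < D := by
    have : 0 < D := Nat.mul_pos
      (Finset.prod_pos fun a _ => Finset.prod_pos fun ω _ => Rat.den_pos _)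
      (Finset.prod_pos fun a _ => Rat.den_pos _)
    exact_mod_cast this
  -- One equation for each action `a'`, with a slack variable for its inequality.
  let A : Matrix I.Action (I.Outcome ⊕ I.Action) ℤ := fun a' =>
    Sum.elim (fun ω => zF a ω - zF a' ω) fun a'' => if a' = a'' then -1 else 0
  let b : I.Action → ℤ := fun a' => zc a - zc a'
  have hsum : ∀ (x : I.Outcome ⊕ I.Action → ℝ) a', ∑ k, (A a' k : ℝ) * x k =
      D * (I.pay i θ a (fun ω => x (Sum.inl ω)) - I.pay i θ a' fun ω => x (Sum.inl ω)) -
        x (Sum.inr a') := by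
    intro x a'
    simp only [A, Fintype.sum_sum_type, Sum.elim_inl, Sum.elim_inr, Int.cast_sub, hzF,
      Instance.pay, mul_sub, Finset.mul_sum, sub_mul, Finset.sum_sub_distrib, mul_assoc]
    simp [sub_eq_add_neg, hD]
  have hD1 : 1 ≤ (D : ℤ) := by exact_mod_cast hDpos
  obtain ⟨x, hx, hAx, hle⟩ := exists_nonneg_solution_le A b D (by
      rintro a' (ω | a'')
      · refine abs_le_of_cast_eq (x := I.F i θ a ω - I.F i θ a' ω) ?_ ?_
        · simp only [A, Sum.elim_inl, Int.cast_sub, hzF, mul_sub]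
          rfl
        · rw [abs_le]
          have h1 : (I.F i θ a ω : ℝ) ≤ 1 := by exact_mod_cast I.F_le_one i θ a ω
          have h2 : (I.F i θ a' ω : ℝ) ≤ 1 := by exact_mod_cast I.F_le_one i θ a' ω
          have h3 : (0 : ℝ) ≤ I.F i θ a ω := by exact_mod_cast I.F_nonneg i θ a ω
          have h4 : (0 : ℝ) ≤ I.F i θ a' ω := by exact_mod_cast I.F_nonneg i θ a' ω
          constructor <;> linarith
      · simp only [A, Sum.elim_inr]
        split_ifs <;> (simp; try omega))
    (fun a' => abs_le_of_cast_eq (x := I.cost i θ a - I.cost i θ a')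
      (by simp only [b, Int.cast_sub, hzc, mul_sub]; rfl) (by
        rw [abs_le]
        constructor <;> linarith [Instance.cost_nonneg i θ a, Instance.cost_nonneg i θ a',
          Instance.cost_le_one i θ a, Instance.cost_le_one i θ a']))
    (Sum.elim (p i) fun a' => D * ((I.pay i θ a (p i) - (I.cost i θ a : ℝ)) -
      (I.pay i θ a' (p i) - (I.cost i θ a' : ℝ))))
    (by
      rintro (ω | a')
      · exact hp i ω
      · exact mul_nonneg hDpos.le (sub_nonneg.2 (hic a')))
    (by
      intro a'
      rw [hsum]
      simp only [Sum.elim_inl, Sum.elim_inr, b, Int.cast_sub, hzc]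
      ring)
  refine ⟨fun _ ω => x (Sum.inl ω), fun _ ω => hx _, fun a' => ?_, fun ω => ?_⟩
  · have h1 := hAx a'
    rw [hsum] at h1
    simp only [b, Int.cast_sub, hzc] at h1
    have h2 := hx (Sum.inr a')
    have h3 : 0 ≤ (D : ℝ) * ((I.pay i θ a (fun ω => x (Sum.inl ω)) - (I.cost i θ a : ℝ)) -
      (I.pay i θ a' (fun ω => x (Sum.inl ω)) - (I.cost i θ a' : ℝ))) := by linarith
    exact sub_nonneg.1 (nonneg_of_mul_nonneg_right h3 hDpos)
  · refine (hle _).trans ?_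
    have h1 : Fintype.card (I.Outcome ⊕ I.Action) ≤ 2 * I.size := by
      rw [Fintype.card_sum, Fintype.card_fin, Fintype.card_fin]
      have := I.numActions_le i θ
      have := I.numOutcomes_le i θ a
      omega
    have h2 : Fintype.card I.Action ≤ I.size := by
      rw [Fintype.card_fin]
      exact I.numActions_le i θ
    exact_mod_cast factorial_mul_pow_le h1 h2 (I.commonDen_le i θ)

/-! ### Functions computable in polynomial time -/

/-- Types whose elements are represented by data. Pairs are represented by pairs and lists as in
`Data.ofList`, so that the fields of a record given as a list are those of a tuple ending
with `0`. -/
class Enc (α : Type) where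
  enc : α → Data

open BayesianPMA.Enc (enc)

instance : Enc ℤ := ⟨Data.int⟩

instance {α β : Type} [Enc α] [Enc β] : Enc (α × β) := ⟨fun p => .pair (enc p.1) (enc p.2)⟩

instance {α : Type} [Enc α] : Enc (List α) := ⟨fun l => Data.ofList (l.map enc)⟩

/-- The length of the binary expansion of an integer. -/
def bits (z : ℤ) : ℕ := Nat.size z.natAbs

theorem bits_le_iff {z : ℤ} {n : ℕ} : bits z ≤ n ↔ z.natAbs < 2 ^ n := Nat.size_le

theorem natAbs_lt_two_pow_bits (z : ℤ) : z.natAbs < 2 ^ bits z := Nat.lt_size_self _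

theorem bits_mul_le (x y : ℤ) : bits (x * y) ≤ bits x + bits y := by
  rw [bits_le_iff, Int.natAbs_mul, pow_add]
  exact Nat.mul_lt_mul'' (natAbs_lt_two_pow_bits x) (natAbs_lt_two_pow_bits y)

theorem bits_add_le (x y : ℤ) : bits (x + y) ≤ max (bits x) (bits y) + 1 := by
  rw [bits_le_iff, pow_succ]
  have h1 := (natAbs_lt_two_pow_bits x).trans_le
    (Nat.pow_le_pow_right two_pos (le_max_left (bits x) (bits y)))
  have h2 := (natAbs_lt_two_pow_bits y).trans_le
    (Nat.pow_le_pow_right two_pos (le_max_right (bits x) (bits y)))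
  have h3 := Int.natAbs_add_le x y
  omega

theorem bits_neg (x : ℤ) : bits (-x) = bits x := by simp [bits]

theorem bits_sub_le (x y : ℤ) : bits (x - y) ≤ max (bits x) (bits y) + 1 := by
  rw [sub_eq_add_neg, ← bits_neg y]
  exact bits_add_le x (-y)

/-- The bit size of the representation. -/
def sz {α : Type} [Enc α] (a : α) : ℕ := (enc a).size

section Size

variable {α β : Type} [Enc α] [Enc β]

theorem sz_int (z : ℤ) : sz z = 1 + bits z := rfl

theorem sz_prod (p : α × β) : sz p = 1 + sz p.1 + sz p.2 := rfl

theorem sz_nil : sz ([] : List α) = 1 := rfl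

theorem sz_cons (x : α) (l : List α) : sz (x :: l) = 1 + sz x + sz l := rfl

theorem sz_pos (a : α) : 0 < sz a := Data.size_pos _

theorem sz_append (l l' : List α) : sz (l ++ l') + 1 = sz l + sz l' := by
  induction l with
  | nil => simp only [List.nil_append, sz_nil]; omega
  | cons x l ih => simp only [List.cons_append, sz_cons]; omega

theorem sz_le_of_mem {x : α} {l : List α} (h : x ∈ l) : sz x ≤ sz l := by
  induction l with
  | nil => simp at h
  | cons y l ih =>
    rw [sz_cons]
    rcases List.mem_cons.1 h with rfl | h
    · omega
    · have := ih h
      omega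

theorem length_le_sz (l : List α) : l.length ≤ sz l := by
  induction l with
  | nil => simp
  | cons y l ih =>
    rw [sz_cons, List.length_cons]
    omega

theorem sz_le_of_suffix {l l' : List α} (h : l <:+ l') : sz l ≤ sz l' := by
  obtain ⟨l'', rfl⟩ := h
  have := sz_append l'' l
  have := sz_pos l''
  omega

end Size

theorem Polynomial.eval_mono (P : Polynomial ℕ) {m n : ℕ} (h : m ≤ n) : P.eval m ≤ P.eval n := by
  rw [Polynomial.eval_eq_sum_range, Polynomial.eval_eq_sum_range]
  exact Finset.sum_le_sum fun i _ => Nat.mul_le_mul_left _ (Nat.pow_le_pow_left h i)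

/-- All the data that a program produces is charged to its running time. -/
theorem Runs.size_le {f : Prog} {d x : Data} {t : ℕ} (h : Runs f d x t) : x.size ≤ t := by
  induction h with
  | instr o d =>
    have hp := d.size_pos
    rcases o with _ | z | _ | _ | _ | _ | _ | _
    case copy => simp [Instr.eval, Instr.cost]
    case const => simp [Instr.eval, Instr.cost]
    case isInt =>
      rcases d with z | ⟨x, y⟩ <;> simp [Instr.eval, Instr.cost, Data.size, Nat.size]
    case fst =>
      rcases d with z | ⟨x, y⟩ <;> simp only [Instr.eval, Instr.cost, Data.size, Int.natAbs_zero,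
        Nat.size_zero] <;> omega
    case snd =>
      rcases d with z | ⟨x, y⟩ <;> simp only [Instr.eval, Instr.cost, Data.size, Int.natAbs_zero,
        Nat.size_zero] <;> omega
    case add =>
      rcases d with z | ⟨x | ⟨x, x'⟩, y | ⟨y, y'⟩⟩
      case pair.int.int =>
        have := bits_add_le x y
        simp only [bits] at this
        simp only [Instr.eval, Instr.cost, Data.size]
        omega
      all_goals simp [Instr.eval, Instr.cost, Data.size]
    case sub =>
      rcases d with z | ⟨x | ⟨x, x'⟩, y | ⟨y, y'⟩⟩
      case pair.int.int =>
        have := bits_sub_le x y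
        simp only [bits] at this
        simp only [Instr.eval, Instr.cost, Data.size]
        omega
      all_goals simp [Instr.eval, Instr.cost, Data.size]
    case mul =>
      rcases d with z | ⟨x | ⟨x, x'⟩, y | ⟨y, y'⟩⟩
      case pair.int.int =>
        have := bits_mul_le x y
        simp only [bits] at this
        simp only [Instr.eval, Instr.cost, Data.size]
        nlinarith
      all_goals simp [Instr.eval, Instr.cost, Data.size]
  | pair _ _ h1 h2 =>
    rename_i d _ _ _ _ _ _
    have := d.size_pos
    simp only [Data.size]
    omega
  | comp _ _ h1 h2 => omega
  | ite_true _ _ _ h1 h2 => omega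
  | ite_false _ _ _ h1 h2 => omega
  | loop_stop _ _ h1 => omega
  | loop_step _ _ _ _ h1 h2 h3 => omega

/-- `f`, started on `d`, halts with output `x` after time at most `T`. -/
def RunsIn (f : Prog) (d x : Data) (T : ℕ) : Prop := ∃ t, Runs f d x t ∧ t ≤ T

namespace RunsIn

variable {f g : Prog} {d x y : Data} {S T : ℕ}

theorem mono (h : RunsIn f d x S) (hST : S ≤ T) : RunsIn f d x T :=
  let ⟨t, h1, h2⟩ := h
  ⟨t, h1, h2.trans hST⟩

theorem instr (o : Instr) (d : Data) : RunsIn (.instr o) d (o.eval d) (o.cost d) :=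
  ⟨_, .instr o d, le_rfl⟩

theorem fst (x y : Data) : RunsIn (.instr .fst) (.pair x y) x ((Data.pair x y).size + 1) :=
  instr .fst (.pair x y)

theorem snd (x y : Data) : RunsIn (.instr .snd) (.pair x y) y ((Data.pair x y).size + 1) :=
  instr .snd (.pair x y)

theorem pair (hf : RunsIn f d x S) (hg : RunsIn g d y T) :
    RunsIn (.pair f g) d (.pair x y) (S + T + d.size) :=
  let ⟨_, h1, h2⟩ := hf
  let ⟨_, h3, h4⟩ := hg
  ⟨_, .pair h1 h3, by omega⟩

theorem comp (hg : RunsIn g x y T) (hf : RunsIn f d x S) :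
    RunsIn (.comp g f) d y (S + T + 1) :=
  let ⟨_, h1, h2⟩ := hf
  let ⟨_, h3, h4⟩ := hg
  ⟨_, .comp h1 h3, by omega⟩

theorem ite_true {c : Prog} {b : Data} (hc : RunsIn c d b S) (hb : b.IsTrue)
    (hf : RunsIn f d x T) : RunsIn (.ite c f g) d x (S + T + d.size) :=
  let ⟨_, h1, h2⟩ := hc
  let ⟨_, h3, h4⟩ := hf
  ⟨_, .ite_true h1 hb h3, by omega⟩

theorem ite_false {c : Prog} {b : Data} (hc : RunsIn c d b S) (hb : ¬ b.IsTrue)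
    (hg : RunsIn g d x T) : RunsIn (.ite c f g) d x (S + T + d.size) :=
  let ⟨_, h1, h2⟩ := hc
  let ⟨_, h3, h4⟩ := hg
  ⟨_, .ite_false h1 hb h3, by omega⟩

/-- `n` rounds of a loop, the data after `k` rounds being `d k`. -/
theorem loop {c f : Prog} {T : ℕ} (n : ℕ) (d : ℕ → Data)
    (hc : ∀ k < n, ∃ b, RunsIn c (d k) b T ∧ b.IsTrue)
    (hcn : ∃ b, RunsIn c (d n) b T ∧ ¬ b.IsTrue)
    (hf : ∀ k < n, RunsIn f (d k) (d (k + 1)) T) (hd : ∀ k ≤ n, (d k).size ≤ T) :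
    RunsIn (.loop c f) (d 0) (d n) ((n + 1) * (3 * T)) := by
  induction n generalizing d with
  | zero =>
    obtain ⟨b, ⟨t, ht, htT⟩, hb⟩ := hcn
    exact ⟨_, Runs.loop_stop ht hb, by have := hd 0 le_rfl; omega⟩
  | succ n ih =>
    obtain ⟨b, ⟨t, ht, htT⟩, hb⟩ := hc 0 (Nat.succ_pos n)
    obtain ⟨t', ht', htT'⟩ := hf 0 (Nat.succ_pos n)
    obtain ⟨t'', ht'', htT''⟩ := ih (fun k => d (k + 1)) (fun k hk => hc (k + 1) (by omega)) hcn
      (fun k hk => hf (k + 1) (by omega)) fun k hk => hd (k + 1) (by omega)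
    refine ⟨_, Runs.loop_step ht hb ht' ht'', ?_⟩
    have := hd 0 (Nat.zero_le _)
    rw [add_mul (n + 1)]
    omega

end RunsIn

/-- `g` is computed by a program whose running time is at most polynomial in the size of the
argument. -/
def PolyTime {α β : Type} [Enc α] [Enc β] (g : α → β) : Prop :=
  ∃ (f : Prog) (P : Polynomial ℕ), ∀ a, RunsIn f (enc a) (enc (g a)) (P.eval (sz a))

namespace PolyTime

section Basic

variable {α β γ σ : Type} [Enc α] [Enc β] [Enc γ] [Enc σ]

theorem of_le {g : α → β} (h : PolyTime g) :
    ∃ P : Polynomial ℕ, ∀ a, sz (g a) ≤ P.eval (sz a) := by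
  obtain ⟨f, P, h⟩ := h
  refine ⟨P, fun a => ?_⟩
  obtain ⟨t, h1, h2⟩ := h a
  exact h1.size_le.trans h2

theorem of_instr {g : α → β} (o : Instr) (h : ∀ a, o.eval (enc a) = enc (g a)) : PolyTime g := by
  refine ⟨.instr o, Polynomial.X ^ 2 + Polynomial.X + 1 + Polynomial.C (o.cost (.int 0)),
    fun a => ?_⟩
  rw [← h]
  refine (RunsIn.instr _ _).mono ?_
  simp only [Polynomial.eval_add, Polynomial.eval_pow, Polynomial.eval_X, Polynomial.eval_one,
    Polynomial.eval_C, sz]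
  cases o <;> simp only [Instr.cost] <;> omega

theorem id : PolyTime fun a : α => a := of_instr .copy fun _ => rfl

theorem fst : PolyTime fun p : α × β => p.1 := of_instr .fst fun _ => rfl

theorem snd : PolyTime fun p : α × β => p.2 := of_instr .snd fun _ => rfl

theorem comp {g : β → γ} {f : α → β} (hg : PolyTime g) (hf : PolyTime f) :
    PolyTime fun a => g (f a) := by
  obtain ⟨F, P, hF⟩ := hf
  obtain ⟨G, Q, hG⟩ := hg
  refine ⟨.comp G F, P + Q.comp P + 1, fun a => ?_⟩
  obtain ⟨t, h1, h2⟩ := hF a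
  have h3 : sz (f a) ≤ P.eval (sz a) := h1.size_le.trans h2
  refine ((hG (f a)).comp (hF a)).mono ?_
  have := Polynomial.eval_mono Q h3
  simp only [Polynomial.eval_add, Polynomial.eval_comp, Polynomial.eval_one]
  omega

theorem pair {f : α → β} {g : α → γ} (hf : PolyTime f) (hg : PolyTime g) :
    PolyTime fun a => (f a, g a) := by
  obtain ⟨F, P, hF⟩ := hf
  obtain ⟨G, Q, hG⟩ := hg
  refine ⟨.pair F G, P + Q + Polynomial.X, fun a => ?_⟩
  refine ((hF a).pair (hG a)).mono ?_
  simp only [Polynomial.eval_add, Polynomial.eval_X]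
  exact le_rfl

theorem fst' {f : α → β × γ} (hf : PolyTime f) : PolyTime fun a => (f a).1 := fst.comp hf

theorem snd' {f : α → β × γ} (hf : PolyTime f) : PolyTime fun a => (f a).2 := snd.comp hf

/-- A program that ignores its input and returns `d`. -/
def constProg : Data → Prog
  | .int z => .instr (.const z)
  | .pair x y => .pair (constProg x) (constProg y)

theorem const (b : β) : PolyTime fun _ : α => b := by
  have h : ∀ e : Data, ∃ P : Polynomial ℕ, ∀ d : Data,
      RunsIn (constProg e) d e (P.eval d.size) := by
    intro e
    induction e with
    | int z =>
      refine ⟨Polynomial.C (Data.int z).size, fun d => ?_⟩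
      rw [Polynomial.eval_C]
      exact RunsIn.instr (.const z) d
    | pair x y hx hy =>
      obtain ⟨P, hP⟩ := hx
      obtain ⟨Q, hQ⟩ := hy
      refine ⟨P + Q + Polynomial.X, fun d => ?_⟩
      refine ((hP d).pair (hQ d)).mono ?_
      simp only [Polynomial.eval_add, Polynomial.eval_X]
      exact le_rfl
  obtain ⟨P, hP⟩ := h (enc b)
  exact ⟨_, P, fun a => hP (enc a)⟩

theorem cons {f : α → β} {g : α → List β} (hf : PolyTime f) (hg : PolyTime g) :
    PolyTime fun a => f a :: g a :=
  let ⟨F, P, h⟩ := hf.pair hg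
  ⟨F, P, h⟩

theorem tail {f : α → List β} (hf : PolyTime f) : PolyTime fun a => (f a).tail :=
  comp (g := fun l : List β => l.tail) (of_instr .snd fun l => by cases l <;> rfl) hf

theorem headI {f : α → List ℤ} (hf : PolyTime f) : PolyTime fun a => (f a).headI :=
  comp (g := fun l : List ℤ => l.headI) (of_instr .fst fun l => by cases l <;> rfl) hf

theorem add {f g : α → ℤ} (hf : PolyTime f) (hg : PolyTime g) : PolyTime fun a => f a + g a :=
  comp (g := fun p : ℤ × ℤ => p.1 + p.2) (of_instr .add fun _ => rfl) (hf.pair hg)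

theorem sub {f g : α → ℤ} (hf : PolyTime f) (hg : PolyTime g) : PolyTime fun a => f a - g a :=
  comp (g := fun p : ℤ × ℤ => p.1 - p.2) (of_instr .sub fun _ => rfl) (hf.pair hg)

theorem mul {f g : α → ℤ} (hf : PolyTime f) (hg : PolyTime g) : PolyTime fun a => f a * g a :=
  comp (g := fun p : ℤ × ℤ => p.1 * p.2) (of_instr .mul fun _ => rfl) (hf.pair hg)

theorem ite_pos {c : α → ℤ} {f g : α → β} (hc : PolyTime c) (hf : PolyTime f) (hg : PolyTime g) :
    PolyTime fun a => if 0 < c a then f a else g a := by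
  obtain ⟨C, R, hC⟩ := hc
  obtain ⟨F, P, hF⟩ := hf
  obtain ⟨G, Q, hG⟩ := hg
  refine ⟨.ite C F G, R + P + Q + Polynomial.X, fun a => ?_⟩
  have hle1 : R.eval (sz a) + P.eval (sz a) + sz a ≤
      (R + P + Q + Polynomial.X).eval (sz a) := by
    simp only [Polynomial.eval_add, Polynomial.eval_X]
    omega
  have hle2 : R.eval (sz a) + Q.eval (sz a) + sz a ≤
      (R + P + Q + Polynomial.X).eval (sz a) := by
    simp only [Polynomial.eval_add, Polynomial.eval_X]
    omega
  beta_reduce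
  by_cases h : 0 < c a
  · rw [if_pos h]
    exact (RunsIn.ite_true (hC a) h (hF a)).mono hle1
  · rw [if_neg h]
    exact (RunsIn.ite_false (hC a) h (hG a)).mono hle2

/-- Iteration over a list is possible in polynomial time if the sizes of the intermediate results
are polynomially bounded. -/
theorem foldl_of_bound {l : α → List β} {init : α → σ} {step : α → σ → β → σ} (hl : PolyTime l)
    (hi : PolyTime init) (hs : PolyTime fun p : α × σ × β => step p.1 p.2.1 p.2.2)
    (hb : ∃ B : Polynomial ℕ, ∀ a k,
      sz (((l a).take k).foldl (step a) (init a)) ≤ B.eval (sz a)) :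
    PolyTime fun a => (l a).foldl (step a) (init a) := by
  obtain ⟨F, P, hF⟩ := id.pair (hl.pair hi)
  obtain ⟨L, hL⟩ := hl.of_le
  obtain ⟨G, Q, hG⟩ := hs
  obtain ⟨B, hB⟩ := hb
  -- The loop works on triples `(a, l, s)` of the input, the rest of the list and the result.
  let lst : Prog := .comp (.instr .fst) (.instr .snd)
  let body : Prog := .pair (.instr .fst) (.pair (.comp (.instr .snd) lst)
    (.comp G (.pair (.instr .fst) (.pair (.comp (.instr .snd) (.instr .snd))
      (.comp (.instr .fst) lst)))))
  let test : Prog := .ite (.comp (.instr .isInt) lst) (.instr (.const 0)) (.instr (.const 1))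
  -- `E` bounds the sizes of these triples, and `T` the times of the test and of one round.
  let E : Polynomial ℕ := Polynomial.X + L + B + 2
  let T : Polynomial ℕ := 30 * E + 40 + Q.comp E
  refine ⟨.comp (.comp (.instr .snd) (.instr .snd)) (.comp (.loop test body) F),
    P + (L + 1) * (3 * T) + 1 + (2 * E + 3) + 1, fun a => ?_⟩
  let st : ℕ → α × List β × σ := fun k =>
    (a, (l a).drop k, ((l a).take k).foldl (step a) (init a))
  have hst : ∀ k, sz (st k) ≤ E.eval (sz a) := by
    intro k
    have h1 := hB a k
    have h2 := hL a
    have h3 := sz_le_of_suffix (List.drop_suffix k (l a))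
    simp only [st, sz_prod, E, Polynomial.eval_add, Polynomial.eval_X, Polynomial.eval_ofNat]
    omega
  have hT : T.eval (sz a) = 30 * E.eval (sz a) + 40 + Q.eval (E.eval (sz a)) := by
    simp only [T, Polynomial.eval_add, Polynomial.eval_mul, Polynomial.eval_ofNat,
      Polynomial.eval_comp]
  have hlst : ∀ x : α × List β × σ, RunsIn lst (enc x) (enc x.2.1) (2 * sz x + 3) := by
    intro x
    refine ((RunsIn.fst (enc x.2.1) (enc x.2.2)).comp (RunsIn.snd (enc x.1) (enc x.2))).mono ?_
    have h1 : (Data.pair (enc x.1) (enc x.2)).size = sz x := rfl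
    have h2 : (Data.pair (enc x.2.1) (enc x.2.2)).size = sz x.2 := rfl
    have h3 := sz_prod x
    rw [h1, h2]
    omega
  have hlen : (l a).length ≤ L.eval (sz a) := (length_le_sz _).trans (hL a)
  have hloop := RunsIn.loop (c := test) (f := body) (T := T.eval (sz a)) (l a).length
    (fun k => enc (st k)) (by
      intro k hk
      refine ⟨.int 1, ?_, one_pos⟩
      have h1 := hlst (st k)
      have h2 : (st k).2.1 = (l a)[k] :: (l a).drop (k + 1) := List.drop_eq_getElem_cons hk
      rw [h2] at h1
      refine (RunsIn.ite_false (b := .int 0) ((RunsIn.instr .isInt _).comp h1)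
        (by simp [Data.IsTrue]) (RunsIn.instr (.const 1) _)).mono ?_
      have h3 := hst k
      have h4 : sz ((l a)[k] :: (l a).drop (k + 1)) ≤ sz (st k) := by
        rw [← h2, sz_prod (st k), sz_prod (st k).2]
        omega
      change 2 * sz (st k) + 3 + (sz ((l a)[k] :: (l a).drop (k + 1)) + 1) + 1 + 2 + sz (st k) ≤ _
      omega)
    (by
      refine ⟨.int 0, ?_, by simp [Data.IsTrue]⟩
      have h1 := hlst (st (l a).length)
      have h2 : (st (l a).length).2.1 = [] := List.drop_length
      rw [h2] at h1
      refine (RunsIn.ite_true (b := .int 1) ((RunsIn.instr .isInt _).comp h1) one_pos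
        (RunsIn.instr (.const 0) _)).mono ?_
      have h3 := hst (l a).length
      change 2 * sz (st (l a).length) + 3 + (1 + 1) + 1 + 1 + sz (st (l a).length) ≤ _
      omega)
    (by
      intro k hk
      have h1 := hlst (st k)
      have h2 : (st k).2.1 = (l a)[k] :: (l a).drop (k + 1) := List.drop_eq_getElem_cons hk
      rw [h2] at h1
      set x := (l a)[k]
      set r := (l a).drop (k + 1)
      set s := (st k).2.2 with hs
      have hstk : st k = (a, x :: r, s) := by rw [← h2]
      have hsz := hst k
      rw [hstk] at h1 hsz ⊢
      have hnext : st (k + 1) = (a, r, step a s x) := by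
        simp only [st, hs, List.take_add_one, List.foldl_append, List.getElem?_eq_getElem hk]
        rfl
      rw [hnext]
      have hsz' : sz (a, x :: r, s) = 1 + sz a + (1 + (1 + sz x + sz r) + sz s) := rfl
      have hG' := (hG (a, s, x)).mono (Polynomial.eval_mono Q (n := E.eval (sz a)) (by
        have : sz (a, s, x) = 1 + sz a + (1 + sz s + sz x) := rfl
        omega))
      have hfst := RunsIn.fst (enc a) (enc (x :: r, s))
      have hsnd := RunsIn.snd (enc a) (enc (x :: r, s))
      have hss := (RunsIn.snd (enc (x :: r)) (enc s)).comp hsnd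
      have hx := (RunsIn.fst (enc x) (enc r)).comp h1
      have hr := (RunsIn.snd (enc x) (enc r)).comp h1
      refine (hfst.pair (hr.pair (hG'.comp (hfst.pair (hss.pair hx))))).mono ?_
      have e1 : (Data.pair (enc a) (enc (x :: r, s))).size = sz (a, x :: r, s) := rfl
      have e2 : (enc (a, x :: r, s)).size = sz (a, x :: r, s) := rfl
      have e3 : (Data.pair (enc (x :: r)) (enc s)).size = 1 + (1 + sz x + sz r) + sz s := rfl
      have e4 : (Data.pair (enc x) (enc r)).size = 1 + sz x + sz r := rfl
      rw [e1, e2, e3, e4]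
      omega)
    (by
      intro k _
      have h1 := hst k
      change sz (st k) ≤ _
      omega)
  have hpost : RunsIn (.comp (.instr .snd) (.instr .snd)) (enc (st (l a).length))
      (enc ((l a).foldl (step a) (init a))) (2 * E.eval (sz a) + 3) := by
    have h1 : st (l a).length = (a, [], (l a).foldl (step a) (init a)) := by
      simp only [st, List.take_length, List.drop_length]
    have h2 := hst (l a).length
    rw [h1] at h2 ⊢
    refine ((RunsIn.snd _ _).comp (RunsIn.snd _ _)).mono ?_
    have e1 : ∀ s : σ, sz (a, ([] : List β), s) = 1 + sz a + (1 + 1 + sz s) := fun _ => rfl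
    rw [e1] at h2
    set s := (l a).foldl (step a) (init a)
    change 1 + sz a + (1 + 1 + sz s) + 1 + (1 + 1 + sz s + 1) + 1 ≤ _
    omega
  refine (hpost.comp (hloop.comp (hF a))).mono ?_
  have hmul : ((l a).length + 1) * (3 * T.eval (sz a)) ≤
      (L.eval (sz a) + 1) * (3 * T.eval (sz a)) := Nat.mul_le_mul_right _ (by omega)
  simp only [Polynomial.eval_add, Polynomial.eval_mul, Polynomial.eval_ofNat, Polynomial.eval_one]
  omega

/-- Iteration over a list is possible in polynomial time if each step increases the size of the
result, or another measure of it, only by a summand that does not depend on it. -/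
theorem foldl_of_measure {l : α → List β} {init : α → σ} {step : α → σ → β → σ}
    (hl : PolyTime l) (hi : PolyTime init)
    (hs : PolyTime fun p : α × σ × β => step p.1 p.2.1 p.2.2) (ν : σ → ℕ)
    (hν : ∀ s, ν s ≤ sz s) (hC : ∃ C : Polynomial ℕ, ∀ s, sz s ≤ C.eval (ν s))
    (hA : ∃ A : Polynomial ℕ, ∀ a s x, ν (step a s x) ≤ ν s + A.eval (sz a + sz x)) :
    PolyTime fun a => (l a).foldl (step a) (init a) := by
  refine foldl_of_bound hl hi hs ?_
  obtain ⟨C, hC⟩ := hC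
  obtain ⟨A, hA⟩ := hA
  obtain ⟨L, hL⟩ := hl.of_le
  obtain ⟨P, hP⟩ := hi.of_le
  have key : ∀ a (l' : List β) (M : ℕ), (∀ x ∈ l', sz x ≤ M) → ∀ s,
      ν (l'.foldl (step a) s) ≤ ν s + l'.length * A.eval (sz a + M) := by
    intro a l' M hM
    induction l' with
    | nil => simp
    | cons x l' ih =>
      intro s
      rw [List.foldl_cons, List.length_cons, add_mul, one_mul]
      have h1 := ih (fun x hx => hM x (List.mem_cons_of_mem _ hx)) (step a s x)
      have h2 := hA a s x
      have h3 := Polynomial.eval_mono A (Nat.add_le_add_left (hM x List.mem_cons_self) (sz a))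
      omega
  refine ⟨C.comp (P + L * A.comp (Polynomial.X + L)), fun a k => (hC _).trans ?_⟩
  rw [Polynomial.eval_comp]
  refine Polynomial.eval_mono C ?_
  have h1 := key a ((l a).take k) (L.eval (sz a))
    (fun x hx => (sz_le_of_mem (List.mem_of_mem_take hx)).trans (hL a)) (init a)
  have h2 : ((l a).take k).length ≤ L.eval (sz a) :=
    (List.length_take_le' k (l a)).trans ((length_le_sz _).trans (hL a))
  have h3 := Nat.mul_le_mul_right (A.eval (sz a + L.eval (sz a))) h2
  have h4 := hν (init a)
  have h5 := hP a
  simp only [Polynomial.eval_add, Polynomial.eval_mul, Polynomial.eval_comp, Polynomial.eval_X]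
  omega

theorem foldl {l : α → List β} {init : α → σ} {step : α → σ → β → σ}
    (hl : PolyTime l) (hi : PolyTime init)
    (hs : PolyTime fun p : α × σ × β => step p.1 p.2.1 p.2.2)
    (hA : ∃ A : Polynomial ℕ, ∀ a s x, sz (step a s x) ≤ sz s + A.eval (sz a + sz x)) :
    PolyTime fun a => (l a).foldl (step a) (init a) :=
  foldl_of_measure hl hi hs sz (fun _ => le_rfl) ⟨Polynomial.X, fun s => by simp⟩ hA

end Basic

end PolyTime

/-! ### Operations on lists and tests -/

/-- The elements of a list together with their positions. -/
def enum {β : Type} (l : List β) : List (ℤ × β) :=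
  (l.foldl (fun s x => (s.1 + 1, (s.1, x) :: s.2)) ((0 : ℤ), ([] : List (ℤ × β)))).2.reverse

/-- The values that an association list assigns to `k`. -/
def lookups {κ β : Type} [DecidableEq κ] (L : List (κ × β)) (k : κ) : List β :=
  L.flatMap fun e => if e.1 = k then [e.2] else []

/-- The entry at position `k`, or `d` if there is none. -/
def nthD {β : Type} (d : β) (l : List β) (k : ℤ) : β :=
  (lookups (enum l) k).foldl (fun _ x => x) d

/-- Types with an equality test in polynomial time. -/
class EqTest (α : Type) [Enc α] [DecidableEq α] : Prop where
  polyTime : PolyTime fun p : α × α => if p.1 = p.2 then (1 : ℤ) else 0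

theorem sz_zero : sz (0 : ℤ) = 1 := by simp [sz_int, bits]

theorem foldl_cons_eq {β : Type} (l s : List β) :
    l.foldl (fun s x => x :: s) s = l.reverse ++ s := by
  induction l generalizing s with
  | nil => rfl
  | cons x l ih => simp [ih]

namespace PolyTime

variable {α β γ κ : Type} [Enc α] [Enc β] [Enc γ] [Enc κ]

theorem of_eq {f g : α → β} (hf : PolyTime f) (h : ∀ a, g a = f a) : PolyTime g := by
  rwa [show g = f from funext h]

theorem reverse {l : α → List β} (hl : PolyTime l) : PolyTime fun a => (l a).reverse := by
  refine of_eq (foldl (step := fun _ s x => x :: s) hl (const ([] : List β))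
    ((snd.comp snd).cons (fst.comp snd)) ⟨Polynomial.X + 1, fun a s x => ?_⟩)
    fun a => by rw [foldl_cons_eq, List.append_nil]
  rw [sz_cons]
  simp only [Polynomial.eval_add, Polynomial.eval_X, Polynomial.eval_one]
  omega

theorem append {l l' : α → List β} (hl : PolyTime l) (hl' : PolyTime l') :
    PolyTime fun a => l a ++ l' a := by
  refine of_eq (foldl (step := fun _ s x => x :: s) hl.reverse hl'
    ((snd.comp snd).cons (fst.comp snd)) ⟨Polynomial.X + 1, fun a s x => ?_⟩)
    fun a => by rw [foldl_cons_eq, List.reverse_reverse]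
  rw [sz_cons]
  simp only [Polynomial.eval_add, Polynomial.eval_X, Polynomial.eval_one]
  omega

theorem map {l : α → List β} {g : α → β → γ} (hl : PolyTime l)
    (hg : PolyTime fun p : α × β => g p.1 p.2) : PolyTime fun a => (l a).map (g a) := by
  obtain ⟨P, hP⟩ := hg.of_le
  refine of_eq (foldl (step := fun a s x => g a x :: s) hl (const ([] : List γ))
    ((hg.comp (fst.pair (snd.comp snd))).cons (fst.comp snd))
      ⟨P.comp (Polynomial.X + 1) + 1, fun a s x => ?_⟩).reverse fun a => ?_
  · rw [sz_cons]
    have h1 := hP (a, x)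
    rw [sz_prod, show 1 + sz (a, x).1 + sz (a, x).2 = sz a + sz x + 1 by
      change 1 + sz a + sz x = _; omega] at h1
    simp only [Polynomial.eval_add, Polynomial.eval_comp, Polynomial.eval_X, Polynomial.eval_one]
    change sz (g a x) ≤ _ at h1
    omega
  · have : ∀ (l : List β) (s : List γ), l.foldl (fun s x => g a x :: s) s =
        (l.map (g a)).reverse ++ s := by
      intro l
      induction l with
      | nil => simp
      | cons x l ih => simp [ih]
    rw [this]
    simp

theorem flatten {l : α → List (List β)} (hl : PolyTime l) : PolyTime fun a => (l a).flatten := by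
  refine of_eq (foldl (step := fun _ s x => s ++ x) hl (const ([] : List β))
    ((fst.comp snd).append (snd.comp snd)) ⟨Polynomial.X, fun a s x => ?_⟩) fun a => ?_
  · have := sz_append s x
    simp only [Polynomial.eval_X]
    omega
  · have : ∀ (l : List (List β)) (s : List β), l.foldl (fun s x => s ++ x) s = s ++ l.flatten := by
      intro l
      induction l with
      | nil => simp
      | cons x l ih => simp [ih]
    rw [this]
    simp

theorem flatMap {l : α → List β} {g : α → β → List γ} (hl : PolyTime l)
    (hg : PolyTime fun p : α × β => g p.1 p.2) : PolyTime fun a => (l a).flatMap (g a) :=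
  (hl.map hg).flatten

theorem ite_isEmpty {l : α → List β} {f g : α → γ} (hl : PolyTime l) (hf : PolyTime f)
    (hg : PolyTime g) : PolyTime fun a => if (l a).isEmpty then f a else g a := by
  have h : PolyTime fun l : List β => if l.isEmpty then (1 : ℤ) else 0 :=
    of_instr .isInt fun l => by cases l <;> rfl
  refine of_eq (ite_pos (h.comp hl) hf hg) fun a => ?_
  split_ifs <;> simp_all

theorem ite_eq [DecidableEq κ] [EqTest κ] {k k' : α → κ} {f g : α → γ} (hk : PolyTime k)
    (hk' : PolyTime k') (hf : PolyTime f) (hg : PolyTime g) :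
    PolyTime fun a => if k a = k' a then f a else g a := by
  refine of_eq (ite_pos (EqTest.polyTime.comp (hk.pair hk')) hf hg) fun a => ?_
  split_ifs <;> simp_all

instance : EqTest ℤ := by
  refine ⟨of_eq (ite_pos (fst.sub snd) (const (0 : ℤ))
    (ite_pos (snd.sub fst) (const (0 : ℤ)) (const (1 : ℤ)))) fun p => ?_⟩
  split_ifs <;> omega

instance [DecidableEq α] [DecidableEq β] [EqTest α] [EqTest β] : EqTest (α × β) := by
  refine ⟨of_eq (ite_eq fst.fst' snd.fst' (ite_eq fst.snd' snd.snd' (const (1 : ℤ))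
    (const (0 : ℤ))) (const (0 : ℤ))) fun p => ?_⟩
  simp only [Prod.ext_iff]
  split_ifs <;> simp_all

instance : EqTest (List ℤ) := by
  -- The second list is consumed along with the first one.
  let step : List ℤ × ℤ → ℤ → List ℤ × ℤ := fun s x =>
    (s.1.tail, if s.1.isEmpty then 0 else if s.1.headI = x then s.2 else 0)
  have hspec : ∀ (l l' : List ℤ) (b : ℤ),
      (if (l.foldl step (l', b)).1.isEmpty then (l.foldl step (l', b)).2 else 0) =
        if l = l' then b else 0 := by
    intro l
    induction l with
    | nil =>
      intro l' b
      cases l' <;> simp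
    | cons x l ih =>
      intro l' b
      rw [List.foldl_cons]
      cases l' with
      | nil =>
        rw [show step ([], b) x = ([], 0) from rfl, ih]
        simp
      | cons y l' =>
        rw [show step (y :: l', b) x = (l', if y = x then b else 0) from rfl, ih]
        simp only [List.cons.injEq]
        split_ifs <;> simp_all
  have hfold : PolyTime fun p : List ℤ × List ℤ => p.1.foldl step (p.2, 1) := by
    refine foldl (step := fun _ => step) fst (snd.pair (const (1 : ℤ))) ?_ ⟨0, fun _ s x => ?_⟩
    · have h1 : PolyTime fun p : (List ℤ × List ℤ) × (List ℤ × ℤ) × ℤ => p.2.1.1 :=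
        (fst.comp snd).fst'
      exact h1.tail.pair (ite_isEmpty h1 (const (0 : ℤ))
        (ite_eq h1.headI (snd.comp snd) (fst.comp snd).snd' (const (0 : ℤ))))
    · obtain ⟨l, b⟩ := s
      have h1 : sz l.tail ≤ sz l := sz_le_of_suffix (List.tail_suffix l)
      have h2 : sz (if l.isEmpty then 0 else if l.headI = x then b else 0) ≤ sz b := by
        have := sz_pos b
        split_ifs
        · rw [sz_zero]; omega
        · exact le_rfl
        · rw [sz_zero]; omega
      rw [sz_prod, sz_prod, Polynomial.eval_zero]
      simp only [step]
      omega
  exact ⟨of_eq (ite_isEmpty hfold.fst' hfold.snd' (const (0 : ℤ))) fun p => (hspec _ _ _).symm⟩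

theorem lookups [DecidableEq κ] [EqTest κ] {L : α → List (κ × β)} {k : α → κ} (hL : PolyTime L)
    (hk : PolyTime k) : PolyTime fun a => lookups (L a) (k a) := by
  have h : PolyTime fun p : α × κ × β => if p.2.1 = k p.1 then [p.2.2] else [] :=
    ite_eq snd.fst' (hk.comp fst) (snd.snd'.cons (const [])) (const [])
  exact hL.flatMap h

theorem enum {l : α → List β} (hl : PolyTime l) : PolyTime fun a => enum (l a) := by
  obtain ⟨L, hL⟩ := hl.of_le
  let step : ℤ × List (ℤ × β) → β → ℤ × List (ℤ × β) := fun s x => (s.1 + 1, (s.1, x) :: s.2)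
  have key : ∀ (M : ℕ) (l : List β) (c : ℤ) (s : List (ℤ × β)), c.natAbs + l.length ≤ M →
      sz (l.foldl step (c, s)) ≤ sz s + sz l + M + 2 + l.length * (M + 3) := by
    intro M l
    have hbits : ∀ c : ℤ, bits c ≤ c.natAbs := fun c => by
      rw [bits_le_iff]
      exact Nat.lt_two_pow_self
    induction l with
    | nil =>
      intro c s h
      have := hbits c
      simp only [List.foldl_nil, List.length_nil, sz_prod, sz_int] at h ⊢
      omega
    | cons x l ih =>
      intro c s h
      rw [List.length_cons] at h ⊢
      have h1 := ih (c + 1) ((c, x) :: s) (by omega)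
      have h2 := hbits c
      have h3 : sz (c, x) = 1 + (1 + bits c) + sz x := rfl
      rw [sz_cons] at h1
      rw [List.foldl_cons, sz_cons, add_mul, one_mul]
      change sz (l.foldl step (c + 1, (c, x) :: s)) ≤ _
      omega
  have hfold : PolyTime fun a => (l a).foldl step (0, []) := by
    refine foldl_of_bound (step := fun _ => step) hl (const ((0 : ℤ), ([] : List (ℤ × β)))) ?_
      ⟨1 + L + L + 2 + L * (L + 3), fun a k => ?_⟩
    · have h1 : PolyTime fun p : α × (ℤ × List (ℤ × β)) × β => p.2.1.1 := (fst.comp snd).fst'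
      exact (h1.add (const 1)).pair ((h1.pair (snd.comp snd)).cons (fst.comp snd).snd')
    · have h1 : ((l a).take k).length ≤ L.eval (sz a) :=
        (List.length_take_le' k (l a)).trans ((length_le_sz _).trans (hL a))
      have h2 := key (L.eval (sz a)) ((l a).take k) 0 [] (by simpa using h1)
      have h3 : sz ((l a).take k) ≤ sz (l a) := by
        have h4 := sz_append ((l a).take k) ((l a).drop k)
        rw [List.take_append_drop] at h4
        have := sz_pos ((l a).drop k)
        omega
      have h4 := hL a
      have h5 := Nat.mul_le_mul_right (L.eval (sz a) + 3) h1
      rw [sz_nil] at h2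
      simp only [Polynomial.eval_add, Polynomial.eval_mul, Polynomial.eval_one,
        Polynomial.eval_ofNat]
      omega
  exact hfold.snd'.reverse

theorem nthD {l : α → List β} {k : α → ℤ} (d : β) (hl : PolyTime l) (hk : PolyTime k) :
    PolyTime fun a => nthD d (l a) (k a) :=
  foldl (step := fun _ _ x => x) (hl.enum.lookups hk) (const d) (snd.comp snd)
    ⟨Polynomial.X, fun a s x => by rw [Polynomial.eval_X]; omega⟩

theorem prod {l : α → List ℤ} (hl : PolyTime l) : PolyTime fun a => (l a).prod := by
  refine of_eq (foldl (step := fun _ s x => s * x) hl (const (1 : ℤ))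
    ((fst.comp snd).mul (snd.comp snd)) ⟨Polynomial.X, fun a s x => ?_⟩)
    fun a => List.prod_eq_foldl
  have := bits_mul_le s x
  simp only [sz_int, Polynomial.eval_X]
  omega

theorem sum {l : α → List ℤ} (hl : PolyTime l) : PolyTime fun a => (l a).sum := by
  refine of_eq (foldl (step := fun _ s x => s + x) hl (const (0 : ℤ))
    ((fst.comp snd).add (snd.comp snd)) ⟨Polynomial.X, fun a s x => ?_⟩)
    fun a => List.sum_eq_foldl
  have := bits_add_le s x
  have := sz_pos a
  simp only [sz_int, Polynomial.eval_X]
  omega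

end PolyTime

/-! ### Fractions and tables -/

/-- The sum of two fractions, given by numerators and denominators. -/
def fracAdd (x y : ℤ × ℤ) : ℤ × ℤ := (x.1 * y.2 + y.1 * x.2, x.2 * y.2)

/-- The product of two fractions. -/
def fracMul (x y : ℤ × ℤ) : ℤ × ℤ := (x.1 * y.1, x.2 * y.2)

/-- The sum of a list of fractions. -/
def fracSum (l : List (ℤ × ℤ)) : ℤ × ℤ := l.foldl fracAdd (0, 1)

/-- Lists of fractions with keys. A key may be listed repeatedly; such a list stands for the
function that adds up the fractions listed for each key. -/
abbrev Table (κ : Type) : Type := List (κ × ℤ × ℤ)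

/-- The sum of the fractions listed for `k`. -/
def sumAt {κ : Type} [DecidableEq κ] (L : Table κ) (k : κ) : ℤ × ℤ := fracSum (lookups L k)

/-- The table with the same sums in which each key is listed only once. -/
def consolidate {κ : Type} [DecidableEq κ] (L : Table κ) : Table κ :=
  L.foldl (fun acc e => if (lookups acc e.1).isEmpty then (e.1, sumAt L e.1) :: acc else acc) []

/-- The key of an entry of maximal value, among entries with values greater than `-2`. -/
def argmax (l : List (ℤ × ℤ × ℤ)) : ℤ :=
  (l.foldl (fun s x => if 0 < x.2.1 * s.2.2 - s.2.1 * x.2.2 then x else s) (0, -2, 1)).1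

namespace PolyTime

variable {α κ : Type} [Enc α] [Enc κ] [DecidableEq κ] [EqTest κ]

theorem fracAdd {x y : α → ℤ × ℤ} (hx : PolyTime x) (hy : PolyTime y) :
    PolyTime fun a => fracAdd (x a) (y a) :=
  ((hx.fst'.mul hy.snd').add (hy.fst'.mul hx.snd')).pair (hx.snd'.mul hy.snd')

theorem fracMul {x y : α → ℤ × ℤ} (hx : PolyTime x) (hy : PolyTime y) :
    PolyTime fun a => fracMul (x a) (y a) :=
  (hx.fst'.mul hy.fst').pair (hx.snd'.mul hy.snd')

theorem fracSum {l : α → List (ℤ × ℤ)} (hl : PolyTime l) : PolyTime fun a => fracSum (l a) := by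
  refine foldl_of_measure (step := fun _ => BayesianPMA.fracAdd) hl (const ((0 : ℤ), (1 : ℤ)))
    ((fst.comp snd).fracAdd (snd.comp snd)) (fun s => max (bits s.1) (bits s.2))
    (fun s => ?_) ⟨2 * Polynomial.X + 3, fun s => ?_⟩ ⟨Polynomial.X, fun a s x => ?_⟩
  · simp only [sz_prod, sz_int]
    omega
  · simp only [sz_prod, sz_int, Polynomial.eval_add, Polynomial.eval_mul, Polynomial.eval_ofNat,
      Polynomial.eval_X]
    omega
  · have h1 := bits_add_le (s.1 * x.2) (x.1 * s.2)
    have h2 := bits_mul_le s.1 x.2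
    have h3 := bits_mul_le x.1 s.2
    have h4 := bits_mul_le s.2 x.2
    simp only [BayesianPMA.fracAdd, sz_prod, sz_int, Polynomial.eval_X]
    omega

theorem sumAt {L : α → Table κ} {k : α → κ} (hL : PolyTime L) (hk : PolyTime k) :
    PolyTime fun a => sumAt (L a) (k a) := (hL.lookups hk).fracSum

theorem consolidate {L : α → Table κ} (hL : PolyTime L) : PolyTime fun a => consolidate (L a) := by
  have hnew : PolyTime fun p : α × κ × ℤ × ℤ => (p.2.1, BayesianPMA.sumAt (L p.1) p.2.1) :=
    snd.fst'.pair ((hL.comp fst).sumAt snd.fst')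
  obtain ⟨P, hP⟩ := hnew.of_le
  refine foldl (step := fun a acc e => if (BayesianPMA.lookups acc e.1).isEmpty then
    (e.1, BayesianPMA.sumAt (L a) e.1) :: acc else acc) hL (const []) ?_
    ⟨P.comp (Polynomial.X + 1) + 1, fun a s x => ?_⟩
  · have hacc : PolyTime fun p : α × Table κ × (κ × ℤ × ℤ) => p.2.1 := snd.fst'
    have hx : PolyTime fun p : α × Table κ × (κ × ℤ × ℤ) => p.2.2 := snd.snd'
    exact ite_isEmpty (hacc.lookups hx.fst') ((hnew.comp (fst.pair hx)).cons hacc) hacc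
  · simp only [Polynomial.eval_add, Polynomial.eval_comp, Polynomial.eval_X, Polynomial.eval_one]
    split_ifs
    · have h1 := hP (a, x)
      rw [show sz (a, x) = sz a + sz x + 1 by
        change 1 + sz a + sz x = _
        omega] at h1
      rw [sz_cons]
      simp only at h1
      omega
    · omega

theorem argmax {l : α → List (ℤ × ℤ × ℤ)} (hl : PolyTime l) : PolyTime fun a => argmax (l a) := by
  refine fst' (foldl (step := fun _ s x => if 0 < x.2.1 * s.2.2 - s.2.1 * x.2.2 then x else s) hl
    (const ((0 : ℤ), (-2 : ℤ), (1 : ℤ))) ?_ ⟨Polynomial.X, fun a s x => ?_⟩)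
  · have hs : PolyTime fun p : α × (ℤ × ℤ × ℤ) × (ℤ × ℤ × ℤ) => p.2.1 := snd.fst'
    have hx : PolyTime fun p : α × (ℤ × ℤ × ℤ) × (ℤ × ℤ × ℤ) => p.2.2 := snd.snd'
    exact ite_pos ((hx.snd'.fst'.mul hs.snd'.snd').sub (hs.snd'.fst'.mul hx.snd'.snd')) hx hs
  · rw [Polynomial.eval_X]
    split_ifs <;> omega

end PolyTime

/-! ### The algorithm -/

/-- The keys `(i, θ, a)` of tables of probabilities `ξ`, ending with the terminator of lists. -/
abbrev KeyXi : Type := ℤ × List ℤ × ℤ × ℤ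

/-- The keys `(i, θ, a, ω)` of tables of payments. -/
abbrev KeyPay : Type := ℤ × List ℤ × ℤ × ℤ × ℤ

/-- The keys `(θ, a)` of tables of probabilities `t`. -/
abbrev KeyT : Type := List ℤ × List ℤ × ℤ

/-- The key `(i, θ, a)` of the payment scheme that the payment with key `(i, θ, a, ω)` belongs
to. -/
def schemeKey (k : KeyPay) : KeyXi := (k.1, k.2.1, k.2.2.1, 0)

/-- The key of the payment for the outcome `ω` in a payment scheme. -/
def payKey (k : KeyXi) (ω : ℤ) : KeyPay := (k.1, k.2.1, k.2.2.1, ω, 0)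

/-- Tables of the probabilities `F`. -/
abbrev FTable : Type := List (List (List (List (ℤ × ℤ))))

/-- Tables of costs. -/
abbrev CostTable : Type := List (List (List (ℤ × ℤ)))

/-- The data that best responses are computed from: the probabilities `F`, the costs, the payments
`y` and the factor that they are multiplied with. -/
abbrev Env : Type := FTable × CostTable × Table KeyPay × ℤ

/-- The expected payment if the probabilities of the outcomes are `row` and the payment scheme is
the one with the key `k`. -/
def payFrac (y : Table KeyPay) (row : List (ℤ × ℤ)) (k : KeyXi) : ℤ × ℤ :=
  fracSum ((enum row).map fun p => fracMul p.2 (sumAt y (payKey k p.1)))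

/-- An action, given with the probabilities of the outcomes, and its utility if the payments are
those of the scheme with the key `k`, multiplied with the factor in `c`. -/
def replyEntry (c : Env) (costs : List (ℤ × ℤ)) (k : KeyXi) (p : ℤ × List (ℤ × ℤ)) :
    ℤ × ℤ × ℤ :=
  (p.1, fracAdd (fracMul (c.2.2.2, 1) (payFrac c.2.2.1 p.2 k))
    (fracMul (-1, 1) (nthD (0, 1) costs p.1)))

/-- A best response of agent `i` of type `θ` to the multiple of the payment scheme with the
key `k`. -/
def bestReply (c : Env) (i θ : ℤ) (k : KeyXi) : ℤ :=
  argmax ((enum (nthD [] (nthD [] c.1 i) θ)).map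
    (replyEntry c (nthD [] (nthD [] c.2.1 i) θ) k))

/-- `bestReply` of the agent and type in the key `(i, θ, a)`. -/
def replyAt (c : Env) (k k' : KeyXi) : ℤ := bestReply c k.1 (nthD 0 k.2.1 k.1) k'

/-- The best responses of all agents. -/
def replies (c : Env) (θ : List ℤ) (k : KeyXi) : List ℤ :=
  (enum θ).map fun p => bestReply c p.1 p.2 k

/-- The share of an entry of `t` in the probabilities of an entry of the lottery. -/
def lotteryTEntry (c : Env) (N : ℤ) (e : KeyT × ℤ × ℤ) (j : KeyPay × ℤ × ℤ) : KeyT × ℤ × ℤ :=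
  ((e.1.1, replies c e.1.1 (schemeKey j.1), 0), fracMul e.2 (1, N))

/-- The share of an entry of `ξ` in the probabilities of an entry of the lottery. -/
def lotteryXiEntry (c : Env) (N : ℤ) (e : KeyXi × ℤ × ℤ) (j : KeyPay × ℤ × ℤ) :
    KeyXi × ℤ × ℤ :=
  ((e.1.1, e.1.2.1, replyAt c e.1 (schemeKey j.1), 0), fracMul e.2 (1, N))

/-- An entry of `y`, moved to a best response if the payment comes with probability `0`. -/
def movedEntry (c : Env) (B N : ℤ) (x : Table KeyXi) (e : KeyPay × ℤ × ℤ) : KeyPay × ℤ × ℤ :=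
  ((e.1.1, e.1.2.1, if 0 < (sumAt x (schemeKey e.1)).1 then e.1.2.2.1 else
    replyAt c (schemeKey e.1) (schemeKey e.1), e.1.2.2.2.1, 0), fracMul e.2 (B, N))

/-- The share of an entry of `ξ` in the payment `j'` of the lottery, if it belongs to the same
payment scheme as `j`. -/
def lotteryPayEntry (c : Env) (N : ℤ) (e : KeyXi × ℤ × ℤ) (j j' : KeyPay × ℤ × ℤ) :
    Table KeyPay :=
  if schemeKey j'.1 = schemeKey j.1 then
    [((e.1.1, e.1.2.1, replyAt c e.1 (schemeKey j.1), j'.1.2.2.2.1, 0),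
      fracMul e.2 (fracMul (c.2.2.2, N) j'.2))]
  else []

/-- The quotient of a payment and the probability that it comes with, if that is positive. -/
def divEntry (x : Table KeyXi) (e : KeyPay × ℤ × ℤ) : Table KeyPay :=
  if 0 < (sumAt x (schemeKey e.1)).1 then
    [(e.1, e.2.1 * (sumAt x (schemeKey e.1)).2, e.2.2 * (sumAt x (schemeKey e.1)).1)] else []

/-- The probabilities `t` after mixing them with the lottery over all entries of the table of
payments, with weights `B / N` and `1 / N`. -/
def mixTTable (c : Env) (B N : ℤ) (t : Table KeyT) : Table KeyT :=
  t.flatMap fun e => (e.1, fracMul e.2 (B, N)) :: c.2.2.1.map (lotteryTEntry c N e)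

/-- The probabilities `ξ` after mixing. Each entry of `ξ` contributes its share of the lottery,
which makes it unnecessary to list the reports. -/
def mixXiTable (c : Env) (B N : ℤ) (x : Table KeyXi) : Table KeyXi :=
  x.flatMap fun e => (e.1, fracMul e.2 (B, N)) :: c.2.2.1.map (lotteryXiEntry c N e)

/-- The payments `y`, moved to a best response where they come with probability `0`. -/
def movedTable (c : Env) (B N : ℤ) (x : Table KeyXi) : Table KeyPay :=
  c.2.2.1.map (movedEntry c B N x)

/-- The payments in the lottery. -/
def lotteryTable (c : Env) (N : ℤ) (x : Table KeyXi) : Table KeyPay :=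
  x.flatMap fun e => c.2.2.1.flatMap fun j => c.2.2.1.flatMap (lotteryPayEntry c N e j)

/-- The quotients of the payments `y` and the probabilities `x`. -/
def divTable (x : Table KeyXi) (y : Table KeyPay) : Table KeyPay := y.flatMap (divEntry x)

/-- Twice a common denominator of all expected payments. -/
def scaleFactor (F : FTable) (y : Table KeyPay) : ℤ :=
  2 * ((F.flatten.flatten.flatten.map fun q => q.2).prod * (y.map fun e => e.2.2).prod)

/-- An upper bound for the payments. -/
def payBound (y : Table KeyPay) : ℤ := (y.map fun e => e.2.1 * e.2.1 + 1).prod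

/-- The number of entries of a table. -/
def tableLength {κ : Type} (L : Table κ) : ℤ := (L.map fun _ => (1 : ℤ)).sum

/-- The weight `B` of the given solution, if each entry of the lottery has weight `1`. It is so
large that the lottery reduces the value by at most `1 / εden`. -/
def mainWeight (n εden K : ℤ) (y : Table KeyPay) : ℤ :=
  εden * (tableLength y + 1) * (1 + n * K * payBound y)

/-- Instances as they are given to the algorithm. -/
abbrev InstanceTable : Type :=
  ℤ × ℤ × ℤ × ℤ × FTable × CostTable × Table (List ℤ) × ℤ

/-- Solutions of the linear program as they are given to the algorithm. -/
abbrev PointTable : Type := Table KeyT × Table KeyXi × Table KeyPay × Table KeyPay × ℤ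

/-- The tables of the menu. -/
def menuTables (c : Env) (B N : ℤ) (t : Table KeyT) (x : Table KeyXi) :
    Table KeyT × Table KeyXi × Table KeyPay × ℤ :=
  (consolidate (mixTTable c B N t), consolidate (mixXiTable c B N x),
    divTable (mixXiTable c B N x) (consolidate (movedTable c B N x ++ lotteryTable c N x)), 0)

/-- The environment for an instance and a solution of its linear program. -/
def mkEnv (I : InstanceTable) (s : PointTable) : Env :=
  (I.2.2.2.2.1, I.2.2.2.2.2.1, s.2.2.1, scaleFactor I.2.2.2.2.1 s.2.2.1)

/-- The algorithm: from an instance, a solution of the linear program and `ε` to a menu. -/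
def algorithm (d : InstanceTable × PointTable × (ℤ × ℤ) × ℤ) :
    Table KeyT × Table KeyXi × Table KeyPay × ℤ :=
  menuTables (mkEnv d.1 d.2.1)
    (mainWeight d.1.1 d.2.2.1.2 (mkEnv d.1 d.2.1).2.2.2 d.2.1.2.2.1)
    (mainWeight d.1.1 d.2.2.1.2 (mkEnv d.1 d.2.1).2.2.2 d.2.1.2.2.1 + tableLength d.2.1.2.2.1)
    d.2.1.1 d.2.1.2.1

namespace PolyTime

variable {α : Type} [Enc α]

theorem schemeKey {k : α → KeyPay} (hk : PolyTime k) : PolyTime fun a => schemeKey (k a) :=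
  hk.fst'.pair (hk.snd'.fst'.pair (hk.snd'.snd'.fst'.pair (const 0)))

theorem payKey {k : α → KeyXi} {ω : α → ℤ} (hk : PolyTime k) (hω : PolyTime ω) :
    PolyTime fun a => payKey (k a) (ω a) :=
  hk.fst'.pair (hk.snd'.fst'.pair (hk.snd'.snd'.fst'.pair (hω.pair (const 0))))

theorem payFrac {y : α → Table KeyPay} {row : α → List (ℤ × ℤ)} {k : α → KeyXi}
    (hy : PolyTime y) (hr : PolyTime row) (hk : PolyTime k) :
    PolyTime fun a => payFrac (y a) (row a) (k a) := by
  have h : PolyTime fun p : α × ℤ × ℤ × ℤ => BayesianPMA.fracMul p.2.2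
      (BayesianPMA.sumAt (y p.1) (BayesianPMA.payKey (k p.1) p.2.1)) :=
    snd.snd'.fracMul ((hy.comp fst).sumAt ((hk.comp fst).payKey snd.fst'))
  exact fracSum (hr.enum.map (g := fun a (p : ℤ × ℤ × ℤ) => BayesianPMA.fracMul p.2
      (BayesianPMA.sumAt (y a) (BayesianPMA.payKey (k a) p.1))) h)

theorem replyEntry {c : α → Env} {costs : α → List (ℤ × ℤ)} {k : α → KeyXi}
    {p : α → ℤ × List (ℤ × ℤ)} (hc : PolyTime c) (hcosts : PolyTime costs) (hk : PolyTime k)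
    (hp : PolyTime p) : PolyTime fun a => replyEntry (c a) (costs a) (k a) (p a) := by
  have h1 : PolyTime fun a => BayesianPMA.fracMul ((c a).2.2.2, 1)
      (BayesianPMA.payFrac (c a).2.2.1 (p a).2 (k a)) :=
    (hc.snd'.snd'.snd'.pair (const 1)).fracMul (hc.snd'.snd'.fst'.payFrac hp.snd' hk)
  have h2 : PolyTime fun a => BayesianPMA.fracMul (-1, 1)
      (BayesianPMA.nthD (0, 1) (costs a) (p a).1) :=
    (const _).fracMul (hcosts.nthD (0, 1) hp.fst')
  exact hp.fst'.pair (h1.fracAdd h2)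

theorem bestReply {c : α → Env} {i θ : α → ℤ} {k : α → KeyXi}
    (hc : PolyTime c) (hi : PolyTime i) (hθ : PolyTime θ) (hk : PolyTime k) :
    PolyTime fun a => bestReply (c a) (i a) (θ a) (k a) := by
  have h1 : PolyTime fun a => BayesianPMA.nthD [] (BayesianPMA.nthD [] (c a).1 (i a)) (θ a) :=
    (hc.fst'.nthD [] hi).nthD [] hθ
  have h2 : PolyTime fun a => BayesianPMA.nthD [] (BayesianPMA.nthD [] (c a).2.1 (i a)) (θ a) :=
    (hc.snd'.fst'.nthD [] hi).nthD [] hθ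
  exact argmax (h1.enum.map (g := fun a p => BayesianPMA.replyEntry (c a)
    (BayesianPMA.nthD [] (BayesianPMA.nthD [] (c a).2.1 (i a)) (θ a)) (k a) p)
      ((hc.comp fst).replyEntry (h2.comp fst) (hk.comp fst) snd))

theorem replyAt {c : α → Env} {k k' : α → KeyXi} (hc : PolyTime c) (hk : PolyTime k)
    (hk' : PolyTime k') : PolyTime fun a => replyAt (c a) (k a) (k' a) :=
  hc.bestReply hk.fst' (hk.snd'.fst'.nthD 0 hk.fst') hk'

theorem replies {c : α → Env} {θ : α → List ℤ} {k : α → KeyXi} (hc : PolyTime c)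
    (hθ : PolyTime θ) (hk : PolyTime k) : PolyTime fun a => replies (c a) (θ a) (k a) :=
  hθ.enum.map (g := fun a (p : ℤ × ℤ) => BayesianPMA.bestReply (c a) p.1 p.2 (k a))
    ((hc.comp fst).bestReply snd.fst' snd.snd' (hk.comp fst))

section Tables

variable {c : α → Env} {B N : α → ℤ} {t : α → Table KeyT} {x : α → Table KeyXi}
  {y : α → Table KeyPay}

theorem lotteryTEntry {e : α → KeyT × ℤ × ℤ} {j : α → KeyPay × ℤ × ℤ} (hc : PolyTime c)
    (hN : PolyTime N) (he : PolyTime e) (hj : PolyTime j) :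
    PolyTime fun a => lotteryTEntry (c a) (N a) (e a) (j a) :=
  (he.fst'.fst'.pair ((hc.replies he.fst'.fst' hj.fst'.schemeKey).pair (const (0 : ℤ)))).pair
    (he.snd'.fracMul ((const 1).pair hN))

theorem lotteryXiEntry {e : α → KeyXi × ℤ × ℤ} {j : α → KeyPay × ℤ × ℤ} (hc : PolyTime c)
    (hN : PolyTime N) (he : PolyTime e) (hj : PolyTime j) :
    PolyTime fun a => lotteryXiEntry (c a) (N a) (e a) (j a) :=
  (he.fst'.fst'.pair (he.fst'.snd'.fst'.pair ((hc.replyAt he.fst' hj.fst'.schemeKey).pair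
    (const (0 : ℤ))))).pair (he.snd'.fracMul ((const 1).pair hN))

theorem movedEntry {e : α → KeyPay × ℤ × ℤ} (hc : PolyTime c) (hB : PolyTime B)
    (hN : PolyTime N) (hx : PolyTime x) (he : PolyTime e) :
    PolyTime fun a => movedEntry (c a) (B a) (N a) (x a) (e a) := by
  have hk := he.fst'.schemeKey
  have hif := ite_pos (hx.sumAt hk).fst' he.fst'.snd'.snd'.fst' (hc.replyAt hk hk)
  exact (he.fst'.fst'.pair (he.fst'.snd'.fst'.pair (hif.pair
    (he.fst'.snd'.snd'.snd'.fst'.pair (const (0 : ℤ)))))).pair (he.snd'.fracMul (hB.pair hN))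

theorem lotteryPayEntry {e : α → KeyXi × ℤ × ℤ} {j j' : α → KeyPay × ℤ × ℤ} (hc : PolyTime c)
    (hN : PolyTime N) (he : PolyTime e) (hj : PolyTime j) (hj' : PolyTime j') :
    PolyTime fun a => lotteryPayEntry (c a) (N a) (e a) (j a) (j' a) := by
  have hk := he.fst'.fst'.pair (he.fst'.snd'.fst'.pair ((hc.replyAt he.fst'
    hj.fst'.schemeKey).pair (hj'.fst'.snd'.snd'.snd'.fst'.pair (const (0 : ℤ)))))
  have hv := he.snd'.fracMul ((hc.snd'.snd'.snd'.pair hN).fracMul hj'.snd')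
  exact ite_eq hj'.fst'.schemeKey hj.fst'.schemeKey ((hk.pair hv).cons (const [])) (const [])

theorem divEntry {e : α → KeyPay × ℤ × ℤ} (hx : PolyTime x) (he : PolyTime e) :
    PolyTime fun a => divEntry (x a) (e a) := by
  have hs := hx.sumAt he.fst'.schemeKey
  have hq := he.fst'.pair ((he.snd'.fst'.mul hs.snd').pair (he.snd'.snd'.mul hs.fst'))
  exact ite_pos hs.fst' (hq.cons (const [])) (const [])

theorem mixTTable (hc : PolyTime c) (hB : PolyTime B) (hN : PolyTime N) (ht : PolyTime t) :
    PolyTime fun a => mixTTable (c a) (B a) (N a) (t a) := by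
  have h1 : PolyTime fun p : α × KeyT × ℤ × ℤ =>
      (p.2.1, BayesianPMA.fracMul p.2.2 (B p.1, N p.1)) :=
    snd.fst'.pair (snd.snd'.fracMul ((hB.comp fst).pair (hN.comp fst)))
  have h2 : PolyTime fun p : α × KeyT × ℤ × ℤ =>
      (c p.1).2.2.1.map (BayesianPMA.lotteryTEntry (c p.1) (N p.1) p.2) :=
    (hc.comp fst).snd'.snd'.fst'.map (g := fun (p : α × KeyT × ℤ × ℤ) j =>
      BayesianPMA.lotteryTEntry (c p.1) (N p.1) p.2 j)
        (lotteryTEntry (hc.comp fst.fst') (hN.comp fst.fst') fst.snd' snd)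
  exact ht.flatMap (g := fun a (e : KeyT × ℤ × ℤ) => (e.1, BayesianPMA.fracMul e.2 (B a, N a)) ::
    (c a).2.2.1.map (BayesianPMA.lotteryTEntry (c a) (N a) e)) (h1.cons h2)

theorem mixXiTable (hc : PolyTime c) (hB : PolyTime B) (hN : PolyTime N) (hx : PolyTime x) :
    PolyTime fun a => mixXiTable (c a) (B a) (N a) (x a) := by
  have h1 : PolyTime fun p : α × KeyXi × ℤ × ℤ =>
      (p.2.1, BayesianPMA.fracMul p.2.2 (B p.1, N p.1)) :=
    snd.fst'.pair (snd.snd'.fracMul ((hB.comp fst).pair (hN.comp fst)))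
  have h2 : PolyTime fun p : α × KeyXi × ℤ × ℤ =>
      (c p.1).2.2.1.map (BayesianPMA.lotteryXiEntry (c p.1) (N p.1) p.2) :=
    (hc.comp fst).snd'.snd'.fst'.map (g := fun (p : α × KeyXi × ℤ × ℤ) j =>
      BayesianPMA.lotteryXiEntry (c p.1) (N p.1) p.2 j)
        (lotteryXiEntry (hc.comp fst.fst') (hN.comp fst.fst') fst.snd' snd)
  exact hx.flatMap (g := fun a (e : KeyXi × ℤ × ℤ) => (e.1, BayesianPMA.fracMul e.2 (B a, N a)) ::
    (c a).2.2.1.map (BayesianPMA.lotteryXiEntry (c a) (N a) e)) (h1.cons h2)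

theorem movedTable (hc : PolyTime c) (hB : PolyTime B) (hN : PolyTime N) (hx : PolyTime x) :
    PolyTime fun a => movedTable (c a) (B a) (N a) (x a) :=
  hc.snd'.snd'.fst'.map (g := fun a e => BayesianPMA.movedEntry (c a) (B a) (N a) (x a) e)
    (movedEntry (hc.comp fst) (hB.comp fst) (hN.comp fst) (hx.comp fst) snd)

theorem lotteryTable (hc : PolyTime c) (hN : PolyTime N) (hx : PolyTime x) :
    PolyTime fun a => lotteryTable (c a) (N a) (x a) := by
  have h1 : PolyTime fun p : (α × KeyXi × ℤ × ℤ) × KeyPay × ℤ × ℤ =>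
      (c p.1.1).2.2.1.flatMap (BayesianPMA.lotteryPayEntry (c p.1.1) (N p.1.1) p.1.2 p.2) :=
    (hc.comp fst.fst').snd'.snd'.fst'.flatMap
      (g := fun (p : (α × KeyXi × ℤ × ℤ) × KeyPay × ℤ × ℤ) j' =>
        BayesianPMA.lotteryPayEntry (c p.1.1) (N p.1.1) p.1.2 p.2 j')
      (lotteryPayEntry (hc.comp fst.fst'.fst') (hN.comp fst.fst'.fst') fst.fst'.snd' fst.snd'
        snd)
  have h2 : PolyTime fun p : α × KeyXi × ℤ × ℤ => (c p.1).2.2.1.flatMap fun j =>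
      (c p.1).2.2.1.flatMap (BayesianPMA.lotteryPayEntry (c p.1) (N p.1) p.2 j) :=
    (hc.comp fst).snd'.snd'.fst'.flatMap (g := fun (p : α × KeyXi × ℤ × ℤ) j =>
      (c p.1).2.2.1.flatMap (BayesianPMA.lotteryPayEntry (c p.1) (N p.1) p.2 j)) h1
  exact hx.flatMap (g := fun a (e : KeyXi × ℤ × ℤ) => (c a).2.2.1.flatMap fun j =>
      (c a).2.2.1.flatMap (BayesianPMA.lotteryPayEntry (c a) (N a) e j)) h2

theorem divTable (hx : PolyTime x) (hy : PolyTime y) :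
    PolyTime fun a => divTable (x a) (y a) :=
  hy.flatMap (g := fun a e => BayesianPMA.divEntry (x a) e) (divEntry (hx.comp fst) snd)

theorem tableLength (hy : PolyTime y) : PolyTime fun a => tableLength (y a) :=
  (hy.map (g := fun _ (_ : KeyPay × ℤ × ℤ) => (1 : ℤ)) (const 1)).sum

theorem scaleFactor {F : α → FTable} (hF : PolyTime F) (hy : PolyTime y) :
    PolyTime fun a => scaleFactor (F a) (y a) :=
  (const 2).mul ((hF.flatten.flatten.flatten.map (g := fun _ (q : ℤ × ℤ) => q.2) snd.snd').prod.mul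
    (hy.map (g := fun _ (e : KeyPay × ℤ × ℤ) => e.2.2) snd.snd'.snd').prod)

theorem mainWeight {n d K : α → ℤ} (hn : PolyTime n) (hd : PolyTime d) (hK : PolyTime K)
    (hy : PolyTime y) : PolyTime fun a => mainWeight (n a) (d a) (K a) (y a) := by
  have hb : PolyTime fun a => payBound (y a) :=
    (hy.map (g := fun _ (e : KeyPay × ℤ × ℤ) => e.2.1 * e.2.1 + 1)
      ((snd.snd'.fst'.mul snd.snd'.fst').add (const 1))).prod
  exact (hd.mul (hy.tableLength.add (const 1))).mul ((const 1).add ((hn.mul hK).mul hb))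

theorem menuTables (hc : PolyTime c) (hB : PolyTime B) (hN : PolyTime N) (ht : PolyTime t)
    (hx : PolyTime x) : PolyTime fun a => menuTables (c a) (B a) (N a) (t a) (x a) :=
  (hc.mixTTable hB hN ht).consolidate.pair ((hc.mixXiTable hB hN hx).consolidate.pair
    (((hc.mixXiTable hB hN hx).divTable
      ((hc.movedTable hB hN hx).append (hc.lotteryTable hN hx)).consolidate).pair (const (0 : ℤ))))

end Tables

theorem algorithm : PolyTime algorithm := by
  have hI : PolyTime fun d : InstanceTable × PointTable × (ℤ × ℤ) × ℤ => d.1 := fst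
  have hs : PolyTime fun d : InstanceTable × PointTable × (ℤ × ℤ) × ℤ => d.2.1 := snd.fst'
  have hε : PolyTime fun d : InstanceTable × PointTable × (ℤ × ℤ) × ℤ => d.2.2.1 := snd.snd'.fst'
  have hF := hI.snd'.snd'.snd'.snd'.fst'
  have hy := hs.snd'.snd'.fst'
  have hK := hF.scaleFactor hy
  have hc : PolyTime fun d : InstanceTable × PointTable × (ℤ × ℤ) × ℤ => mkEnv d.1 d.2.1 :=
    hF.pair (hI.snd'.snd'.snd'.snd'.snd'.fst'.pair (hy.pair hK))
  have hB := hI.fst'.mainWeight hε.snd' hK hy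
  exact hc.menuTables hB (hB.add hy.tableLength) hs.fst' hs.snd'.fst'

end PolyTime

/-! ### The functions that tables stand for -/

/-- The value of a fraction. -/
noncomputable def fracVal (x : ℤ × ℤ) : ℝ := (x.1 : ℝ) / (x.2 : ℝ)

theorem fracVal_mul (x y : ℤ × ℤ) : fracVal (fracMul x y) = fracVal x * fracVal y := by
  simp only [fracVal, fracMul, Int.cast_mul]
  exact mul_div_mul_comm _ _ _ _

theorem fracVal_add {x y : ℤ × ℤ} (hx : 0 < x.2) (hy : 0 < y.2) :
    fracVal (fracAdd x y) = fracVal x + fracVal y := by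
  have hx' : (x.2 : ℝ) ≠ 0 := by exact_mod_cast hx.ne'
  have hy' : (y.2 : ℝ) ≠ 0 := by exact_mod_cast hy.ne'
  simp only [fracVal, fracAdd]
  push_cast
  field_simp

theorem fracVal_pos_iff {x : ℤ × ℤ} (hx : 0 < x.2) : 0 < fracVal x ↔ 0 < x.1 := by
  have hx' : (0 : ℝ) < x.2 := by exact_mod_cast hx
  rw [fracVal, div_pos_iff_of_pos_right hx', Int.cast_pos]

theorem fracVal_lt_iff {x y : ℤ × ℤ} (hx : 0 < x.2) (hy : 0 < y.2) :
    fracVal x < fracVal y ↔ 0 < y.1 * x.2 - x.1 * y.2 := by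
  have hx' : (0 : ℝ) < x.2 := by exact_mod_cast hx
  have hy' : (0 : ℝ) < y.2 := by exact_mod_cast hy
  rw [fracVal, fracVal, div_lt_div_iff₀ hx' hy', sub_pos]
  exact_mod_cast Iff.rfl

theorem fracSum_spec {l : List (ℤ × ℤ)} (hl : ∀ x ∈ l, 0 < x.2) :
    0 < (fracSum l).2 ∧ fracVal (fracSum l) = (l.map fracVal).sum := by
  have key : ∀ (l : List (ℤ × ℤ)) (s : ℤ × ℤ), (∀ x ∈ l, 0 < x.2) → 0 < s.2 →
      0 < (l.foldl fracAdd s).2 ∧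
        fracVal (l.foldl fracAdd s) = fracVal s + (l.map fracVal).sum := by
    intro l
    induction l with
    | nil => intro s _ hs; simpa using hs
    | cons x l ih =>
      intro s hl hs
      have hx := hl x List.mem_cons_self
      obtain ⟨h1, h2⟩ := ih (fracAdd s x) (fun y hy => hl y (List.mem_cons_of_mem _ hy))
        (mul_pos hs hx)
      refine ⟨h1, ?_⟩
      rw [List.foldl_cons, h2, fracVal_add hs hx, List.map_cons, List.sum_cons, add_assoc]
  obtain ⟨h1, h2⟩ := key l (0, 1) hl one_pos
  exact ⟨h1, by rw [fracSum, h2]; simp [fracVal]⟩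

section Weighted

variable {κ : Type}

/-- The sum over the entries of a table of their values, weighted with a function of the keys. -/
noncomputable def weighted (L : Table κ) (h : κ → ℝ) : ℝ :=
  (L.map fun e => fracVal e.2 * h e.1).sum

theorem weighted_cons (e : κ × ℤ × ℤ) (L : Table κ) (h : κ → ℝ) :
    weighted (e :: L) h = fracVal e.2 * h e.1 + weighted L h := by
  simp [weighted]

theorem weighted_append (L L' : Table κ) (h : κ → ℝ) :
    weighted (L ++ L') h = weighted L h + weighted L' h := by
  simp [weighted]

theorem weighted_flatMap {β : Type} (l : List β) (g : β → Table κ) (h : κ → ℝ) :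
    weighted (l.flatMap g) h = (l.map fun b => weighted (g b) h).sum := by
  induction l with
  | nil => simp [weighted]
  | cons b l ih => rw [List.flatMap_cons, weighted_append, ih, List.map_cons, List.sum_cons]

theorem weighted_map {β : Type} (l : List β) (g : β → κ × ℤ × ℤ) (h : κ → ℝ) :
    weighted (l.map g) h = (l.map fun b => fracVal (g b).2 * h (g b).1).sum := by
  rw [weighted, List.map_map]
  rfl

theorem weighted_congr {L : Table κ} {h h' : κ → ℝ} (hh : ∀ e ∈ L, h e.1 = h' e.1) :
    weighted L h = weighted L h' := by
  rw [weighted, weighted]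
  congr 1
  exact List.map_congr_left fun e he => by rw [hh e he]

theorem sumAt_spec [DecidableEq κ] {L : Table κ} (hL : ∀ e ∈ L, 0 < e.2.2) (k : κ) :
    0 < (sumAt L k).2 ∧ fracVal (sumAt L k) = weighted L fun k' => if k' = k then 1 else 0 := by
  have h1 := fracSum_spec (l := lookups L k) (by
    intro x hx
    obtain ⟨e, he, hx⟩ := List.mem_flatMap.1 hx
    split_ifs at hx
    · rw [List.mem_singleton.1 hx]
      exact hL e he
    · simp at hx)
  refine ⟨h1.1, h1.2.trans ?_⟩
  clear h1 hL
  induction L with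
  | nil => simp [lookups, weighted]
  | cons e L ih =>
    rw [weighted_cons, ← ih]
    simp only [lookups, List.flatMap_cons, List.map_append, List.sum_append]
    split_ifs <;> simp

theorem sum_indicator_of_nodup [DecidableEq κ] {β : Type} (L : List (κ × β)) (v : β → ℝ) (c : ℝ)
    (k : κ) (hn : (L.map fun e => e.1).Nodup) (hc : ∀ e ∈ L, e.1 = k → v e.2 = c) :
    (L.map fun e => v e.2 * if e.1 = k then 1 else 0).sum =
      if k ∈ L.map (fun e => e.1) then c else 0 := by
  induction L with
  | nil => simp
  | cons e L ih =>
    rw [List.map_cons, List.nodup_cons] at hn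
    rw [List.map_cons, List.sum_cons, ih hn.2 fun e he => hc e (List.mem_cons_of_mem _ he)]
    by_cases hk : e.1 = k
    · have hk' : k ∉ L.map fun e => e.1 := hk ▸ hn.1
      rw [if_pos hk, if_neg hk', hc e List.mem_cons_self hk, if_pos (by simp [hk])]
      ring
    · have : k ∈ (e :: L).map (fun e => e.1) ↔ k ∈ L.map fun e => e.1 := by
        simp [Ne.symm hk]
      simp only [hk, if_false, mul_zero, zero_add, this]

theorem mem_keys_of_weighted_ne_zero [DecidableEq κ] {L : Table κ} {k : κ}
    (h : (weighted L fun k' => if k' = k then 1 else 0) ≠ 0) : ∃ e ∈ L, e.1 = k := by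
  by_contra! hn
  refine h ?_
  rw [weighted_congr (h' := fun _ => 0) fun e he => if_neg (hn e he)]
  simp [weighted]

theorem lookups_isEmpty_iff [DecidableEq κ] {β : Type} (L : List (κ × β)) (k : κ) :
    (lookups L k).isEmpty ↔ k ∉ L.map fun e => e.1 := by
  rw [List.isEmpty_iff, lookups, List.flatMap_eq_nil_iff]
  simp only [List.mem_map, not_exists, not_and]
  refine forall₂_congr fun e _ => ?_
  split_ifs with h <;> simp [h]

/-- Consolidating a table keeps the keys, and assigns their sums to them. -/
theorem consolidate_spec [DecidableEq κ] (L : Table κ) :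
    ((consolidate L).map fun e => e.1).Nodup ∧
      (∀ e ∈ consolidate L, e.2 = sumAt L e.1 ∧ ∃ e' ∈ L, e'.1 = e.1) ∧
      ∀ e ∈ L, ∃ e' ∈ consolidate L, e'.1 = e.1 := by
  have key : ∀ (l acc : Table κ), (∀ e ∈ l, e ∈ L) → (acc.map fun e => e.1).Nodup →
      (∀ e ∈ acc, e.2 = sumAt L e.1 ∧ ∃ e' ∈ L, e'.1 = e.1) →
      ∀ r, l.foldl (fun acc e => if (lookups acc e.1).isEmpty then
        (e.1, sumAt L e.1) :: acc else acc) acc = r →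
      (r.map fun e => e.1).Nodup ∧ (∀ e ∈ r, e.2 = sumAt L e.1 ∧ ∃ e' ∈ L, e'.1 = e.1) ∧
        (∀ e ∈ acc, e ∈ r) ∧ ∀ e ∈ l, ∃ e' ∈ r, e'.1 = e.1 := by
    intro l
    induction l with
    | nil =>
      rintro acc - h1 h2 r rfl
      exact ⟨h1, h2, fun e he => he, by simp⟩
    | cons x l ih =>
      rintro acc hl h1 h2 r rfl
      have hl' : ∀ e ∈ l, e ∈ L := fun e he => hl e (List.mem_cons_of_mem _ he)
      rw [List.foldl_cons]
      by_cases hx : (lookups acc x.1).isEmpty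
      · rw [if_pos hx]
        rw [lookups_isEmpty_iff] at hx
        obtain ⟨h3, h4, h5, h6⟩ := ih ((x.1, sumAt L x.1) :: acc) hl'
          (by rw [List.map_cons, List.nodup_cons]; exact ⟨hx, h1⟩)
          (by
            intro e he
            rcases List.mem_cons.1 he with rfl | he
            · exact ⟨rfl, x, hl x List.mem_cons_self, rfl⟩
            · exact h2 e he) _ rfl
        refine ⟨h3, h4, fun e he => h5 e (List.mem_cons_of_mem _ he), fun e he => ?_⟩
        rcases List.mem_cons.1 he with rfl | he
        · exact ⟨_, h5 _ List.mem_cons_self, rfl⟩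
        · exact h6 e he
      · rw [if_neg hx]
        rw [lookups_isEmpty_iff, not_not] at hx
        obtain ⟨h3, h4, h5, h6⟩ := ih acc hl' h1 h2 _ rfl
        refine ⟨h3, h4, h5, fun e he => ?_⟩
        rcases List.mem_cons.1 he with rfl | he
        · obtain ⟨e', he', h⟩ := List.mem_map.1 hx
          exact ⟨e', h5 e' he', h⟩
        · exact h6 e he
  obtain ⟨h1, h2, -, h3⟩ := key L [] (fun e he => he) (by simp) (by simp) _ rfl
  exact ⟨h1, h2, h3⟩

/-- Tables without repeated keys are tables in the sense of `IsTable`. -/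
theorem isTable_of_nodup {K : Type} [Enc κ] {encKey : K → Data} {ek : K → κ} {f : K → ℝ}
    {L : Table κ} (henc : ∀ x, enc (ek x) = encKey x)
    (hn : (L.map fun e => e.1).Nodup) (hkeys : ∀ e ∈ L, ∃ x, ek x = e.1)
    (hden : ∀ e ∈ L, 0 < e.2.2) (hval : ∀ e ∈ L, ∀ x, ek x = e.1 → f x = fracVal e.2)
    (hcov : ∀ x, f x ≠ 0 → ∃ e ∈ L, e.1 = ek x) (hek : Function.Injective ek) :
    IsTable encKey f (enc L) := by
  let φ : K × ℤ × ℕ → κ × ℤ × ℤ := fun e => (ek e.1, e.2.1, (e.2.2 : ℤ))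
  obtain ⟨L₀, rfl⟩ : L ∈ Set.range (List.map φ) := by
    rw [Set.range_list_map]
    intro e he
    obtain ⟨x, hx⟩ := hkeys e he
    refine ⟨(x, e.2.1, e.2.2.toNat), ?_⟩
    have := hden e he
    simp only [φ, hx, Int.toNat_of_nonneg this.le]
  refine ⟨L₀, ?_, fun e he => ?_, fun x hx => ?_, ?_⟩
  · rw [List.map_map] at hn
    have : ((fun e : κ × ℤ × ℤ => e.1) ∘ φ) = ek ∘ fun e : K × ℤ × ℕ => e.1 := rfl
    rw [this, ← List.map_map] at hn
    exact hn.of_map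
  · have h1 := hden (φ e) (List.mem_map_of_mem he)
    have h2 := hval (φ e) (List.mem_map_of_mem he) e.1 rfl
    refine ⟨Int.natCast_pos.1 h1, h2.trans ?_⟩
    simp [fracVal, φ]
  · obtain ⟨e, he, hx'⟩ := hcov x hx
    obtain ⟨e₀, he₀, rfl⟩ := List.mem_map.1 he
    exact List.mem_map.2 ⟨e₀, he₀, hek hx'⟩
  · change Data.ofList (List.map _ _) = _
    rw [List.map_map]
    congr 1
    refine List.map_congr_left fun e _ => ?_
    rw [← henc]
    rfl

variable {K : Type} [DecidableEq κ]

/-- `L` is a table of the function `f`, whose arguments are turned into keys by `ek`. Keys may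
be listed repeatedly. -/
structure Represents (ek : K → κ) (L : Table κ) (f : K → ℝ) : Prop where
  keys : ∀ e ∈ L, ∃ x, ek x = e.1
  den : ∀ e ∈ L, 0 < e.2.2
  val : ∀ x, weighted L (fun k => if k = ek x then 1 else 0) = f x

namespace Represents

variable {ek : K → κ} {L L' : Table κ} {f f' : K → ℝ}

theorem append (h : Represents ek L f) (h' : Represents ek L' f') :
    Represents ek (L ++ L') fun x => f x + f' x := by
  refine ⟨fun e he => ?_, fun e he => ?_, fun x => by rw [weighted_append, h.val, h'.val]⟩
  · rcases List.mem_append.1 he with he | he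
    exacts [h.keys e he, h'.keys e he]
  · rcases List.mem_append.1 he with he | he
    exacts [h.den e he, h'.den e he]

theorem sumAt_spec (h : Represents ek L f) (x : K) :
    0 < (sumAt L (ek x)).2 ∧ fracVal (sumAt L (ek x)) = f x := by
  obtain ⟨h1, h2⟩ := BayesianPMA.sumAt_spec h.den (ek x)
  exact ⟨h1, h2.trans (h.val x)⟩

theorem exists_entry (h : Represents ek L f) {x : K} (hx : f x ≠ 0) : ∃ e ∈ L, e.1 = ek x :=
  mem_keys_of_weighted_ne_zero (by rwa [h.val])

/-- Weighted sums over a table are weighted sums of the values of the function. -/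
theorem weighted_eq [Fintype K] (hek : Function.Injective ek) (h : Represents ek L f)
    (w : κ → ℝ) : weighted L w = ∑ x, f x * w (ek x) := by
  have h1 : ∀ e ∈ L, w e.1 = ∑ x, (if e.1 = ek x then 1 else 0) * w (ek x) := by
    intro e he
    obtain ⟨x, hx⟩ := h.keys e he
    rw [Finset.sum_eq_single x]
    · simp [hx]
    · intro x' _ hne
      rw [if_neg, zero_mul]
      rw [← hx]
      exact fun h => hne (hek h).symm
    · simp
  rw [weighted_congr (h' := fun k => ∑ x, (if k = ek x then 1 else 0) * w (ek x)) h1]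
  simp_rw [← h.val]
  clear h h1
  induction L with
  | nil => simp [weighted]
  | cons e L ih =>
    simp only [weighted_cons, ih, add_mul, Finset.sum_add_distrib, Finset.mul_sum, mul_assoc]

end Represents

variable {encKey : K → Data} {ek : K → κ} {f : K → ℝ} [Enc κ]

theorem IsTable.exists_represents {d : Data} (h : IsTable encKey f d)
    (hek : Function.Injective ek) (henc : ∀ x, enc (ek x) = encKey x) :
    ∃ L : Table κ, d = enc L ∧ Represents ek L f := by
  classical
  obtain ⟨L, hn, hv, hc, rfl⟩ := h
  refine ⟨L.map fun e => (ek e.1, e.2.1, (e.2.2 : ℤ)), ?_, ?_, ?_, ?_⟩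
  · change _ = Data.ofList (List.map _ _)
    rw [List.map_map]
    congr 1
    refine List.map_congr_left fun e _ => ?_
    rw [← henc]
    rfl
  · intro e he
    obtain ⟨e', -, rfl⟩ := List.mem_map.1 he
    exact ⟨_, rfl⟩
  · intro e he
    obtain ⟨e', he', rfl⟩ := List.mem_map.1 he
    exact Int.natCast_pos.2 (hv e' he').1
  · intro x
    rw [weighted_map]
    have h1 := sum_indicator_of_nodup L (fun q : ℤ × ℕ => fracVal (q.1, (q.2 : ℤ))) (f x) x hn
      fun e he hx => by
        rw [← hx, (hv e he).2]
        simp [fracVal]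
    have h2 : (if x ∈ L.map (fun e => e.1) then f x else 0) = f x := by
      by_cases hx : f x = 0
      · simp [hx]
      · exact if_pos (hc x hx)
    rw [h2] at h1
    rw [← h1]
    congr 1
    refine List.map_congr_left fun e _ => ?_
    simp only [hek.eq_iff]

theorem Represents.isTable_consolidate {L : Table κ} (h : Represents ek L f)
    (hek : Function.Injective ek) (henc : ∀ x, enc (ek x) = encKey x) :
    IsTable encKey f (enc (consolidate L)) := by
  obtain ⟨h1, h2, h3⟩ := consolidate_spec L
  refine isTable_of_nodup henc h1 ?_ ?_ ?_ ?_ hek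
  · intro e he
    obtain ⟨-, e', he', hk⟩ := h2 e he
    rw [← hk]
    exact h.keys e' he'
  · intro e he
    rw [(h2 e he).1]
    exact (BayesianPMA.sumAt_spec h.den _).1
  · intro e he x hx
    rw [(h2 e he).1, ← hx, (h.sumAt_spec x).2]
  · intro x hx
    obtain ⟨e, he, hk⟩ := h.exists_entry hx
    obtain ⟨e', he', hk'⟩ := h3 e he
    exact ⟨e', he', hk'.trans hk⟩

end Weighted

/-! ### Lists of the values of functions -/

theorem enum_ofFn {β : Type} {n : ℕ} (f : Fin n → β) :
    enum (List.ofFn f) = List.ofFn fun k => (((k : ℕ) : ℤ), f k) := by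
  have key : ∀ (n : ℕ) (f : Fin n → β) (c : ℤ) (s : List (ℤ × β)),
      ((List.ofFn f).foldl (fun s x => (s.1 + 1, (s.1, x) :: s.2)) (c, s)).2.reverse =
        s.reverse ++ List.ofFn fun k : Fin n => (c + ((k : ℕ) : ℤ), f k) := by
    intro n
    induction n with
    | zero => intro f c s; simp
    | succ n ih =>
      intro f c s
      rw [List.ofFn_succ, List.foldl_cons, ih, List.ofFn_succ]
      simp only [List.reverse_cons, List.append_assoc, List.singleton_append, Fin.val_zero,
        Fin.val_succ]
      push_cast
      simp only [add_zero]
      congr 3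
      ext k
      · simp only
        ring
      · rfl
  have := key n f 0 []
  rw [enum, this]
  simp

theorem lookups_ofFn {β : Type} {n : ℕ} (f : Fin n → β) (k : Fin n) :
    lookups (List.ofFn fun k => (((k : ℕ) : ℤ), f k)) ((k : ℕ) : ℤ) = [f k] := by
  have key : ∀ (l : List (Fin n)), l.Nodup →
      lookups (l.map fun k : Fin n => (((k : ℕ) : ℤ), f k)) ((k : ℕ) : ℤ) =
        if k ∈ l then [f k] else [] := by
    intro l
    induction l with
    | nil => simp [lookups]
    | cons x l ih =>
      intro hn
      rw [List.nodup_cons] at hn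
      have h := ih hn.2
      simp only [lookups, List.map_cons, List.flatMap_cons] at h ⊢
      rw [h]
      by_cases hx : x = k
      · subst hx
        simp [hn.1]
      · have h1 : ¬ (((x : ℕ) : ℤ) = ((k : ℕ) : ℤ)) := by
          rw [Nat.cast_inj]
          exact fun h => hx (Fin.ext h)
        have h2 : k ≠ x := Ne.symm hx
        simp [h1, h2]
  have h := key (List.finRange n) (List.nodup_finRange n)
  rwa [if_pos (List.mem_finRange k), ← List.ofFn_eq_map] at h

theorem nthD_ofFn {β : Type} {n : ℕ} (d : β) (f : Fin n → β) (k : Fin n) :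
    nthD d (List.ofFn f) ((k : ℕ) : ℤ) = f k := by
  rw [nthD, enum_ofFn, lookups_ofFn]
  rfl

theorem argmax_spec {l : List (ℤ × ℤ × ℤ)} (hl : l ≠ []) (hden : ∀ e ∈ l, 0 < e.2.2)
    (hval : ∀ e ∈ l, -2 < fracVal e.2) :
    ∃ e ∈ l, argmax l = e.1 ∧ ∀ e' ∈ l, fracVal e'.2 ≤ fracVal e.2 := by
  have key : ∀ (l : List (ℤ × ℤ × ℤ)) (s : ℤ × ℤ × ℤ), (∀ e ∈ l, 0 < e.2.2) → 0 < s.2.2 →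
      ∀ r, l.foldl (fun s x => if 0 < x.2.1 * s.2.2 - s.2.1 * x.2.2 then x else s) s = r →
        (r = s ∨ r ∈ l) ∧ fracVal s.2 ≤ fracVal r.2 ∧ ∀ e ∈ l, fracVal e.2 ≤ fracVal r.2 := by
    intro l
    induction l with
    | nil =>
      rintro s - - r rfl
      simp
    | cons x l ih =>
      rintro s hl hs r rfl
      have hl' : ∀ e ∈ l, 0 < e.2.2 := fun e he => hl e (List.mem_cons_of_mem _ he)
      have hx := hl x List.mem_cons_self
      rw [List.foldl_cons]
      have hiff := fracVal_lt_iff hs hx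
      by_cases h : 0 < x.2.1 * s.2.2 - s.2.1 * x.2.2
      · rw [if_pos h]
        obtain ⟨h1, h2, h3⟩ := ih x hl' hx _ rfl
        refine ⟨Or.inr (List.mem_cons.2 h1), (hiff.2 h).le.trans h2, fun e he => ?_⟩
        rcases List.mem_cons.1 he with rfl | he
        exacts [h2, h3 e he]
      · rw [if_neg h]
        obtain ⟨h1, h2, h3⟩ := ih s hl' hs _ rfl
        refine ⟨h1.imp_right (List.mem_cons_of_mem _), h2, fun e he => ?_⟩
        rcases List.mem_cons.1 he with rfl | he
        · exact (not_lt.1 fun h' => h (hiff.1 h')).trans h2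
        · exact h3 e he
  obtain ⟨h1, h2, h3⟩ := key l (0, -2, 1) hden one_pos _ rfl
  refine ⟨_, h1.resolve_left fun h => ?_, rfl, h3⟩
  obtain ⟨e, he⟩ := List.exists_mem_of_ne_nil l hl
  have h4 := h3 e he
  rw [h] at h4
  have h5 := hval e he
  have h6 : fracVal ((-2 : ℤ), (1 : ℤ)) = -2 := by simp [fracVal]
  simp only at h4
  linarith

/-! ### Instances and solutions as tables -/

/-- A tuple of types or actions as a list of integers. -/
def tupleKey {n k : ℕ} (f : Fin n → Fin k) : List ℤ := List.ofFn fun i => ((f i : ℕ) : ℤ)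

theorem tupleKey_injective {n k : ℕ} :
    Function.Injective (tupleKey : (Fin n → Fin k) → List ℤ) := by
  intro f g h
  have := List.ofFn_injective h
  funext i
  have := congrFun this i
  exact Fin.ext (by exact_mod_cast this)

theorem enc_ofFn {α : Type} [Enc α] {n : ℕ} (f : Fin n → α) :
    enc (List.ofFn f) = encSeq fun i => enc (f i) := by
  change Data.ofList (List.map enc _) = _
  rw [List.map_ofFn]
  rfl

theorem enc_tupleKey {n k : ℕ} (f : Fin n → Fin k) : enc (tupleKey f) = encTuple f :=
  enc_ofFn _

section Keys

variable {n k l m : ℕ}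

/-- The key of `(θ, a)`. -/
def tKey (x : (Fin n → Fin k) × (Fin n → Fin l)) : KeyT := (tupleKey x.1, tupleKey x.2, 0)

/-- The key of `(i, θ, a)`. -/
def xiKey (x : Fin n × (Fin n → Fin k) × Fin l) : KeyXi :=
  (((x.1 : ℕ) : ℤ), tupleKey x.2.1, ((x.2.2 : ℕ) : ℤ), 0)

/-- The key of `(i, θ, a, ω)`. -/
def yKey (x : Fin n × (Fin n → Fin k) × Fin l × Fin m) : KeyPay :=
  (((x.1 : ℕ) : ℤ), tupleKey x.2.1, ((x.2.2.1 : ℕ) : ℤ), ((x.2.2.2 : ℕ) : ℤ), 0)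

theorem tKey_injective : Function.Injective (tKey (n := n) (k := k) (l := l)) := by
  rintro ⟨x, y⟩ ⟨x', y'⟩ h
  simp only [tKey, Prod.mk.injEq, tupleKey_injective.eq_iff] at h
  simp [h]

theorem xiKey_injective : Function.Injective (xiKey (n := n) (k := k) (l := l)) := by
  rintro ⟨x, y, z⟩ ⟨x', y', z'⟩ h
  simp only [xiKey, Prod.mk.injEq, tupleKey_injective.eq_iff, Nat.cast_inj, Fin.val_inj] at h
  simp [h]

theorem yKey_injective : Function.Injective (yKey (n := n) (k := k) (l := l) (m := m)) := by
  rintro ⟨x, y, z, w⟩ ⟨x', y', z', w'⟩ h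
  simp only [yKey, Prod.mk.injEq, tupleKey_injective.eq_iff, Nat.cast_inj, Fin.val_inj] at h
  simp [h]

theorem enc_tKey (x : (Fin n → Fin k) × (Fin n → Fin l)) :
    enc (tKey x) = Data.ofList [encTuple x.1, encTuple x.2] := by
  rw [← enc_tupleKey, ← enc_tupleKey]
  rfl

theorem enc_xiKey (x : Fin n × (Fin n → Fin k) × Fin l) :
    enc (xiKey x) = Data.ofList [encNat x.1, encTuple x.2.1, encNat x.2.2] := by
  rw [← enc_tupleKey]
  rfl

theorem enc_yKey (x : Fin n × (Fin n → Fin k) × Fin l × Fin m) :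
    enc (yKey x) =
      Data.ofList [encNat x.1, encTuple x.2.1, encNat x.2.2.1, encNat x.2.2.2] := by
  rw [← enc_tupleKey]
  rfl

end Keys

/-- A rational number as a fraction. -/
def ratFrac (q : ℚ) : ℤ × ℤ := (q.num, (q.den : ℤ))

theorem fracVal_ratFrac (q : ℚ) : fracVal (ratFrac q) = q := by
  rw [fracVal, ratFrac]
  exact_mod_cast Rat.num_div_den q

theorem ratFrac_den_pos (q : ℚ) : 0 < (ratFrac q).2 := Int.natCast_pos.2 q.den_pos

namespace Instance

/-- The probabilities `F` as nested lists. -/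
def fTable (I : Instance) : FTable :=
  List.ofFn fun i => List.ofFn fun θ => List.ofFn fun a => List.ofFn fun ω => ratFrac (I.F i θ a ω)

/-- The costs as nested lists. -/
def costTable (I : Instance) : CostTable :=
  List.ofFn fun i => List.ofFn fun θ => List.ofFn fun a => ratFrac (I.cost i θ a)

/-- An instance as it is given to the algorithm. -/
def table (I : Instance) : InstanceTable :=
  (I.numAgents, I.numTypes, I.numOutcomes, I.numActions, I.fTable, I.costTable,
    I.support.map fun θ => (tupleKey θ, ratFrac (I.prior θ)), 0)

theorem enc_table (I : Instance) : Enc.enc I.table = I.enc := by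
  have h1 : Enc.enc I.fTable =
      encSeq fun i => encSeq fun θ => encSeq fun a => encSeq fun ω => encRat (I.F i θ a ω) := by
    simp only [fTable, enc_ofFn]
    rfl
  have h2 : Enc.enc I.costTable =
      encSeq fun i => encSeq fun θ => encSeq fun a => encRat (I.cost i θ a) := by
    simp only [costTable, enc_ofFn]
    rfl
  have h3 : Enc.enc (I.support.map fun θ => (tupleKey θ, ratFrac (I.prior θ))) =
      Data.ofList (I.support.map fun θ => .pair (encTuple θ) (encRat (I.prior θ))) := by
    change Data.ofList (List.map Enc.enc _) = _
    rw [List.map_map]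
    congr 1
    refine List.map_congr_left fun θ _ => ?_
    rw [← enc_tupleKey]
    rfl
  rw [Instance.enc, ← h1, ← h2, ← h3]
  rfl

variable {I : Instance}

theorem LPPoint.IsEncoding.exists_tables {s : I.LPPoint} {d : Data} (h : s.IsEncoding d) :
    ∃ (t : Table KeyT) (x : Table KeyXi) (y g : Table KeyPay),
      d = Enc.enc ((t, x, y, g, 0) : PointTable) ∧
      Represents tKey t (fun z : I.TypeProfile × I.ActionProfile => s.t z.1 z.2) ∧
      Represents xiKey x (fun z : I.Agent × I.TypeProfile × I.Action => s.ξ z.1 z.2.1 z.2.2) ∧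
      Represents yKey y (fun z : I.Agent × I.TypeProfile × I.Action × I.Outcome =>
        s.y z.1 z.2.1 z.2.2.1 z.2.2.2) := by
  obtain ⟨dt, dξ, dy, dγ, ht, hξ, hy, hγ, rfl⟩ := h
  obtain ⟨t, rfl, ht'⟩ := IsTable.exists_represents ht tKey_injective enc_tKey
  obtain ⟨x, rfl, hx'⟩ := IsTable.exists_represents hξ xiKey_injective enc_xiKey
  obtain ⟨y, rfl, hy'⟩ := IsTable.exists_represents hy yKey_injective enc_yKey
  obtain ⟨g, rfl, -⟩ := IsTable.exists_represents hγ yKey_injective enc_yKey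
  exact ⟨t, x, y, g, rfl, ht', hx', hy'⟩

/-! ### Correctness of the computation of best responses -/

variable {ξ : I.Agent → I.TypeProfile → I.Action → ℝ}
  {y : I.Agent → I.TypeProfile → I.Action → I.Outcome → ℝ} {L : Table KeyPay}

theorem payFrac_spec (hy : Represents yKey L
      fun z : I.Agent × I.TypeProfile × I.Action × I.Outcome => y z.1 z.2.1 z.2.2.1 z.2.2.2)
    (i : I.Agent) (θ : I.AgentType) (a : I.Action) (x : I.Agent × I.TypeProfile × I.Action) :
    0 < (payFrac L (List.ofFn fun ω => ratFrac (I.F i θ a ω)) (xiKey x)).2 ∧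
      fracVal (payFrac L (List.ofFn fun ω => ratFrac (I.F i θ a ω)) (xiKey x)) =
        I.pay i θ a (y x.1 x.2.1 x.2.2) := by
  have hω := fun ω : I.Outcome => hy.sumAt_spec (x.1, x.2.1, x.2.2, ω)
  rw [payFrac, enum_ofFn, List.map_ofFn]
  have h1 := fracSum_spec (l := List.ofFn ((fun p : ℤ × ℤ × ℤ =>
    fracMul p.2 (sumAt L (payKey (xiKey x) p.1))) ∘
      fun ω : I.Outcome => (((ω : ℕ) : ℤ), ratFrac (I.F i θ a ω)))) (by
    rw [List.forall_mem_ofFn_iff]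
    exact fun ω => mul_pos (ratFrac_den_pos _) (hω ω).1)
  refine ⟨h1.1, h1.2.trans ?_⟩
  rw [List.map_ofFn, List.sum_ofFn, pay]
  refine Finset.sum_congr rfl fun ω _ => ?_
  simp only [Function.comp_apply, fracVal_mul, fracVal_ratFrac]
  congr 1
  exact (hω ω).2

theorem exists_bestReply_eq (hy : Represents yKey L
      fun z : I.Agent × I.TypeProfile × I.Action × I.Outcome => y z.1 z.2.1 z.2.2.1 z.2.2.2)
    (hy0 : ∀ i θ a ω, 0 ≤ y i θ a ω) {K : ℤ} (hK : 0 ≤ K) (i : I.Agent) (θ : I.AgentType)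
    (x : I.Agent × I.TypeProfile × I.Action) :
    ∃ a : I.Action,
      bestReply (I.fTable, I.costTable, L, K) ((i : ℕ) : ℤ) ((θ : ℕ) : ℤ) (xiKey x) =
        ((a : ℕ) : ℤ) ∧ I.IsBest i θ ((K : ℝ) • y x.1 x.2.1 x.2.2) a := by
  have h1 : ∀ a : I.Action, replyEntry (I.fTable, I.costTable, L, K)
      (List.ofFn fun a => ratFrac (I.cost i θ a)) (xiKey x)
        (((a : ℕ) : ℤ), List.ofFn fun ω => ratFrac (I.F i θ a ω)) =
      (((a : ℕ) : ℤ), fracAdd (fracMul (K, 1)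
        (payFrac L (List.ofFn fun ω => ratFrac (I.F i θ a ω)) (xiKey x)))
          (fracMul (-1, 1) (ratFrac (I.cost i θ a)))) := by
    intro a
    simp only [replyEntry, nthD_ofFn]
  set e : I.Action → ℤ × ℤ × ℤ := fun a => (((a : ℕ) : ℤ), fracAdd (fracMul (K, 1)
        (payFrac L (List.ofFn fun ω => ratFrac (I.F i θ a ω)) (xiKey x)))
          (fracMul (-1, 1) (ratFrac (I.cost i θ a)))) with he
  have h2 : bestReply (I.fTable, I.costTable, L, K) ((i : ℕ) : ℤ) ((θ : ℕ) : ℤ) (xiKey x) =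
      argmax (List.ofFn e) := by
    simp only [bestReply, fTable, costTable, nthD_ofFn, enum_ofFn, List.map_ofFn]
    congr 2
    funext a
    exact h1 a
  have hden : ∀ a, 0 < (e a).2.2 := fun a =>
    mul_pos (mul_pos one_pos (payFrac_spec hy i θ a x).1) (mul_pos one_pos (ratFrac_den_pos _))
  have hval : ∀ a, fracVal (e a).2 =
      I.pay i θ a ((K : ℝ) • y x.1 x.2.1 x.2.2) - (I.cost i θ a : ℝ) := by
    intro a
    have hp := payFrac_spec hy i θ a x
    simp only [he]
    rw [fracVal_add (mul_pos one_pos hp.1) (mul_pos one_pos (ratFrac_den_pos _)), fracVal_mul,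
      fracVal_mul, hp.2, fracVal_ratFrac, pay_smul]
    simp [fracVal]
    ring
  obtain ⟨a₀⟩ := I.nonempty_action
  -- Utilities are at least `-1`, hence greater than the initial value `-2` of the search.
  obtain ⟨r, hr, h3, h4⟩ := argmax_spec (l := List.ofFn e)
    (List.ne_nil_of_mem ((List.mem_ofFn' _ _).2 ⟨a₀, rfl⟩))
    (by rw [List.forall_mem_ofFn_iff]; exact hden)
    (by
      rw [List.forall_mem_ofFn_iff]
      intro a
      rw [hval]
      have h5 : 0 ≤ I.pay i θ a ((K : ℝ) • y x.1 x.2.1 x.2.2) := pay_nonneg i θ a fun ω =>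
        mul_nonneg (Int.cast_nonneg hK) (hy0 _ _ _ ω)
      linarith [cost_le_one i θ a])
  obtain ⟨a, rfl⟩ := (List.mem_ofFn' _ _).1 hr
  refine ⟨a, h2.trans h3, fun a' => ?_⟩
  rw [← hval, ← hval]
  exact h4 _ ((List.mem_ofFn' _ _).2 ⟨a', rfl⟩)

end Instance

/-! ### Correctness of the tables of the mixture -/

/-- Weighted sums over a table in which each entry is split into a part that keeps its key and
equal parts for the elements of a list. -/
theorem weighted_mix {κ β : Type} (L : Table κ) (M : List β) (φ : κ → β → κ) (B N : ℤ)
    (h : κ → ℝ) :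
    weighted (L.flatMap fun e => (e.1, fracMul e.2 (B, N)) ::
        M.map fun j => (φ e.1 j, fracMul e.2 (1, N))) h =
      weighted L fun k => (B / N : ℝ) * h k + ∑ j : Fin M.length, (1 / N : ℝ) * h (φ k M[j.1]) := by
  rw [weighted_flatMap, weighted]
  congr 1
  refine List.map_congr_left fun e _ => ?_
  rw [weighted_cons, weighted_map, mul_add, fracVal_mul,
    Fin.sum_univ_fun_getElem M fun j => (1 / N : ℝ) * h (φ e.1 j), ← List.sum_map_mul_left]
  simp only [fracVal_mul, mul_assoc]
  congr 2
  simp [fracVal]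

theorem sum_ite_fst_snd {A B C : Type*} [Fintype A] [Fintype B] [Fintype C] [DecidableEq A]
    [DecidableEq B] (a : A) (b : B) (g : A × B × C → ℝ) :
    ∑ x : A × B × C, (if x.1 = a ∧ x.2.1 = b then g x else 0) = ∑ c, g (a, b, c) := by
  rw [Fintype.sum_prod_type, Finset.sum_eq_single a (fun a' _ ha => ?_) (by simp),
    Fintype.sum_prod_type, Finset.sum_eq_single b (fun b' _ hb => ?_) (by simp)]
  · simp
  · simp [hb]
  · simp [ha]

namespace Instance

variable {I : Instance} {t : I.TypeProfile → I.ActionProfile → ℝ}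
  {ξ : I.Agent → I.TypeProfile → I.Action → ℝ}
  {y : I.Agent → I.TypeProfile → I.Action → I.Outcome → ℝ}
  {T : Table KeyT} {X : Table KeyXi} {c : Env}
  {br : I.Agent → I.AgentType → I.Agent × I.TypeProfile × I.Action → I.Action}
  {sch : Fin c.2.2.1.length → I.Agent × I.TypeProfile × I.Action} {B N : ℤ}

theorem replies_eq (hbr : ∀ (i : I.Agent) (θ : I.AgentType) x,
      bestReply c ((i : ℕ) : ℤ) ((θ : ℕ) : ℤ) (xiKey x) = ((br i θ x : ℕ) : ℤ))
    (θ : I.TypeProfile) (x : I.Agent × I.TypeProfile × I.Action) :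
    replies c (tupleKey θ) (xiKey x) = tupleKey fun i => br i (θ i) x := by
  rw [replies, tupleKey, enum_ofFn, List.map_ofFn, tupleKey]
  congr 1
  funext i
  exact hbr i (θ i) x

theorem replyAt_eq (hbr : ∀ (i : I.Agent) (θ : I.AgentType) x,
      bestReply c ((i : ℕ) : ℤ) ((θ : ℕ) : ℤ) (xiKey x) = ((br i θ x : ℕ) : ℤ))
    (z x : I.Agent × I.TypeProfile × I.Action) :
    replyAt c (xiKey z) (xiKey x) = ((br z.1 (z.2.1 z.1) x : ℕ) : ℤ) := by
  rw [← hbr, replyAt]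
  congr 1
  exact nthD_ofFn _ _ _

/-- `mixTTable` is a table of `mixT`. The lottery has one payment scheme `sch j` for each entry
`j` of the table of payments. -/
theorem represents_mixTTable (hT : Represents tKey T
      fun z : I.TypeProfile × I.ActionProfile => t z.1 z.2)
    (hbr : ∀ (i : I.Agent) (θ : I.AgentType) x,
      bestReply c ((i : ℕ) : ℤ) ((θ : ℕ) : ℤ) (xiKey x) = ((br i θ x : ℕ) : ℤ))
    (hsch : ∀ j, schemeKey (c.2.2.1[j.1]).1 = xiKey (sch j)) (hN : 0 < N) :
    Represents tKey (mixTTable c B N T) fun z : I.TypeProfile × I.ActionProfile =>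
      mixT (B / N : ℝ) (1 / N : ℝ) (fun i θ j => br i θ (sch j)) t z.1 z.2 := by
  have hkey : ∀ (z : I.TypeProfile × I.ActionProfile) (j : Fin c.2.2.1.length),
      ((tKey z).1, replies c (tKey z).1 (schemeKey (c.2.2.1[j.1]).1), 0) =
        tKey (z.1, fun i => br i (z.1 i) (sch j)) := by
    intro z j
    rw [hsch]
    simp only [tKey, replies_eq hbr]
  refine ⟨fun e he => ?_, fun e he => ?_, fun z => ?_⟩
  · obtain ⟨e', he', he⟩ := List.mem_flatMap.1 he
    obtain ⟨w, hw⟩ := hT.keys e' he'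
    rcases List.mem_cons.1 he with rfl | he
    · exact ⟨w, hw⟩
    · obtain ⟨j, hj, rfl⟩ := List.mem_map.1 he
      obtain ⟨j, hj', rfl⟩ := List.mem_iff_getElem.1 hj
      refine ⟨_, ((hkey w ⟨j, hj'⟩).symm.trans ?_)⟩
      rw [hw]
      rfl
  · obtain ⟨e', he', he⟩ := List.mem_flatMap.1 he
    rcases List.mem_cons.1 he with rfl | he
    · exact mul_pos (hT.den e' he') hN
    · obtain ⟨j, hj, rfl⟩ := List.mem_map.1 he
      exact mul_pos (hT.den e' he') hN
  · refine (weighted_mix T c.2.2.1 (fun k j => (k.1, replies c k.1 (schemeKey j.1), 0)) B N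
      _).trans ?_
    rw [hT.weighted_eq tKey_injective]
    simp only [hkey, tKey_injective.eq_iff]
    obtain ⟨θ, b⟩ := z
    rw [Fintype.sum_prod_type, Finset.sum_eq_single θ (fun θ' _ hθ => ?_) (by simp)]
    · simp only [Prod.mk.injEq, true_and, mul_add, Finset.sum_add_distrib, mixT]
      congr 1
      · simp [mul_comm]
      · rw [Finset.mul_sum]
        refine Finset.sum_congr rfl fun a _ => ?_
        rw [← Finset.mul_sum]
        ring
    · simp [hθ]

theorem represents_mixXiTable (hX : Represents xiKey X
      fun z : I.Agent × I.TypeProfile × I.Action => ξ z.1 z.2.1 z.2.2)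
    (hbr : ∀ (i : I.Agent) (θ : I.AgentType) x,
      bestReply c ((i : ℕ) : ℤ) ((θ : ℕ) : ℤ) (xiKey x) = ((br i θ x : ℕ) : ℤ))
    (hsch : ∀ j, schemeKey (c.2.2.1[j.1]).1 = xiKey (sch j)) (hN : 0 < N) :
    Represents xiKey (mixXiTable c B N X) fun z : I.Agent × I.TypeProfile × I.Action =>
      mixXi (B / N : ℝ) (1 / N : ℝ) (fun i θ j => br i θ (sch j)) ξ z.1 z.2.1 z.2.2 := by
  have hkey : ∀ (z : I.Agent × I.TypeProfile × I.Action) (j : Fin c.2.2.1.length),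
      ((xiKey z).1, (xiKey z).2.1, replyAt c (xiKey z) (schemeKey (c.2.2.1[j.1]).1), 0) =
        xiKey (z.1, z.2.1, br z.1 (z.2.1 z.1) (sch j)) := by
    intro z j
    rw [hsch, replyAt_eq hbr]
    rfl
  refine ⟨fun e he => ?_, fun e he => ?_, fun z => ?_⟩
  · obtain ⟨e', he', he⟩ := List.mem_flatMap.1 he
    obtain ⟨w, hw⟩ := hX.keys e' he'
    rcases List.mem_cons.1 he with rfl | he
    · exact ⟨w, hw⟩
    · obtain ⟨j, hj, rfl⟩ := List.mem_map.1 he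
      obtain ⟨j, hj', rfl⟩ := List.mem_iff_getElem.1 hj
      refine ⟨_, ((hkey w ⟨j, hj'⟩).symm.trans ?_)⟩
      rw [hw]
      rfl
  · obtain ⟨e', he', he⟩ := List.mem_flatMap.1 he
    rcases List.mem_cons.1 he with rfl | he
    · exact mul_pos (hX.den e' he') hN
    · obtain ⟨j, hj, rfl⟩ := List.mem_map.1 he
      exact mul_pos (hX.den e' he') hN
  · refine (weighted_mix X c.2.2.1
      (fun k j => (k.1, k.2.1, replyAt c k (schemeKey j.1), 0)) B N _).trans ?_
    rw [hX.weighted_eq xiKey_injective]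
    simp only [hkey, xiKey_injective.eq_iff]
    obtain ⟨i, θ, b⟩ := z
    have hite : ∀ z : I.Agent × I.TypeProfile × I.Action, ξ z.1 z.2.1 z.2.2 *
        ((B / N : ℝ) * (if z = (i, θ, b) then 1 else 0) + ∑ j, (1 / N : ℝ) *
          if (z.1, z.2.1, br z.1 (z.2.1 z.1) (sch j)) = (i, θ, b) then 1 else 0) =
        if z.1 = i ∧ z.2.1 = θ then ξ z.1 z.2.1 z.2.2 *
          ((B / N : ℝ) * (if z.2.2 = b then 1 else 0) + ∑ j, (1 / N : ℝ) *
            if br z.1 (z.2.1 z.1) (sch j) = b then 1 else 0) else 0 := by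
      rintro ⟨i', θ', a⟩
      by_cases h1 : i' = i
      · by_cases h2 : θ' = θ
        · simp [h1, h2]
        · simp [h2]
      · simp [h1]
    rw [Finset.sum_congr rfl fun z _ => hite z, sum_ite_fst_snd]
    simp only [mul_add, Finset.sum_add_distrib, mixXi, ← Finset.mul_sum]
    congr 1
    · simp [mul_comm]
    · rw [Finset.mul_sum]
      exact Finset.sum_congr rfl fun a _ => by ring

variable {σ : I.Agent → I.TypeProfile → I.Action → I.Action}

theorem represents_movedTable (hX : Represents xiKey X
      fun z : I.Agent × I.TypeProfile × I.Action => ξ z.1 z.2.1 z.2.2)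
    (hy : Represents yKey c.2.2.1
      fun z : I.Agent × I.TypeProfile × I.Action × I.Outcome => y z.1 z.2.1 z.2.2.1 z.2.2.2)
    (hbr : ∀ (i : I.Agent) (θ : I.AgentType) x,
      bestReply c ((i : ℕ) : ℤ) ((θ : ℕ) : ℤ) (xiKey x) = ((br i θ x : ℕ) : ℤ))
    (hσ : ∀ i θ a, σ i θ a = if 0 < ξ i θ a then a else br i (θ i) (i, θ, a)) (hN : 0 < N) :
    Represents yKey (movedTable c B N X)
      fun z : I.Agent × I.TypeProfile × I.Action × I.Outcome =>
        (B / N : ℝ) * ∑ a, if σ z.1 z.2.1 a = z.2.2.1 then y z.1 z.2.1 a z.2.2.2 else 0 := by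
  have hkey : ∀ z : I.Agent × I.TypeProfile × I.Action × I.Outcome,
      ((yKey z).1, (yKey z).2.1,
        if 0 < (sumAt X (schemeKey (yKey z))).1 then (yKey z).2.2.1 else
          replyAt c (schemeKey (yKey z)) (schemeKey (yKey z)), (yKey z).2.2.2.1, 0) =
        yKey (z.1, z.2.1, σ z.1 z.2.1 z.2.2.1, z.2.2.2) := by
    rintro ⟨i, θ, a, ω⟩
    have h1 : schemeKey (yKey (i, θ, a, ω)) = xiKey (i, θ, a) := rfl
    obtain ⟨h2, h3⟩ := hX.sumAt_spec (i, θ, a)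
    have h4 : 0 < (sumAt X (xiKey (i, θ, a))).1 ↔ 0 < ξ i θ a := by
      rw [← fracVal_pos_iff h2, h3]
    rw [h1, replyAt_eq hbr]
    simp only [hσ, yKey, h4]
    split_ifs <;> rfl
  refine ⟨fun e he => ?_, fun e he => ?_, fun z => ?_⟩
  · obtain ⟨e', he', rfl⟩ := List.mem_map.1 he
    obtain ⟨w, hw⟩ := hy.keys e' he'
    refine ⟨_, ((hkey w).symm.trans ?_)⟩
    rw [hw]
    rfl
  · obtain ⟨e', he', rfl⟩ := List.mem_map.1 he
    exact mul_pos (hy.den e' he') hN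
  · rw [movedTable, weighted_map]
    have h1 : ∀ e : KeyPay × ℤ × ℤ,
        fracVal (movedEntry c B N X e).2 * (if (movedEntry c B N X e).1 = yKey z then 1 else 0) =
          fracVal e.2 * ((B / N : ℝ) * if (e.1.1, e.1.2.1,
            if 0 < (sumAt X (schemeKey e.1)).1 then e.1.2.2.1 else
              replyAt c (schemeKey e.1) (schemeKey e.1), e.1.2.2.2.1, 0) = yKey z
                then 1 else 0) := by
      intro e
      rw [movedEntry, fracVal_mul, mul_assoc]
      rfl
    simp only [h1]
    refine (hy.weighted_eq yKey_injective fun k => (B / N : ℝ) * if (k.1, k.2.1,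
      if 0 < (sumAt X (schemeKey k)).1 then k.2.2.1 else
        replyAt c (schemeKey k) (schemeKey k), k.2.2.2.1, 0) = yKey z then 1 else 0).trans ?_
    simp only [hkey, yKey_injective.eq_iff]
    obtain ⟨i, θ, b, ω⟩ := z
    have hite : ∀ z : I.Agent × I.TypeProfile × I.Action × I.Outcome,
        y z.1 z.2.1 z.2.2.1 z.2.2.2 * ((B / N : ℝ) *
          if (z.1, z.2.1, σ z.1 z.2.1 z.2.2.1, z.2.2.2) = (i, θ, b, ω) then 1 else 0) =
        if z.1 = i ∧ z.2.1 = θ then (B / N : ℝ) * (if σ z.1 z.2.1 z.2.2.1 = b then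
          if z.2.2.2 = ω then y z.1 z.2.1 z.2.2.1 z.2.2.2 else 0 else 0) else 0 := by
      rintro ⟨i', θ', a, ω'⟩
      simp only [Prod.mk.injEq]
      split_ifs <;> first | ring1 | (exfalso; tauto)
    rw [Finset.sum_congr rfl fun z _ => hite z, sum_ite_fst_snd, ← Finset.mul_sum,
      Fintype.sum_prod_type]
    congr 1
    refine Finset.sum_congr rfl fun a _ => ?_
    by_cases h : σ i θ a = b <;> simp [h]

theorem represents_lotteryTable (hX : Represents xiKey X
      fun z : I.Agent × I.TypeProfile × I.Action => ξ z.1 z.2.1 z.2.2)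
    (hy : Represents yKey c.2.2.1
      fun z : I.Agent × I.TypeProfile × I.Action × I.Outcome => y z.1 z.2.1 z.2.2.1 z.2.2.2)
    (hbr : ∀ (i : I.Agent) (θ : I.AgentType) x,
      bestReply c ((i : ℕ) : ℤ) ((θ : ℕ) : ℤ) (xiKey x) = ((br i θ x : ℕ) : ℤ))
    (hsch : ∀ j, schemeKey (c.2.2.1[j.1]).1 = xiKey (sch j)) (hN : 0 < N) :
    Represents yKey (lotteryTable c N X)
      fun z : I.Agent × I.TypeProfile × I.Action × I.Outcome =>
        (1 / N : ℝ) * ∑ a, ξ z.1 z.2.1 a * ∑ j, if br z.1 (z.2.1 z.1) (sch j) = z.2.2.1 then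
          ((c.2.2.2 : ℝ) • y (sch j).1 (sch j).2.1 (sch j).2.2) z.2.2.2 else 0 := by
  have hkey : ∀ (z : I.Agent × I.TypeProfile × I.Action) (j : Fin c.2.2.1.length)
      (z' : I.Agent × I.TypeProfile × I.Action × I.Outcome),
      ((xiKey z).1, (xiKey z).2.1, replyAt c (xiKey z) (schemeKey (c.2.2.1[j.1]).1),
        (yKey z').2.2.2.1, 0) =
        yKey (z.1, z.2.1, br z.1 (z.2.1 z.1) (sch j), z'.2.2.2) := by
    intro z j z'
    rw [hsch, replyAt_eq hbr]
    rfl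
  have hmem : ∀ e ∈ lotteryTable c N X, ∃ e' ∈ X, ∃ j ∈ c.2.2.1, ∃ j' ∈ c.2.2.1,
      e = ((e'.1.1, e'.1.2.1, replyAt c e'.1 (schemeKey j.1), j'.1.2.2.2.1, 0),
        fracMul e'.2 (fracMul (c.2.2.2, N) j'.2)) := by
    intro e he
    obtain ⟨e', he', he⟩ := List.mem_flatMap.1 he
    obtain ⟨j, hj, he⟩ := List.mem_flatMap.1 he
    obtain ⟨j', hj', he⟩ := List.mem_flatMap.1 he
    rw [lotteryPayEntry] at he
    split_ifs at he
    · exact ⟨e', he', j, hj, j', hj', List.mem_singleton.1 he⟩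
    · simp at he
  refine ⟨fun e he => ?_, fun e he => ?_, fun z => ?_⟩
  · obtain ⟨e', he', j, hj, j', hj', rfl⟩ := hmem e he
    obtain ⟨w, hw⟩ := hX.keys e' he'
    obtain ⟨w', hw'⟩ := hy.keys j' hj'
    obtain ⟨j, hj₀, rfl⟩ := List.mem_iff_getElem.1 hj
    refine ⟨_, ((hkey w ⟨j, hj₀⟩ w').symm.trans ?_)⟩
    rw [hw, hw']
  · obtain ⟨e', he', j, hj, j', hj', rfl⟩ := hmem e he
    exact mul_pos (hX.den e' he') (mul_pos hN (hy.den j' hj'))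
  · have h1 : ∀ (e : KeyXi × ℤ × ℤ) (j j' : KeyPay × ℤ × ℤ) (h : KeyPay → ℝ),
        weighted (lotteryPayEntry c N e j j') h = fracVal j'.2 * (fracVal e.2 *
          (if schemeKey j'.1 = schemeKey j.1 then (c.2.2.2 / N : ℝ) *
            h (e.1.1, e.1.2.1, replyAt c e.1 (schemeKey j.1), j'.1.2.2.2.1, 0) else 0)) := by
      intro e j j' h
      rw [lotteryPayEntry]
      split_ifs
      · simp only [weighted, List.map_cons, List.map_nil, List.sum_cons, List.sum_nil, fracVal_mul]
        simp only [fracVal]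
        ring
      · simp [weighted]
    have h2 : ∀ h : KeyPay → ℝ, weighted (lotteryTable c N X) h = weighted X fun k =>
        ∑ j : Fin c.2.2.1.length, weighted c.2.2.1 fun k' =>
          if schemeKey k' = schemeKey (c.2.2.1[j.1]).1 then (c.2.2.2 / N : ℝ) *
            h (k.1, k.2.1, replyAt c k (schemeKey (c.2.2.1[j.1]).1), k'.2.2.2.1, 0) else 0 := by
      intro h
      rw [lotteryTable, weighted_flatMap, weighted]
      congr 1
      refine List.map_congr_left fun e _ => ?_
      rw [weighted_flatMap, Fin.sum_univ_fun_getElem c.2.2.1 fun j => weighted c.2.2.1 fun k' =>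
        if schemeKey k' = schemeKey j.1 then (c.2.2.2 / N : ℝ) *
          h (e.1.1, e.1.2.1, replyAt c e.1 (schemeKey j.1), k'.2.2.2.1, 0) else 0,
        ← List.sum_map_mul_left]
      congr 1
      refine List.map_congr_left fun j _ => ?_
      rw [weighted_flatMap, weighted, ← List.sum_map_mul_left]
      congr 1
      refine List.map_congr_left fun j' _ => ?_
      rw [h1]
      ring
    rw [h2, hX.weighted_eq xiKey_injective]
    obtain ⟨i, θ, b, ω⟩ := z
    -- The entries of the table of `y` that belong to the payment scheme `sch j`, summed up.
    have h3 : ∀ (z : I.Agent × I.TypeProfile × I.Action) (j : Fin c.2.2.1.length),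
        (weighted c.2.2.1 fun k' => if schemeKey k' = schemeKey (c.2.2.1[j.1]).1 then
          (c.2.2.2 / N : ℝ) * (if ((xiKey z).1, (xiKey z).2.1,
            replyAt c (xiKey z) (schemeKey (c.2.2.1[j.1]).1), k'.2.2.2.1, 0) =
              yKey (i, θ, b, ω) then 1 else 0) else 0) =
        if z.1 = i ∧ z.2.1 = θ then (1 / N : ℝ) * (if br z.1 (z.2.1 z.1) (sch j) = b then
          ((c.2.2.2 : ℝ) • y (sch j).1 (sch j).2.1 (sch j).2.2) ω else 0) else 0 := by
      intro z j
      have hs : ∀ w : I.Agent × I.TypeProfile × I.Action × I.Outcome,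
          schemeKey (yKey w) = xiKey (w.1, w.2.1, w.2.2.1) := fun _ => rfl
      rw [hy.weighted_eq yKey_injective]
      simp only [hkey, yKey_injective.eq_iff]
      simp only [hsch, hs, xiKey_injective.eq_iff]
      obtain ⟨i', θ', a'⟩ := sch j
      have hite : ∀ w : I.Agent × I.TypeProfile × I.Action × I.Outcome,
          (y w.1 w.2.1 w.2.2.1 w.2.2.2 * if (w.1, w.2.1, w.2.2.1) = (i', θ', a') then
            (c.2.2.2 / N : ℝ) * (if (z.1, z.2.1, br z.1 (z.2.1 z.1) (i', θ', a'), w.2.2.2) =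
              (i, θ, b, ω) then 1 else 0) else 0) =
          if w.1 = i' ∧ w.2.1 = θ' then (if w.2.2.1 = a' then if w.2.2.2 = ω then
            (if z.1 = i ∧ z.2.1 = θ then (1 / N : ℝ) *
              (if br z.1 (z.2.1 z.1) (i', θ', a') = b then
                (c.2.2.2 : ℝ) * y w.1 w.2.1 w.2.2.1 w.2.2.2 else 0) else 0) else 0 else 0)
              else 0 := by
        rintro ⟨i₁, θ₁, a₁, ω₁⟩
        simp only [Prod.mk.injEq]
        split_ifs <;> first | ring1 | (exfalso; tauto)
      rw [Finset.sum_congr rfl fun z _ => hite z, sum_ite_fst_snd, Fintype.sum_prod_type]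
      simp
    simp only [h3]
    have h4 : ∀ z : I.Agent × I.TypeProfile × I.Action, ξ z.1 z.2.1 z.2.2 *
        (∑ j, if z.1 = i ∧ z.2.1 = θ then (1 / N : ℝ) * (if br z.1 (z.2.1 z.1) (sch j) = b then
          ((c.2.2.2 : ℝ) • y (sch j).1 (sch j).2.1 (sch j).2.2) ω else 0) else 0) =
        if z.1 = i ∧ z.2.1 = θ then ξ z.1 z.2.1 z.2.2 * ∑ j, (1 / N : ℝ) *
          (if br z.1 (z.2.1 z.1) (sch j) = b then
            ((c.2.2.2 : ℝ) • y (sch j).1 (sch j).2.1 (sch j).2.2) ω else 0) else 0 := by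
      intro z
      split_ifs <;> simp
    rw [Finset.sum_congr rfl fun z _ => h4 z, sum_ite_fst_snd]
    rw [Finset.mul_sum]
    refine Finset.sum_congr rfl fun a _ => ?_
    rw [← Finset.mul_sum]
    ring

/-- Entries whose probability is `0` are dropped by `divTable`; since `x / 0 = 0`, the quotients
are correct there as well. -/
theorem isPayTable_divTable {Y : Table KeyPay} (hX : Represents xiKey X
      fun z : I.Agent × I.TypeProfile × I.Action => ξ z.1 z.2.1 z.2.2)
    (hY : Represents yKey Y
      fun z : I.Agent × I.TypeProfile × I.Action × I.Outcome => y z.1 z.2.1 z.2.2.1 z.2.2.2)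
    (hξ : ∀ i θ a, 0 ≤ ξ i θ a) :
    I.IsPayTable (fun i θ a ω => y i θ a ω / ξ i θ a) (Enc.enc (divTable X (consolidate Y))) := by
  obtain ⟨h1, h2, h3⟩ := consolidate_spec Y
  have hs : ∀ w : I.Agent × I.TypeProfile × I.Action × I.Outcome,
      schemeKey (yKey w) = xiKey (w.1, w.2.1, w.2.2.1) := fun _ => rfl
  have hmem : ∀ e ∈ divTable X (consolidate Y), ∃ e' ∈ consolidate Y,
      0 < (sumAt X (schemeKey e'.1)).1 ∧ e = (e'.1, e'.2.1 * (sumAt X (schemeKey e'.1)).2,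
        e'.2.2 * (sumAt X (schemeKey e'.1)).1) := by
    intro e he
    obtain ⟨e', he', he⟩ := List.mem_flatMap.1 he
    rw [divEntry] at he
    split_ifs at he with h
    · exact ⟨e', he', h, List.mem_singleton.1 he⟩
    · simp at he
  refine isTable_of_nodup (ek := yKey) enc_yKey ?_ ?_ ?_ ?_ ?_ yKey_injective
  · refine h1.sublist ?_
    generalize consolidate Y = M
    induction M with
    | nil => exact List.Sublist.refl _
    | cons e M ih =>
      rw [divTable, List.flatMap_cons, divEntry, List.map_append, List.map_cons]
      split_ifs
      · exact ih.cons_cons _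
      · exact ih.cons _
  · intro e he
    obtain ⟨e', he', -, rfl⟩ := hmem e he
    obtain ⟨-, e'', he'', hk⟩ := h2 e' he'
    obtain ⟨w, hw⟩ := hY.keys e'' he''
    exact ⟨w, hw.trans hk⟩
  · intro e he
    obtain ⟨e', he', hpos, rfl⟩ := hmem e he
    refine mul_pos ?_ hpos
    rw [(h2 e' he').1]
    exact (sumAt_spec hY.den _).1
  · intro e he w hw
    obtain ⟨e', he', hpos, rfl⟩ := hmem e he
    change yKey w = e'.1 at hw
    obtain ⟨h5, h6⟩ := hX.sumAt_spec (w.1, w.2.1, w.2.2.1)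
    obtain ⟨h7, h8⟩ := hY.sumAt_spec w
    rw [hw, ← (h2 e' he').1] at h8
    simp only at h6 h8 ⊢
    rw [← h6, ← h8, ← hw, hs]
    simp only [fracVal]
    push_cast
    rw [div_div_div_eq]
  · intro w hw
    have hy0 : y w.1 w.2.1 w.2.2.1 w.2.2.2 ≠ 0 := fun h => hw (by simp [h])
    have hξ0 : ξ w.1 w.2.1 w.2.2.1 ≠ 0 := fun h => hw (by simp [h])
    obtain ⟨e, he, hk⟩ := hY.exists_entry hy0
    obtain ⟨e', he', hk'⟩ := h3 e he
    have hk'' := hk'.trans hk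
    obtain ⟨h5, h6⟩ := hX.sumAt_spec (w.1, w.2.1, w.2.2.1)
    have hpos : 0 < (sumAt X (schemeKey e'.1)).1 := by
      rw [hk'', hs, ← fracVal_pos_iff h5, h6]
      exact lt_of_le_of_ne (hξ _ _ _) hξ0.symm
    refine ⟨(e'.1, e'.2.1 * (sumAt X (schemeKey e'.1)).2,
      e'.2.2 * (sumAt X (schemeKey e'.1)).1), List.mem_flatMap.2 ⟨e', he', ?_⟩, hk''⟩
    rw [divEntry, if_pos hpos]
    exact List.mem_singleton.2 rfl

end Instance

/-! ### The scaling factor and the weight of the lottery -/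

/-- The integers, as a subring of the real numbers. -/
abbrev intRange : Subring ℝ := (Int.castRingHom ℝ).range

theorem mul_fracVal_mem_intRange {x : ℤ × ℤ} {D : ℤ} (hx : 0 < x.2) (h : x.2 ∣ D) :
    (D : ℝ) * fracVal x ∈ intRange := by
  obtain ⟨k, rfl⟩ := h
  refine ⟨k * x.1, ?_⟩
  have : (x.2 : ℝ) ≠ 0 := by exact_mod_cast hx.ne'
  simp only [eq_intCast, fracVal]
  push_cast
  field_simp

theorem mul_weighted_mem_intRange {κ : Type} [DecidableEq κ] {L : Table κ}
    (hL : ∀ e ∈ L, 0 < e.2.2) (k : κ) :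
    (((L.map fun e => e.2.2).prod : ℤ) : ℝ) * weighted L (fun k' => if k' = k then 1 else 0) ∈
      intRange := by
  rw [weighted, ← List.sum_map_mul_left]
  refine list_sum_mem fun v hv => ?_
  obtain ⟨e, he, rfl⟩ := List.mem_map.1 hv
  rw [← mul_assoc]
  refine mul_mem (mul_fracVal_mem_intRange (hL e he)
    (List.dvd_prod (List.mem_map_of_mem he))) ?_
  split_ifs
  exacts [one_mem _, zero_mem _]

theorem payBound_cons (e : KeyPay × ℤ × ℤ) (L : Table KeyPay) :
    payBound (e :: L) = (e.2.1 * e.2.1 + 1) * payBound L := by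
  simp [payBound]

theorem one_le_payBound (L : Table KeyPay) : 1 ≤ payBound L := by
  induction L with
  | nil => simp [payBound]
  | cons e L ih =>
    rw [payBound_cons]
    nlinarith [mul_self_nonneg e.2.1]

theorem weighted_add_one_le_payBound {L : Table KeyPay} (hL : ∀ e ∈ L, 0 < e.2.2) (k : KeyPay) :
    weighted L (fun k' => if k' = k then 1 else 0) + 1 ≤ payBound L := by
  induction L with
  | nil => simp [weighted, payBound]
  | cons e L ih =>
    have h1 := ih fun e' he' => hL e' (List.mem_cons_of_mem _ he')
    have h2 : fracVal e.2 * (if e.1 = k then 1 else 0) ≤ (e.2.1 : ℝ) * e.2.1 := by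
      split_ifs
      · rw [mul_one, fracVal]
        have h3 : (1 : ℝ) ≤ e.2.2 := by exact_mod_cast hL e List.mem_cons_self
        have h4 : (e.2.1 : ℝ) ≤ e.2.1 * e.2.1 := by
          have : e.2.1 ≤ e.2.1 * e.2.1 := by
            rcases le_or_gt e.2.1 0 with h | h <;> nlinarith
          exact_mod_cast this
        rw [div_le_iff₀ (by linarith)]
        nlinarith [mul_self_nonneg (e.2.1 : ℝ)]
      · rw [mul_zero]
        exact mul_self_nonneg _
    have h3 : (1 : ℝ) ≤ payBound L := by exact_mod_cast one_le_payBound L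
    rw [weighted_cons, payBound_cons]
    push_cast
    nlinarith [mul_self_nonneg (e.2.1 : ℝ)]

theorem tableLength_eq {κ : Type} (L : Table κ) : tableLength L = L.length := by
  simp [tableLength]

namespace Instance

variable {I : Instance} {t : I.TypeProfile → I.ActionProfile → ℝ}
  {ξ : I.Agent → I.TypeProfile → I.Action → ℝ}
  {y : I.Agent → I.TypeProfile → I.Action → I.Outcome → ℝ}
  {T : Table KeyT} {X : Table KeyXi} {L : Table KeyPay}

theorem mem_flatten_fTable {q : ℤ × ℤ} :
    q ∈ I.fTable.flatten.flatten.flatten ↔ ∃ i θ a ω, ratFrac (I.F i θ a ω) = q := by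
  simp only [fTable, List.mem_flatten, List.mem_ofFn', Set.mem_range]
  constructor
  · rintro ⟨_, ⟨_, ⟨_, ⟨i, rfl⟩, h1⟩, h2⟩, h3⟩
    obtain ⟨θ, rfl⟩ := (List.mem_ofFn' _ _).1 h1
    obtain ⟨a, rfl⟩ := (List.mem_ofFn' _ _).1 h2
    obtain ⟨ω, rfl⟩ := (List.mem_ofFn' _ _).1 h3
    exact ⟨i, θ, a, ω, rfl⟩
  · rintro ⟨i, θ, a, ω, rfl⟩
    exact ⟨_, ⟨_, ⟨_, ⟨i, rfl⟩, (List.mem_ofFn' _ _).2 ⟨θ, rfl⟩⟩,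
      (List.mem_ofFn' _ _).2 ⟨a, rfl⟩⟩, (List.mem_ofFn' _ _).2 ⟨ω, rfl⟩⟩

theorem scaleFactor_pos (hL : ∀ e ∈ L, 0 < e.2.2) : 0 < scaleFactor I.fTable L := by
  refine mul_pos two_pos (mul_pos (List.prod_pos ?_) (List.prod_pos ?_))
  · intro x hx
    obtain ⟨q, hq, rfl⟩ := List.mem_map.1 hx
    obtain ⟨i, θ, a, ω, rfl⟩ := mem_flatten_fTable.1 hq
    exact ratFrac_den_pos _
  · intro x hx
    obtain ⟨e, he, rfl⟩ := List.mem_map.1 hx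
    exact hL e he

/-- Half of the scaling factor is a common denominator of all expected payments. -/
theorem one_lt_scaleFactor_mul (hy : Represents yKey L
      fun z : I.Agent × I.TypeProfile × I.Action × I.Outcome => y z.1 z.2.1 z.2.2.1 z.2.2.2)
    (i : I.Agent) (θ : I.AgentType) (x : I.Agent × I.TypeProfile × I.Action) (a a' : I.Action)
    (h : I.pay i θ a (y x.1 x.2.1 x.2.2) < I.pay i θ a' (y x.1 x.2.1 x.2.2)) :
    (1 : ℝ) < scaleFactor I.fTable L *
      (I.pay i θ a' (y x.1 x.2.1 x.2.2) - I.pay i θ a (y x.1 x.2.1 x.2.2)) := by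
  set D : ℤ := (I.fTable.flatten.flatten.flatten.map fun q => q.2).prod *
    (L.map fun e => e.2.2).prod with hD
  have hK : (scaleFactor I.fTable L : ℝ) = 2 * D := by
    rw [scaleFactor, ← hD]
    push_cast
    rfl
  have hDpos : (0 : ℝ) < D := by
    have h1 : (0 : ℝ) < scaleFactor I.fTable L := by exact_mod_cast scaleFactor_pos hy.den
    linarith
  have hint : ∀ a, (D : ℝ) * I.pay i θ a (y x.1 x.2.1 x.2.2) ∈ intRange := by
    intro a
    rw [pay, Finset.mul_sum]
    refine sum_mem fun ω _ => ?_
    have h1 := mul_weighted_mem_intRange hy.den (yKey (x.1, x.2.1, x.2.2, ω))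
    rw [hy.val] at h1
    have h2 := mul_fracVal_mem_intRange (ratFrac_den_pos (I.F i θ a ω))
      (List.dvd_prod (List.mem_map_of_mem (f := fun q : ℤ × ℤ => q.2)
        (mem_flatten_fTable.2 ⟨i, θ, a, ω, rfl⟩)))
    rw [fracVal_ratFrac] at h2
    have h3 := mul_mem h2 h1
    rw [hD, Int.cast_mul]
    rwa [mul_mul_mul_comm]
  obtain ⟨z, hz⟩ := sub_mem (hint a') (hint a)
  rw [← mul_sub, eq_intCast] at hz
  have hzpos : (0 : ℝ) < z := by
    rw [hz]
    exact mul_pos hDpos (sub_pos.2 h)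
  have hz1 : (1 : ℝ) ≤ z := by exact_mod_cast Int.cast_pos.1 hzpos
  rw [hK, mul_assoc, ← hz]
  linarith

/-- The tables computed by `menuTables` are those of a feasible menu; it is obtained from a
scheme by mixing it with the lottery over the multiples of its payment schemes, and the weight of
the lottery is small enough. -/
theorem IsScheme.exists_menu (h : I.IsScheme t ξ y)
    (hT : Represents tKey T fun z : I.TypeProfile × I.ActionProfile => t z.1 z.2)
    (hX : Represents xiKey X fun z : I.Agent × I.TypeProfile × I.Action => ξ z.1 z.2.1 z.2.2)
    (hY : Represents yKey L
      fun z : I.Agent × I.TypeProfile × I.Action × I.Outcome => y z.1 z.2.1 z.2.2.1 z.2.2.2)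
    {d K B : ℤ} (hd : 0 < d) (hK : K = scaleFactor I.fTable L)
    (hB : B = mainWeight I.numAgents d K L) :
    ∃ μ : I.Menu, μ.IsEncoding (Enc.enc
        (menuTables (I.fTable, I.costTable, L, K) B (B + tableLength L) T X)) ∧
      μ.Feasible ∧ I.schemeValue t y - 1 / d ≤ μ.value := by
  have hKpos : 0 < K := hK ▸ scaleFactor_pos hY.den
  have hKpos' : (0 : ℝ) < K := by exact_mod_cast hKpos
  choose br hbr hbest using exists_bestReply_eq hY h.y_nonneg hKpos.le
  choose z hz using fun j : Fin L.length => hY.keys L[j.1] (List.getElem_mem _)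
  let sch : Fin L.length → I.Agent × I.TypeProfile × I.Action :=
    fun j => ((z j).1, (z j).2.1, (z j).2.2.1)
  have hsch : ∀ j : Fin L.length, schemeKey (L[j.1]).1 = xiKey (sch j) := fun j => by
    rw [← hz]
    rfl
  let Q : Fin L.length → I.Outcome → ℝ := fun j => (K : ℝ) • y (sch j).1 (sch j).2.1 (sch j).2.2
  let σ : I.Agent → I.TypeProfile → I.Action → I.Action := fun i θ a =>
    if 0 < ξ i θ a then a else br i (θ i) (i, θ, a)
  -- Every payment scheme that is not zero has an entry in the table.
  have hcov : ∀ i θ a, y i θ a ≠ 0 → ∃ j, sch j = (i, θ, a) := by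
    intro i θ a hne
    obtain ⟨ω, hω⟩ := Function.ne_iff.1 hne
    obtain ⟨e, he, hk⟩ := hY.exists_entry (x := (i, θ, a, ω)) hω
    obtain ⟨j, hj, rfl⟩ := List.mem_iff_getElem.1 he
    have := yKey_injective ((hz ⟨j, hj⟩).trans hk)
    refine ⟨⟨j, hj⟩, ?_⟩
    simp only [sch, this]
  have hr : Relocates ξ y Q (fun i θ j => br i θ (sch j)) σ := by
    refine ⟨fun j ω => mul_nonneg hKpos'.le (h.y_nonneg _ _ _ ω), fun i θ j => hbest i θ (sch j),
      fun i θ a ha => if_pos (lt_of_le_of_ne (h.ξ_nonneg i θ a) ha.symm),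
      fun i θ a ha hne => ?_, fun i θ a ha _ a' => ?_⟩
    · obtain ⟨j, hj⟩ := hcov i θ a hne
      refine ⟨j, ?_⟩
      simp only [hj, σ, ha, lt_irrefl, if_false]
    · simp only [σ, ha, lt_irrefl, if_false]
      refine (hbest i (θ i) (i, θ, a)).pay_le_of_gap (fun b b' hb => ?_) a'
      rw [hK]
      exact one_lt_scaleFactor_mul hY i (θ i) (i, θ, a) b b' hb
  -- The bound for the payments in the lottery, and the resulting bounds for its weight.
  have hP0 : (0 : ℝ) ≤ payBound L := by exact_mod_cast zero_le_one.trans (one_le_payBound L)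
  have hC : ∀ j ω, Q j ω ≤ K * payBound L := by
    intro j ω
    refine mul_le_mul_of_nonneg_left ?_ hKpos'.le
    have h1 := weighted_add_one_le_payBound hY.den (yKey ((sch j).1, (sch j).2.1, (sch j).2.2, ω))
    rw [hY.val] at h1
    simp only at h1
    linarith
  set m : ℝ := (L.length : ℝ) with hm
  have hm0 : 0 ≤ m := Nat.cast_nonneg _
  have hd' : (0 : ℝ) < d := by exact_mod_cast hd
  have hW : 0 < 1 + (I.numAgents : ℝ) * (K * payBound L) :=
    add_pos_of_pos_of_nonneg one_pos (mul_nonneg (Nat.cast_nonneg _) (mul_nonneg hKpos'.le hP0))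
  have hBeq : (B : ℝ) = d * (m + 1) * (1 + I.numAgents * (K * payBound L)) := by
    rw [hB, mainWeight, tableLength_eq]
    push_cast
    ring
  have hB0 : (0 : ℝ) < B := by
    rw [hBeq]
    positivity
  have hNeq : ((B + tableLength L : ℤ) : ℝ) = B + m := by
    rw [tableLength_eq]
    push_cast
    rfl
  have hN : 0 < B + tableLength L := by
    have : (0 : ℝ) < ((B + tableLength L : ℤ) : ℝ) := by
      rw [hNeq]
      linarith
    exact_mod_cast this
  set N : ℤ := B + tableLength L
  have hN' : (0 : ℝ) < N := by exact_mod_cast hN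
  have hα : (0 : ℝ) < B / N := div_pos hB0 hN'
  have hβ : (0 : ℝ) < 1 / N := div_pos one_pos hN'
  have hαβ : (B / N : ℝ) + 1 / N * (Fintype.card (Fin L.length) : ℕ) = 1 := by
    rw [Fintype.card_fin, ← hm]
    field_simp
    rw [hNeq]
  have hmix := hr.isScheme hα.le hβ.le hαβ h
  obtain ⟨hfeas, hval⟩ := hmix.menu (hr.mixXi_ne_zero hα hβ h)
  have hT' := represents_mixTTable (c := (I.fTable, I.costTable, L, K)) (B := B) hT hbr hsch hN
  have hX' := represents_mixXiTable (c := (I.fTable, I.costTable, L, K)) (B := B) hX hbr hsch hN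
  have hY' := (represents_movedTable (c := (I.fTable, I.costTable, L, K)) (B := B) (σ := σ)
    hX hY hbr (fun _ _ _ => rfl) hN).append
      (represents_lotteryTable (c := (I.fTable, I.costTable, L, K)) hX hY hbr hsch hN)
  have hp := isPayTable_divTable
    (y := mixY (B / N : ℝ) (1 / N : ℝ) (fun i θ j => br i θ (sch j)) σ Q ξ y) hX' hY'
      (Relocates.mixXi_nonneg hα.le hβ.le h)
  refine ⟨_, ?_, hfeas, ?_⟩
  · exact ⟨_, _, _, hT'.isTable_consolidate tKey_injective enc_tKey,
      hX'.isTable_consolidate xiKey_injective enc_xiKey, hp, rfl⟩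
  rw [hval]
  refine le_trans ?_ (hr.value_ge hβ.le hαβ h hC)
  rw [Fintype.card_fin, ← hm]
  refine sub_le_sub_left ?_ _
  rw [one_div_mul_eq_div, div_le_div_iff₀ hN' hd', one_mul, hNeq, hBeq]
  nlinarith [mul_pos hd' hW]

end Instance

/-- The algorithm turns optimal solutions of the linear program into menus. -/
theorem exists_prog_menu :
    ∃ (f : Prog) (P : Polynomial ℕ), ∀ (I : Instance) (s : I.LPPoint) (d : Data),
      s.Optimal → s.IsEncoding d → ∀ ε : ℚ, 0 < ε →
        ∃ (μ : I.Menu) (d' : Data) (time : ℕ),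
          Runs f (Data.ofList [I.enc, d, encRat ε]) d' time ∧
          time ≤ P.eval (I.size + d.size + (encRat ε).size) ∧
          μ.IsEncoding d' ∧ μ.Feasible ∧ I.supValue - (ε : ℝ) ≤ μ.value := by
  obtain ⟨f, P, hf⟩ := PolyTime.algorithm
  refine ⟨f, P.comp (Polynomial.X + 4), fun I s d hs hd ε hε => ?_⟩
  obtain ⟨T, X, L, G, rfl, hT, hX, hY⟩ := hd.exists_tables
  obtain ⟨time, hrun, htime⟩ := hf (I.table, (T, X, L, G, 0), ratFrac ε, 0)
  obtain ⟨μ, hμ, hfeas, hval⟩ := hs.1.isScheme.exists_menu hT hX hY (ratFrac_den_pos ε) rfl rfl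
  have hin : enc ((I.table, (T, X, L, G, 0), ratFrac ε, 0) :
      InstanceTable × PointTable × (ℤ × ℤ) × ℤ) =
      Data.ofList [I.enc, enc ((T, X, L, G, 0) : PointTable), encRat ε] := by
    rw [← I.enc_table]
    rfl
  refine ⟨μ, _, time, hin ▸ hrun, htime.trans ?_, hμ, hfeas, ?_⟩
  · -- Joining the three inputs to a list adds `4` to their sizes.
    rw [Polynomial.eval_comp]
    refine Polynomial.eval_mono P ?_
    rw [sz, hin]
    simp only [Data.ofList, Data.size, Polynomial.eval_add, Polynomial.eval_X,
      Polynomial.eval_ofNat, Instance.size]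
    simp
    omega
  · -- The loss is at most `1 / ε.den`, and the numerator of `ε` is at least `1`.
    have h1 : (1 : ℝ) / (ratFrac ε).2 ≤ ε := by
      rw [← fracVal_ratFrac ε, fracVal]
      have h2 : (1 : ℝ) ≤ (ratFrac ε).1 := by exact_mod_cast Rat.num_pos.2 hε
      have h3 : (0 : ℝ) < (ratFrac ε).2 := by exact_mod_cast ratFrac_den_pos ε
      exact div_le_div_of_nonneg_right h2 h3.le
    have h2 := hs.supValue_le
    rw [Instance.LPPoint.value_eq hs.1.isScheme] at h2
    linarith

end BayesianPMA

theorem mainTheorem9 :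
    -- bounds on the payments exist
    (∃ τ : ℕ → ℝ, IsPaymentBound τ) ∧
    -- the two optimization problems have finite values, and `SUP ≤ LP`
    (∀ I : Instance, IsLUB I.menuValues I.supValue ∧ IsLUB I.lpValues I.lpValue ∧
      I.supValue ≤ I.lpValue) ∧
    -- feasible solutions of the linear program can be regularized at small loss
    (∀ τ : ℕ → ℝ, IsPaymentBound τ → ∀ (I : Instance) (s : I.LPPoint), s.Feasible →
      ∀ ε : ℝ, 0 < ε → ∃ s' : I.LPPoint, s'.Feasible ∧ ¬ s'.Irregular ∧
        s.value - ε * (I.numAgents * τ I.size + 1) ≤ s'.value) ∧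
    -- recovering a menu from an optimal solution of the linear program in polynomial time
    (∃ (f : Prog) (P : Polynomial ℕ), ∀ (I : Instance) (s : I.LPPoint) (d : Data),
      s.Optimal → s.IsEncoding d → ∀ ε : ℚ, 0 < ε →
        ∃ (μ : I.Menu) (d' : Data) (time : ℕ),
          Runs f (Data.ofList [I.enc, d, encRat ε]) d' time ∧
          time ≤ P.eval (I.size + d.size + (encRat ε).size + ⌈1 / ε⌉₊) ∧
          μ.IsEncoding d' ∧ μ.Feasible ∧
          ∀ τ : ℕ → ℝ, IsPaymentBound τ →
            I.supValue - (ε : ℝ) * (I.numAgents * τ I.size + 1) ≤ μ.value) := by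
  refine ⟨BayesianPMA.exists_isPaymentBound, fun I => ⟨I.isLUB_menuValues, I.isLUB_lpValues,
    I.supValue_le_lpValue⟩, fun τ hτ I s hs ε hε => ?_, ?_⟩
  · obtain ⟨s', hs', hreg, hv⟩ := BayesianPMA.Instance.exists_regular_lpPoint hs hε
    refine ⟨s', hs', hreg, le_trans (sub_le_sub_left ?_ _) hv⟩
    have := mul_nonneg (Nat.cast_nonneg (α := ℝ) I.numAgents) (hτ.nonneg I)
    nlinarith
  · obtain ⟨f, P, hf⟩ := BayesianPMA.exists_prog_menu
    refine ⟨f, P, fun I s d hs hd ε hε => ?_⟩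
    obtain ⟨μ, d', time, hrun, htime, hμ, hfeas, hv⟩ := hf I s d hs hd ε hε
    refine ⟨μ, d', time, hrun,
      htime.trans (BayesianPMA.Polynomial.eval_mono P (Nat.le_add_right _ _)), hμ, hfeas,
      fun τ hτ => le_trans (sub_le_sub_left ?_ _) hv⟩
    have h1 := mul_nonneg (Nat.cast_nonneg (α := ℝ) I.numAgents) (hτ.nonneg I)
    have h2 : (0 : ℝ) < ε := by exact_mod_cast hε
    nlinarith
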